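/- Let $D$ be a semisimple two-dimensional real algebra (i.e. $D=\mathbb C$ or $D=\mathbb R\oplus\mathbb R$) with its non-trivial involution $d\mapsto\bar d$, let $n$ be a natural number, and let $\psi$ be a non-trivial (continuous, unitary) additive character of $\mathbb R$. Let $H=H^n(D)$ be the real vector space of hermitian $n\times n$ matrices over $D$, let $S=S^n(D)\subset H$ be the open set of invertible ones, and let $N$ be the group of upper triangular $n\times n$ matrices over $D$ with unit diagonal, acting on $H$ by $x\mapsto \bar u^t x u$. Put $\chi(u)=\psi\bigl(\sum_{i=1}^{n-1}(u_{i,i+1}+\overline{u_{i,i+1}})\bigr)$ for $u\in N$. A matrix $g\in H$ is called relevant if $\chi$ is trivial on its stabilizer $N_g$. Let $(X,V)$ be $(H,\mathbb R)$ or $(S,\mathbb R^\times)$, so that $X=\{x\in H:\det x\in V\}$. Let $\mathcal S^{\det,V}(X)$ be the space of smooth functions $\Phi:X\to\mathbb C$ such that $(h\circ\det)\,\Phi$ is a Schwartz function on $X$ for every Schwartz function $h$ on $V$; here the Schwartz functions on an open set $U$ ($U=V$ or $U=X$) of a real vector space $E$ are the restrictions to $U$ of those Schwartz functions on $E$ that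 vanish with all their derivatives outside $U$. For an invertible real diagonal matrix $a$ and for a relevant $g\in X$ put $$\Omega(\Phi,a)=\int_N\Phi(\bar u^t a u)\,\chi(u)\,du,\qquad \Omega(\Phi,g)=\int_{N/N_g}\Phi(\bar u^t g u)\,\chi(u)\,du,$$ where $du$ is a Haar measure on $N$, respectively an $N$-invariant locally finite Borel measure on the space $N/N_g$ of cosets of $N_g$ in $N$. Then for every relevant $g\in X$: (1) the integral defining $\Omega(\Phi,g)$ converges absolutely for every $\Phi\in\mathcal S^{\det,V}(X)$; (2) if $\Phi\in\mathcal S^{\det,V}(X)$ satisfies $\Omega(\Phi,a)=0$ for every invertible real diagonal matrix $a$, then $\Omega(\Phi,g)=0$; (3) in other words, regular orbital integrals are dense among all orbital integrals: the functional $\Phi\mapsto\Omega(\Phi,g)$ on $\mathcal S^{\det,V}(X)$ lies in the closure, for the topology of pointwise convergence, of the linear span of the functionals $\Phi\mapsto\Omega(\Phi,a)$. -/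

import Mathlib

open scoped Matrix ContDiff

attribute [local instance] Matrix.normedAddCommGroup Matrix.normedSpace

namespace Kloosterman

/-! ### Schwartz functions -/

section Schwartz

variable {E F : Type*} [NormedAddCommGroup E] [NormedSpace ℝ E]
  [NormedAddCommGroup F] [NormedSpace ℝ F]

/-- `f` is a Schwartz function on the open (semi-algebraic) set `U ⊆ E`: on `U` it agrees with a
Schwartz function on the vector space `E` that vanishes with all its derivatives outside `U`.
The values of `f` outside `U` play no role. -/
def IsSchwartzOn (U : Set E) (f : E → ℂ) : Prop :=
  ∃ φ : SchwartzMap E ℂ, (∀ x ∈ U, φ x = f x) ∧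
    ∀ x, x ∉ U → ∀ k : ℕ, iteratedFDeriv ℝ k (φ : E → ℂ) x = 0

/-- The space `𝒮^{p,V}(p⁻¹ V)` of functions that are Schwartz along the fibres of
`p : p⁻¹ V → V`: `f` is smooth on `p⁻¹ V` and `(h ∘ p) f` is Schwartz on `p⁻¹ V` for every
Schwartz function `h` on `V`. -/
structure SchwartzAlong (p : E → F) (V : Set F) (f : E → ℂ) : Prop where
  smooth : ContDiffOn ℝ ∞ f (p ⁻¹' V)
  schwartz : ∀ h : F → ℂ, IsSchwartzOn V h → IsSchwartzOn (p ⁻¹' V) fun x => h (p x) * f x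

end Schwartz

/-! ### The unipotent group -/

section Unipotent

variable (n : ℕ) (D : Type*) [NormedCommRing D]

/-- The group of upper triangular matrices with unit diagonal. -/
def unip : Subgroup (GL (Fin n) D) where
  carrier := {u | (∀ i j, j < i → u.val i j = 0) ∧ ∀ i, u.val i i = 1}
  one_mem' := by
    refine ⟨fun i j h => ?_, fun i => ?_⟩
    · simp [h.ne']
    · simp
  mul_mem' := by
    rintro u v ⟨hu, hu'⟩ ⟨hv, hv'⟩
    refine ⟨fun i j h => ?_, fun i => ?_⟩
    · rw [Units.val_mul, Matrix.mul_apply]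
      refine Finset.sum_eq_zero fun k _ => ?_
      rcases lt_or_ge k i with hk | hk
      · rw [hu i k hk, zero_mul]
      · rw [hv k j (h.trans_le hk), mul_zero]
    · rw [Units.val_mul, Matrix.mul_apply, Finset.sum_eq_single i]
      · rw [hu', hv', mul_one]
      · intro k _ hk
        rcases lt_or_gt_of_ne hk with hk | hk
        · rw [hu i k hk, zero_mul]
        · rw [hv k i hk, mul_zero]
      · simp
  inv_mem' := by
    rintro u ⟨hu, hu'⟩
    have hut : ∀ i j, j < i → (u⁻¹).val i j = 0 := by
      have hb : Matrix.BlockTriangular u.val (id : Fin n → Fin n) := fun i j h => hu i j h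
      have : Invertible u.val := u.invertible
      have := Matrix.blockTriangular_inv_of_blockTriangular hb
      intro i j h
      have h2 := this (i := i) (j := j) h
      rwa [← Matrix.coe_units_inv] at h2
    refine ⟨hut, fun i => ?_⟩
    have h1 : (u.val * (u⁻¹).val) i i = 1 := by
      rw [← Units.val_mul, mul_inv_cancel]; simp
    rw [Matrix.mul_apply, Finset.sum_eq_single i] at h1
    · rwa [hu', one_mul] at h1
    · intro k _ hk
      rcases lt_or_gt_of_ne hk with hk | hk
      · rw [hu i k hk, zero_mul]
      · rw [hut k i hk, mul_zero]
    · simp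

/-- The unipotent group carries its Borel `σ`-algebra. -/
instance : MeasurableSpace (unip n D) := borel _

instance : BorelSpace (unip n D) := ⟨rfl⟩

variable {n D}

theorem unip_mul_superdiag (u v : unip n D) (i j : Fin n) (hij : (i : ℕ) + 1 = j) :
    (u * v).1.val i j = u.1.val i j + v.1.val i j := by
  have hne : i ≠ j := by intro h; rw [h] at hij; omega
  change (u.1.val * v.1.val) i j = _
  rw [Matrix.mul_apply, ← Finset.sum_subset (Finset.subset_univ {i, j}), Finset.sum_pair hne,
    u.2.2 i, v.2.2 j, one_mul, mul_one, add_comm]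
  intro k _ hk
  simp only [Finset.mem_insert, Finset.mem_singleton, not_or] at hk
  rcases lt_or_gt_of_ne hk.1 with h | h
  · rw [u.2.1 i k h, zero_mul]
  · have h3 : j < k := by
      have h4 := hk.2
      rw [Fin.lt_def] at h ⊢
      rw [Fin.ext_iff] at h4
      omega
    rw [v.2.1 k j h3, mul_zero]

variable [NormedAlgebra ℝ D]

/-- The character `χ_ψ(u) = ψ (∑ (u_{i,i+1} + conj u_{i,i+1}))`. The real number `d + conj d`
is the trace of `d`, see `algebraMap_trace`. -/
noncomputable def chi (ψ : AddChar ℝ Circle) (u : unip n D) : Circle :=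
  ψ (∑ i : Fin n, ∑ j : Fin n,
    if (i : ℕ) + 1 = j then Algebra.trace ℝ D (u.1.val i j) else 0)

theorem chi_mul (ψ : AddChar ℝ Circle) (u v : unip n D) :
    chi ψ (u * v) = chi ψ u * chi ψ v := by
  unfold chi
  rw [← AddChar.map_add_eq_mul, ← Finset.sum_add_distrib]
  congr 1
  refine Finset.sum_congr rfl fun i _ => ?_
  rw [← Finset.sum_add_distrib]
  refine Finset.sum_congr rfl fun j _ => ?_
  split_ifs with h
  · rw [unip_mul_superdiag u v i j h, map_add]
  · rw [add_zero]

end Unipotent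

/-! ### Hermitian matrices and the action of the unipotent group -/

section Hermitian

variable (n : ℕ) (D : Type*) [NormedCommRing D] [NormedAlgebra ℝ D] [StarRing D] [StarModule ℝ D]

/-- The real vector space `H` of hermitian matrices of size `n` over `D`. -/
noncomputable abbrev Herm : Submodule ℝ (Matrix (Fin n) (Fin n) D) :=
  selfAdjoint.submodule ℝ (Matrix (Fin n) (Fin n) D)

variable {n D}

/-- In a two-dimensional real algebra with a non-trivial involution, `d + conj d` is the real
number `trace d`. -/
theorem algebraMap_trace (hD : Module.finrank ℝ D = 2) (hstar : ∃ d : D, star d ≠ d) (d : D) :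
    algebraMap ℝ D (Algebra.trace ℝ D d) = d + star d := by
  have : Nontrivial D := Module.nontrivial_of_finrank_pos (R := ℝ) (by omega)
  have : Module.Finite ℝ D := Module.finite_of_finrank_pos (by omega)
  have hsm : ∀ r : ℝ, star (algebraMap ℝ D r) = algebraMap ℝ D r := fun r => by
    simp [Algebra.algebraMap_eq_smul_one, star_smul]
  -- a non-scalar element forms a basis together with `1`
  have hli : ∀ x : D, (∀ r : ℝ, algebraMap ℝ D r ≠ x) → LinearIndependent ℝ ![1, x] := by
    intro x hx
    rw [LinearIndependent.pair_iff]
    intro s t hst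
    have ht : t = 0 := by
      by_contra ht
      refine hx (-(t⁻¹ * s)) ?_
      have h1 : t⁻¹ • (s • (1 : D) + t • x) = 0 := by rw [hst, smul_zero]
      rw [smul_add, smul_smul, smul_smul, inv_mul_cancel₀ ht, one_smul] at h1
      rw [Algebra.algebraMap_eq_smul_one, neg_smul]
      exact neg_eq_of_add_eq_zero_right h1
    subst ht
    refine ⟨?_, rfl⟩
    simpa using hst
  have hbas : ∀ x : D, (∀ r : ℝ, algebraMap ℝ D r ≠ x) →
      ∃ b : Module.Basis (Fin 2) ℝ D, b 0 = 1 ∧ b 1 = x := fun x hx =>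
    ⟨basisOfLinearIndependentOfCardEqFinrank (hli x hx) (by simp [hD]), by simp, by simp⟩
  have hfix : ∀ x : D, star x = x → ∃ r : ℝ, algebraMap ℝ D r = x := by
    intro x hx
    by_contra! hne
    obtain ⟨e, he⟩ := hstar
    apply he
    obtain ⟨b, b0, b1⟩ := hbas x hne
    rw [← b.sum_repr e, Fin.sum_univ_two, b0, b1, star_add, star_smul, star_smul, star_one, hx]
    simp
  by_cases hd : ∃ r : ℝ, algebraMap ℝ D r = d
  · obtain ⟨r, rfl⟩ := hd
    rw [Algebra.trace_algebraMap, hD, hsm, two_smul, map_add]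
  · push Not at hd
    obtain ⟨r, hr⟩ := hfix (d + star d) (by simp [add_comm])
    obtain ⟨s, hs⟩ := hfix (d * star d) (by simp [mul_comm])
    have hsq : d * d = (-s) • (1 : D) + r • d := by
      rw [neg_smul, ← Algebra.algebraMap_eq_smul_one, hs, Algebra.smul_def, hr]
      ring
    obtain ⟨b, b0, b1⟩ := hbas d hd
    have h1 : b.repr d = Finsupp.single 1 1 := by
      have h := b.repr_self 1
      rwa [b1] at h
    have h0 : b.repr 1 = Finsupp.single 0 1 := by
      have h := b.repr_self 0
      rwa [b0] at h
    have ht : Algebra.trace ℝ D d = r := by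
      rw [Algebra.trace_eq_matrix_trace b, Matrix.trace_fin_two,
        Algebra.leftMulMatrix_eq_repr_mul, Algebra.leftMulMatrix_eq_repr_mul, b0, b1, mul_one,
        hsq, map_add, map_smul, map_smul, h0, h1]
      simp
    rw [ht, hr]

/-- The determinant of a hermitian matrix as a real number: the matrix determinant `d ∈ D` is
fixed by the involution, so it is the real number `(d + conj d) / 2`, see `algebraMap_detR`. -/
noncomputable def detR (x : Herm n D) : ℝ :=
  Algebra.trace ℝ D x.1.det / 2

theorem algebraMap_detR (hD : Module.finrank ℝ D = 2) (hstar : ∃ d : D, star d ≠ d)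
    (x : Herm n D) : algebraMap ℝ D (detR x) = x.1.det := by
  have hx : x.1ᴴ = x.1 := x.2
  have h : star x.1.det = x.1.det := by rw [← Matrix.det_conjTranspose, hx]
  rw [detR, div_eq_inv_mul, map_mul, algebraMap_trace hD hstar, h, ← two_mul,
    ← map_ofNat (algebraMap ℝ D) 2, ← mul_assoc, ← map_mul, inv_mul_cancel₀ two_ne_zero, map_one,
    one_mul]

variable (n D) in
/-- The space of functions that are Schwartz along the fibres of the determinant. For `V = ℝ` these
are functions on the space of all hermitian matrices, for `V = ℝ ∖ {0}` functions on the set of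
invertible hermitian matrices (with irrelevant values elsewhere). -/
def schwartzAlongDet (V : Set ℝ) : Set (Herm n D → ℂ) :=
  {Φ | SchwartzAlong (detR : Herm n D → ℝ) V Φ}

/-- The action `x ↦ conj(u)ᵗ x u` of the unipotent group on hermitian matrices. -/
noncomputable def act (u : unip n D) (x : Herm n D) : Herm n D :=
  ⟨u.1.valᴴ * x.1 * u.1.val, by
    have hx : x.1ᴴ = x.1 := x.2
    change (u.1.valᴴ * x.1 * u.1.val)ᴴ = _
    simp [Matrix.conjTranspose_mul, hx, Matrix.mul_assoc]⟩

theorem act_one (x : Herm n D) : act 1 x = x := by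
  apply Subtype.ext
  simp [act]

theorem act_mul (u v : unip n D) (x : Herm n D) : act (u * v) x = act v (act u x) := by
  apply Subtype.ext
  simp [act, Matrix.conjTranspose_mul, Matrix.mul_assoc]

/-- The stabilizer `N_g`. -/
def stab (g : Herm n D) : Subgroup (unip n D) where
  carrier := {u | act u g = g}
  one_mem' := act_one g
  mul_mem' := by
    intro u v (hu : act u g = g) (hv : act v g = g)
    change act (u * v) g = g
    rw [act_mul, hu, hv]
  inv_mem' := by
    intro u (hu : act u g = g)
    change act u⁻¹ g = g
    conv_lhs => rw [← hu]
    rw [← act_mul, mul_inv_cancel, act_one]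

/-- `g` is relevant if the character `χ_ψ` is trivial on the stabilizer of `g`. -/
def IsRelevant (ψ : AddChar ℝ Circle) (g : Herm n D) : Prop :=
  ∀ u ∈ stab g, chi ψ u = 1

/-- The invertible real diagonal matrix with diagonal entries `a i`. -/
noncomputable def diagA (a : Fin n → ℝˣ) : Herm n D :=
  ⟨Matrix.diagonal fun i => algebraMap ℝ D (a i : ℝ), by
    change (Matrix.diagonal fun i => algebraMap ℝ D (a i : ℝ))ᴴ = _
    rw [Matrix.diagonal_conjTranspose]
    congr 1
    funext i
    simp [Pi.star_apply, Algebra.algebraMap_eq_smul_one, star_smul]⟩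

/-! ### Kloosterman integrals -/

/-- The regular Kloosterman integral `Ω(Φ)(a) = ∫_N Φ(conj(u)ᵗ a u) χ(u) du`, where `ν` is a Haar
measure on `N`. -/
noncomputable def regularIntegral (ψ : AddChar ℝ Circle) (ν : MeasureTheory.Measure (unip n D))
    (Φ : Herm n D → ℂ) (a : Fin n → ℝˣ) : ℂ :=
  ∫ u, Φ (act u (diagA a)) * (chi ψ u : ℂ) ∂ν

/-- For a relevant `g`, the function `u ↦ Φ(conj(u)ᵗ g u) χ(u)` on the coset space of `N` by `N_g`.
This function is invariant under left translation of `u` by `N_g`; Mathlib's `N ⧸ N_g` consists of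
the cosets `v N_g`, so it is evaluated at `u = v⁻¹`. -/
noncomputable def orbitFun (ψ : AddChar ℝ Circle) (Φ : Herm n D → ℂ) (g : Herm n D)
    (hg : IsRelevant ψ g) : unip n D ⧸ stab g → ℂ :=
  Quotient.lift (fun v : unip n D => Φ (act v⁻¹ g) * (chi ψ v⁻¹ : ℂ)) (by
    intro v w hvw
    have hs : v⁻¹ * w ∈ stab g := QuotientGroup.leftRel_apply.mp hvw
    have hv : v⁻¹ = (v⁻¹ * w) * w⁻¹ := by group
    have h1 : act v⁻¹ g = act w⁻¹ g := by
      rw [hv, act_mul, show act (v⁻¹ * w) g = g from hs]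
    have h2 : chi ψ v⁻¹ = chi ψ w⁻¹ := by
      rw [hv, chi_mul, hg _ hs, one_mul]
    simp only [h1, h2])

/-- The Kloosterman integral `Ω(Φ, g) = ∫_{N/N_g} Φ(conj(u)ᵗ g u) χ(u) du` over the orbit of a
relevant `g`, where `μ` is an invariant measure on `N/N_g`. -/
noncomputable def orbitIntegral (ψ : AddChar ℝ Circle) (Φ : Herm n D → ℂ) (g : Herm n D)
    (hg : IsRelevant ψ g) (μ : MeasureTheory.Measure (unip n D ⧸ stab g)) : ℂ :=
  ∫ q, orbitFun ψ Φ g hg q ∂μ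

end Hermitian

end Kloosterman

/-! The determinant is constant on orbits, so Φ may be multiplied by a function of the determinant
that is 1 at det g. This makes Φ a Schwartz function on the vector space H. The character is ψ(t) =
exp(iθt) with θ ≠ 0.

Testing relevance on Cayley transforms of nilpotent elements shows that each relevant orbit contains
a block diagonal matrix with blocks b w, where b ≠ 0 is real and w is the antidiagonal permutation
matrix; the last block may instead be the zero matrix of size 1 (`IsRel.exists_std`). The orbit of
such a matrix is parametrized bijectively by 1 + P for a nilpotent algebra P, with an inverse of
polynomial growth (`IsChart`). Hence Φ restricts to a Schwartz function on P, which gives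
convergence, and the invariant measure is a multiple of Lebesgue measure on P
(`exists_orbitIntegral_eq'`). Density follows formally from the vanishing statement (2) by
finite-dimensional duality (`mem_closure_span_of_forall`).

The vanishing statement (`Std.isLimit`) is proved by induction on n, using the Fourier transform on
H.

For invertible g of size n - 1, let `MS` be the integral of Φ over the directions of the orbit that
belong to the upper left block g; it is a function of the remaining diagonal variable. The Weil
formula for the quadratic form of g shows that the Fourier transform of `MS` at t ≠ 0 is a non-zero
multiple of the orbital integral at g of a Schwartz function of size n - 1 that does not depend on
g, namely the Fourier transform of `Desc` (`exists_OI_ft_desc`). So vanishing for diagonal g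
propagates to every invertible standard g of size n - 1 to which the induction applies
(`MS_eq_zero`). Moreover `Desc` is itself the reduction of the reversed Fourier transform of Φ along
a block of size one; hence the vanishing of all regular integrals passes to that Fourier transform
(`OI_diagA_ft_hrev_eq_zero`).

For a single block b w of size n the orbit is an affine subspace on which the character is linear.
The Fourier transform carries this integral to one over a coset of the orthogonal complement, and
that is a reduction along b⁻¹ w of size n - 1 (`OI_wH_eq_zero`). For a sum of several blocks the
first block is integrated out, and the induction hypothesis is applied both to the rest and to the
matrices obtained when the rest is diagonal. -/

namespace Kloosterman

open MeasureTheory MeasureTheory.Measure SchwartzMap Module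

/-! ### Schwartz functions on finite-dimensional spaces -/

section SchwartzFunctions

variable {E F G : Type*} [NormedAddCommGroup E] [NormedSpace ℝ E]
  [NormedAddCommGroup F] [NormedSpace ℝ F] [NormedAddCommGroup G] [NormedSpace ℝ G]

/-- The function `f` is (the underlying function of) a Schwartz function. -/
def IsSchwartz (f : E → ℂ) : Prop := ∃ φ : SchwartzMap E ℂ, ⇑φ = f

theorem hasTemperateGrowth_prodMk {f : E → F} {g : E → G} (hf : f.HasTemperateGrowth)
    (hg : g.HasTemperateGrowth) : (fun x => (f x, g x)).HasTemperateGrowth := by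
  have h1 := (ContinuousLinearMap.inl ℝ F G).hasTemperateGrowth.comp hf
  have h2 := (ContinuousLinearMap.inr ℝ F G).hasTemperateGrowth.comp hg
  convert h1.add h2 using 1
  funext x; simp

theorem LinearMap.hasTemperateGrowth [FiniteDimensional ℝ E] (f : E →ₗ[ℝ] F) :
    Function.HasTemperateGrowth f :=
  (LinearMap.toContinuousLinearMap f).hasTemperateGrowth

/-- The additive character `t ↦ exp (i θ t)`. -/
noncomputable def expi (θ t : ℝ) : ℂ := Complex.exp (θ * t * Complex.I)

theorem expi_add (θ s t : ℝ) : expi θ (s + t) = expi θ s * expi θ t := by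
  rw [expi, expi, expi, ← Complex.exp_add]; congr 1; push_cast; ring

@[simp] theorem expi_zero (θ : ℝ) : expi θ 0 = 1 := by simp [expi]

@[simp] theorem norm_expi (θ t : ℝ) : ‖expi θ t‖ = 1 := by
  rw [expi, ← Complex.ofReal_mul, Complex.norm_exp_ofReal_mul_I]

theorem expi_ne_zero (θ t : ℝ) : expi θ t ≠ 0 := Complex.exp_ne_zero _

theorem expi_neg_left (θ t : ℝ) : expi (-θ) t = expi θ (-t) := by simp [expi]

theorem continuous_expi (θ : ℝ) : Continuous (expi θ) := by
  unfold expi; fun_prop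

theorem hasTemperateGrowth_expi (θ : ℝ) : (expi θ).HasTemperateGrowth := by
  have hd : ∀ n : ℕ, iteratedDeriv n (expi θ) = fun t => (θ * Complex.I) ^ n * expi θ t := by
    intro n
    induction n with
    | zero => simp
    | succ n ih =>
      rw [iteratedDeriv_succ, ih]
      funext t
      have h : HasDerivAt (expi θ) (θ * Complex.I * expi θ t) t := by
        have h1 : HasDerivAt (fun s : ℝ => (θ * s * Complex.I : ℂ)) (θ * Complex.I) t := by
          have := ((Complex.ofRealCLM.hasDerivAt (x := t)).const_mul (θ : ℂ)).mul_const Complex.I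
          simpa using this
        have := h1.cexp
        rwa [mul_comm] at this
      rw [(h.const_mul _).deriv]; ring
  refine ⟨?_, fun n => ⟨0, |θ| ^ n, fun t => ?_⟩⟩
  · unfold expi
    exact (((contDiff_const.mul Complex.ofRealCLM.contDiff).mul contDiff_const)).cexp
  · rw [norm_iteratedFDeriv_eq_norm_iteratedDeriv, hd]
    simp

theorem hasTemperateGrowth_expi_comp (θ : ℝ) {q : E → ℝ} (hq : q.HasTemperateGrowth) :
    (fun x => expi θ (q x)).HasTemperateGrowth :=
  (hasTemperateGrowth_expi θ).comp hq

namespace IsSchwartz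

variable {f g : E → ℂ}

theorem continuous (hf : IsSchwartz f) : Continuous f := by
  obtain ⟨φ, rfl⟩ := hf; exact φ.continuous

theorem integrable [MeasurableSpace E] [BorelSpace E] [SecondCountableTopology E]
    (hf : IsSchwartz f) (μ : Measure E) [μ.HasTemperateGrowth] : Integrable f μ := by
  obtain ⟨φ, rfl⟩ := hf; exact φ.integrable

theorem const_mul (hf : IsSchwartz f) (c : ℂ) : IsSchwartz fun x => c * f x := by
  obtain ⟨φ, rfl⟩ := hf; exact ⟨c • φ, rfl⟩

theorem mul_temperate (hf : IsSchwartz f) {m : E → ℂ} (hm : m.HasTemperateGrowth) :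
    IsSchwartz fun x => f x * m x := by
  obtain ⟨φ, rfl⟩ := hf
  refine ⟨smulLeftCLM ℂ m φ, ?_⟩
  funext x
  rw [smulLeftCLM_apply_apply hm, smul_eq_mul, mul_comm]

/-- A left inverse of polynomial growth bounds ‖x‖ by a power of 1 + ‖m x‖, so decay of `f` along `m
x` is decay in `x`. For orbit maps this says that Schwartz functions restrict to Schwartz functions
in the coordinates of the orbit. -/
theorem comp_leftInverse {f : F → ℂ} (hf : IsSchwartz f) {m : E → F} (hm : m.HasTemperateGrowth)
    {r : F → E} (hr : r.HasTemperateGrowth) (h : ∀ x, r (m x) = x) :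
    IsSchwartz fun x => f (m x) := by
  obtain ⟨φ, rfl⟩ := hf
  obtain ⟨k, C, hC⟩ := hr.2 0
  refine ⟨compCLM ℂ hm ⟨k, C, fun x => ?_⟩ φ, rfl⟩
  have := hC (m x)
  rwa [norm_iteratedFDeriv_zero, h] at this

theorem comp_linearMap [FiniteDimensional ℝ E] [FiniteDimensional ℝ F] {f : F → ℂ}
    (hf : IsSchwartz f) (m : E →ₗ[ℝ] F) (hm : Function.Injective m) (v : F) :
    IsSchwartz fun x => f (v + m x) := by
  obtain ⟨r, hr⟩ := m.exists_leftInverse_of_injective (LinearMap.ker_eq_bot.2 hm)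
  refine hf.comp_leftInverse (r := fun y => r (y - v)) ?_ ?_ ?_
  · exact (Function.HasTemperateGrowth.const v).add (LinearMap.hasTemperateGrowth m)
  · exact (LinearMap.hasTemperateGrowth r).comp
      (Function.HasTemperateGrowth.id.sub (Function.HasTemperateGrowth.const v))
  · intro x
    rw [add_sub_cancel_left]
    exact LinearMap.congr_fun hr x

theorem comp_linearEquiv [FiniteDimensional ℝ E] [FiniteDimensional ℝ F] {f : F → ℂ}
    (hf : IsSchwartz f) (m : E ≃ₗ[ℝ] F) : IsSchwartz fun x => f (m x) := by
  simpa using hf.comp_linearMap m.toLinearMap m.injective 0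

end IsSchwartz

/-- The decay of the partial derivatives of a Schwartz function on a product. -/
theorem norm_iteratedFDeriv_left_le (φ : SchwartzMap (E × F) ℂ) (k : ℕ) (x : E) (y : F) :
    ‖iteratedFDeriv ℝ k (fun x => φ (x, y)) x‖ ≤ ‖iteratedFDeriv ℝ k φ (x, y)‖ := by
  have h1 : (fun x => φ (x, y)) = (fun z => φ (z + (0, y))) ∘ ContinuousLinearMap.inl ℝ E F := by
    funext x; simp
  have h2 : ContDiff ℝ k (fun z => φ (z + (0, y))) :=
    (φ.smooth k).comp (contDiff_id.add contDiff_const)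
  rw [h1, ContinuousLinearMap.iteratedFDeriv_comp_right _ h2 _ le_rfl,
    iteratedFDeriv_comp_add_right]
  refine (ContinuousMultilinearMap.norm_compContinuousLinearMap_le _ _).trans ?_
  have : (ContinuousLinearMap.inl ℝ E F x + (0, y)) = (x, y) := by simp
  rw [this]
  refine mul_le_of_le_one_right (norm_nonneg _) (Finset.prod_le_one (fun _ _ => norm_nonneg _) ?_)
  intro i _
  exact ContinuousLinearMap.norm_inl_le_one ℝ E F

theorem continuous_iteratedFDeriv_left (φ : SchwartzMap (E × F) ℂ) (k : ℕ) :
    Continuous fun z : E × F => iteratedFDeriv ℝ k (fun x => φ (x, z.2)) z.1 := by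
  have : (fun z : E × F => iteratedFDeriv ℝ k (fun x => φ (x, z.2)) z.1) =
      fun z => (iteratedFDeriv ℝ k φ z).compContinuousLinearMap
        fun _ => ContinuousLinearMap.inl ℝ E F := by
    funext ⟨x, y⟩
    have h1 : (fun x => φ (x, y)) =
        (fun z => φ (z + (0, y))) ∘ ContinuousLinearMap.inl ℝ E F := by
      funext x; simp
    have h2 : ContDiff ℝ k (fun z => φ (z + (0, y))) :=
      (φ.smooth k).comp (contDiff_id.add contDiff_const)
    dsimp only
    rw [h1, ContinuousLinearMap.iteratedFDeriv_comp_right _ h2 _ le_rfl,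
      iteratedFDeriv_comp_add_right]
    simp
  rw [this]
  exact (ContinuousMultilinearMap.compContinuousLinearMapL
    fun _ => ContinuousLinearMap.inl ℝ E F).continuous.comp
      ((φ.smooth k).continuous_iteratedFDeriv le_rfl)

/-- The bound is uniform in `x` and integrable in `y`: it justifies differentiation under the
integral sign and gives the decay of the partial integral. -/
theorem exists_bound_iteratedFDeriv_left [MeasurableSpace F] (μ : Measure F)
    [μ.HasTemperateGrowth] (φ : SchwartzMap (E × F) ℂ) (m k : ℕ) :
    ∃ C : ℝ, ∀ x y, ‖x‖ ^ m * ‖iteratedFDeriv ℝ k (fun x => φ (x, y)) x‖ ≤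
      C * (1 + ‖y‖) ^ (-(μ.integrablePower : ℝ)) := by
  obtain ⟨C₁, h₁⟩ := φ.decay m k
  obtain ⟨C₂, h₂⟩ := φ.decay (m + μ.integrablePower) k
  refine ⟨2 ^ μ.integrablePower * (C₁ + C₂), fun x y => ?_⟩
  have hx : ‖x‖ ≤ ‖(x, y)‖ := norm_fst_le (x, y)
  have hy : ‖y‖ ≤ ‖(x, y)‖ := norm_snd_le (x, y)
  have := pow_mul_le_of_le_of_pow_mul_le (k := 0) (l := μ.integrablePower) (x := ‖y‖)
    (f := ‖x‖ ^ m * ‖iteratedFDeriv ℝ k (fun x => φ (x, y)) x‖) (C₁ := C₁) (C₂ := C₂)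
    (norm_nonneg _) (by positivity) ?_ ?_
  · simpa using this
  · refine le_trans ?_ (h₁.2 (x, y))
    gcongr
    exact norm_iteratedFDeriv_left_le φ k x y
  · refine le_trans ?_ (h₂.2 (x, y))
    rw [← mul_assoc, zero_add, pow_add, mul_comm (‖(x, y)‖ ^ m)]
    gcongr
    exact norm_iteratedFDeriv_left_le φ k x y

/-- The partial integral of a Schwartz function is a Schwartz function. -/
theorem IsSchwartz.integral_right [MeasurableSpace F] [BorelSpace F] [SecondCountableTopology F]
    {f : E × F → ℂ} (hf : IsSchwartz f) (μ : Measure F) [μ.HasTemperateGrowth] :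
    IsSchwartz fun x => ∫ y, f (x, y) ∂μ := by
  obtain ⟨φ, rfl⟩ := hf
  -- The candidate Taylor series of the partial integral: the Taylor series of the integrand,
  -- integrated term by term.
  set p : E → FormalMultilinearSeries ℝ E ℂ := fun x k =>
    ∫ y, iteratedFDeriv ℝ k (fun x => φ (x, y)) x ∂μ with hp
  have hint0 := integrable_pow_neg_integrablePower μ
  have hmeas : ∀ k x, AEStronglyMeasurable
      (fun y => iteratedFDeriv ℝ k (fun x => φ (x, y)) x) μ := fun k x =>
    ((continuous_iteratedFDeriv_left φ k).comp
      (Continuous.prodMk continuous_const continuous_id)).aestronglyMeasurable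
  have hbd : ∀ k, ∃ C : ℝ, ∀ x y, ‖iteratedFDeriv ℝ k (fun x => φ (x, y)) x‖ ≤
      C * (1 + ‖y‖) ^ (-(μ.integrablePower : ℝ)) := fun k => by
    obtain ⟨C, hC⟩ := exists_bound_iteratedFDeriv_left μ φ 0 k
    exact ⟨C, fun x y => by simpa using hC x y⟩
  have hint : ∀ k x, Integrable (fun y => iteratedFDeriv ℝ k (fun x => φ (x, y)) x) μ :=
    fun k x => by
      obtain ⟨C, hC⟩ := hbd k
      exact (hint0.const_mul C).mono' (hmeas k x) (Filter.Eventually.of_forall (hC x))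
  have hsm : ∀ y, ContDiff ℝ ∞ fun x => φ (x, y) := fun y =>
    (φ.smooth ⊤).comp (contDiff_id.prodMk contDiff_const)
  have hderiv : ∀ k x, HasFDerivAt (fun x => p x k) (p x (k + 1)).curryLeft x := by
    intro k x
    obtain ⟨C, hC⟩ := hbd (k + 1)
    have hcl : (p x (k + 1)).curryLeft =
        ∫ y, (iteratedFDeriv ℝ (k + 1) (fun x => φ (x, y)) x).curryLeft ∂μ := by
      let L : (E [×(k + 1)]→L[ℝ] ℂ) →L[ℝ] (E →L[ℝ] E [×k]→L[ℝ] ℂ) :=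
        (continuousMultilinearCurryLeftEquiv ℝ (fun _ : Fin (k + 1) => E)
          ℂ).toContinuousLinearEquiv.toContinuousLinearMap
      exact (ContinuousLinearMap.integral_comp_comm (𝕜 := ℝ) (E := E [×(k + 1)]→L[ℝ] ℂ)
        (Fₗ := E →L[ℝ] E [×k]→L[ℝ] ℂ) L (hint (k + 1) x)).symm
    rw [hcl]
    refine hasFDerivAt_integral_of_dominated_of_fderiv_le (s := Set.univ)
      (bound := fun y => C * (1 + ‖y‖) ^ (-(μ.integrablePower : ℝ)))
      (F' := fun x y => (iteratedFDeriv ℝ (k + 1) (fun x => φ (x, y)) x).curryLeft)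
      Filter.univ_mem (Filter.Eventually.of_forall fun x => hmeas k x) (hint k x) ?_
      (Filter.Eventually.of_forall fun y x _ => ?_) (hint0.const_mul C)
      (Filter.Eventually.of_forall fun y x _ => ?_)
    · exact (continuousMultilinearCurryLeftEquiv ℝ (fun _ : Fin (k + 1) => E)
        ℂ).continuous.comp_aestronglyMeasurable (hmeas (k + 1) x)
    · rw [ContinuousMultilinearMap.curryLeft_norm]
      exact hC x y
    · exact (hsm y).ftaylorSeries.fderiv k (by exact_mod_cast ENat.natCast_lt_top k) x
  have hT : HasFTaylorSeriesUpTo ∞ (fun x => ∫ y, φ (x, y) ∂μ) p := by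
    refine ⟨fun x => ?_, fun k _ x => hderiv k x, fun k _ => ?_⟩
    · rw [hp]
      dsimp only
      have := (continuousMultilinearCurryFin0 ℝ E ℂ).toContinuousLinearEquiv.integral_comp_comm
        (fun y => iteratedFDeriv ℝ 0 (fun x => φ (x, y)) x) (μ := μ)
      refine Eq.trans this.symm ?_
      congr 1
    · exact continuous_iff_continuousAt.2 fun x => (hderiv k x).continuousAt
  refine ⟨⟨fun x => ∫ y, φ (x, y) ∂μ, hT.contDiff, fun m k => ?_⟩, rfl⟩
  obtain ⟨C, hC⟩ := exists_bound_iteratedFDeriv_left μ φ m k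
  refine ⟨∫ y, C * (1 + ‖y‖) ^ (-(μ.integrablePower : ℝ)) ∂μ, fun x => ?_⟩
  rw [← hT.eq_iteratedFDeriv (by exact_mod_cast le_top) x, hp]
  calc ‖x‖ ^ m * ‖∫ y, iteratedFDeriv ℝ k (fun x => φ (x, y)) x ∂μ‖
      ≤ ‖x‖ ^ m * ∫ y, ‖iteratedFDeriv ℝ k (fun x => φ (x, y)) x‖ ∂μ := by
        gcongr; exact norm_integral_le_integral_norm _
    _ = ∫ y, ‖x‖ ^ m * ‖iteratedFDeriv ℝ k (fun x => φ (x, y)) x‖ ∂μ :=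
        (integral_const_mul _ _).symm
    _ ≤ _ := integral_mono ((hint k x).norm.const_mul _) (hint0.const_mul C) (hC x)

end SchwartzFunctions

set_option linter.unusedSectionVars false

/-! ### Integration on finite-dimensional spaces -/

section Integration

variable {E F : Type*} [NormedAddCommGroup E] [NormedSpace ℝ E] [FiniteDimensional ℝ E]
  [MeasurableSpace E] [BorelSpace E] [NormedAddCommGroup F] [NormedSpace ℝ F]
  [FiniteDimensional ℝ F] [MeasurableSpace F] [BorelSpace F]

/-- Only the vanishing of integrals matters in the end, so Haar measures are never normalized: such
a comparison costs a non-zero constant, which must be uniform in the integrand. -/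
theorem exists_integral_eq_mul (μ ν : Measure E) [μ.IsAddHaarMeasure] [ν.IsAddHaarMeasure] :
    ∃ c : ℂ, c ≠ 0 ∧ ∀ f : E → ℂ, ∫ x, f x ∂μ = c * ∫ x, f x ∂ν := by
  refine ⟨((μ.addHaarScalarFactor ν : ℝ) : ℂ), ?_, fun f => ?_⟩
  · have := addHaarScalarFactor_pos_of_isAddHaarMeasure μ ν
    exact_mod_cast this.ne'
  · conv_lhs => rw [isAddLeftInvariant_eq_smul μ ν]
    rw [integral_smul_nnreal_measure, NNReal.smul_def, Complex.real_smul]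

theorem exists_integral_comp_linearEquiv (e : E ≃ₗ[ℝ] F) :
    ∃ c : ℂ, c ≠ 0 ∧ ∀ f : F → ℂ,
      ∫ x, f (e x) ∂(addHaar : Measure E) = c * ∫ y, f y ∂(addHaar : Measure F) := by
  let e' : E ≃L[ℝ] F := e.toContinuousLinearEquiv
  have : (Measure.map e' (addHaar : Measure E)).IsAddHaarMeasure := e'.isAddHaarMeasure_map _
  obtain ⟨c, hc, h⟩ := exists_integral_eq_mul (Measure.map e' (addHaar : Measure E)) addHaar
  refine ⟨c, hc, fun f => ?_⟩
  rw [← h]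
  exact (e'.toHomeomorph.measurableEmbedding.integral_map f).symm

theorem integrable_addHaar_prod {f : E × F → ℂ} (hf : Integrable f addHaar) :
    Integrable f ((addHaar : Measure E).prod (addHaar : Measure F)) := by
  rw [isAddLeftInvariant_eq_smul ((addHaar : Measure E).prod (addHaar : Measure F)) addHaar]
  exact hf.smul_measure_nnreal

theorem exists_integral_prod : ∃ c : ℂ, c ≠ 0 ∧ ∀ f : E × F → ℂ, Integrable f addHaar →
    ∫ z, f z ∂(addHaar : Measure (E × F)) =
      c * ∫ x, ∫ y, f (x, y) ∂(addHaar : Measure F) ∂(addHaar : Measure E) := by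
  obtain ⟨c, hc, h⟩ := exists_integral_eq_mul (addHaar : Measure (E × F))
    ((addHaar : Measure E).prod (addHaar : Measure F))
  exact ⟨c, hc, fun f hf => by rw [h, integral_prod _ (integrable_addHaar_prod hf)]⟩

theorem IsSchwartz.integral_swap {f : E × F → ℂ} (hf : IsSchwartz f) :
    ∫ x, ∫ y, f (x, y) ∂(addHaar : Measure F) ∂(addHaar : Measure E) =
      ∫ y, ∫ x, f (x, y) ∂(addHaar : Measure E) ∂(addHaar : Measure F) :=
  integral_integral_swap (integrable_addHaar_prod (hf.integrable _))

theorem measurePreserving_of_isNilpotent_sub_one (T : E →ₗ[ℝ] E) (hT : IsNilpotent (T - 1))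
    (μ : Measure E) [μ.IsAddHaarMeasure] : MeasurePreserving T μ μ := by
  have hdet : LinearMap.det T = 1 := by
    -- With N = 1 - T nilpotent, det T = det (1 - N) is the value at 1 of the characteristic
    -- polynomial of N, a power of X.
    have h1 := IsNilpotent.charpoly_eq_X_pow_finrank (hT.neg)
    have h2 := congrArg (Polynomial.eval 1) h1
    simpa [LinearMap.eval_charpoly] using h2
  refine ⟨(LinearMap.continuous_of_finiteDimensional T).measurable, ?_⟩
  rw [map_linearMap_addHaar_eq_smul_addHaar μ (by rw [hdet]; exact one_ne_zero), hdet]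
  simp

end Integration

/-! ### The Fourier transform with respect to a pairing -/

section Fourier

variable {E F : Type*} [NormedAddCommGroup E] [NormedSpace ℝ E] [FiniteDimensional ℝ E]
  [MeasurableSpace E] [BorelSpace E] [NormedAddCommGroup F] [NormedSpace ℝ F]
  [FiniteDimensional ℝ F] [MeasurableSpace F] [BorelSpace F]

/-- The Fourier transform of `f` with respect to the pairing `b` and the character `expi θ`. -/
noncomputable def ft (θ : ℝ) (b : E →ₗ[ℝ] F →ₗ[ℝ] ℝ) (f : E → ℂ) (w : F) : ℂ :=
  ∫ v, f v * expi θ (b v w) ∂(addHaar : Measure E)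

/-- A non-degenerate pairing identifies `F` with the dual of `E`. Euclidean coordinates on `E` and
the Riesz isomorphism then bring the pairing into the normalization of the Fourier transform on
Euclidean space. -/
theorem exists_ft_eq_fourier {θ : ℝ} (hθ : θ ≠ 0) (b : E →ₗ[ℝ] F →ₗ[ℝ] ℝ)
    (hb : b.Nondegenerate) :
    ∃ (e : E ≃ₗ[ℝ] EuclideanSpace ℝ (Fin (finrank ℝ E)))
      (T : F ≃ₗ[ℝ] EuclideanSpace ℝ (Fin (finrank ℝ E))),
      ∀ v w, θ * b v w = -2 * Real.pi * inner ℝ (e v) (T w) := by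
  let V := EuclideanSpace ℝ (Fin (finrank ℝ E))
  let e : E ≃ₗ[ℝ] V := LinearEquiv.ofFinrankEq _ _ (by simp [V])
  let T : F →ₗ[ℝ] V := (-(θ / (2 * Real.pi))) •
    ((InnerProductSpace.toDual ℝ V).symm.toLinearEquiv.toLinearMap ∘ₗ
      (LinearMap.toContinuousLinearMap : (V →ₗ[ℝ] ℝ) ≃ₗ[ℝ] _).toLinearMap ∘ₗ
      (LinearMap.lcomp ℝ ℝ e.symm.toLinearMap) ∘ₗ b.flip)
  have hT : ∀ v w, θ * b v w = -2 * Real.pi * inner ℝ (e v) (T w) := by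
    intro v w
    have h1 : inner ℝ (e v) (T w) = -(θ / (2 * Real.pi)) * b v w := by
      rw [real_inner_comm]
      simp only [T, LinearMap.smul_apply, inner_smul_left]
      simp [InnerProductSpace.toDual_symm_apply]
    rw [h1]
    field_simp
  have hinj : Function.Injective T := by
    rw [injective_iff_map_eq_zero]
    intro w hw
    refine hb.2 w fun v => ?_
    have := hT v w
    rw [hw, inner_zero_right, mul_zero] at this
    exact (mul_eq_zero.1 this).resolve_left hθ
  have hdim : finrank ℝ F = finrank ℝ V := by
    refine le_antisymm (LinearMap.finrank_le_finrank_of_injective hinj) ?_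
    have hb1 : Function.Injective b := by
      rw [injective_iff_map_eq_zero]
      intro v hv
      exact hb.1 v fun w => by rw [hv]; rfl
    have := LinearMap.finrank_le_finrank_of_injective hb1
    simpa [V] using this
  exact ⟨e, LinearEquiv.ofInjectiveOfFinrankEq T hinj hdim, hT⟩

theorem exists_ft_eq_fourier' {θ : ℝ} (hθ : θ ≠ 0) (b : E →ₗ[ℝ] F →ₗ[ℝ] ℝ)
    (hb : b.Nondegenerate) :
    ∃ (e : E ≃ₗ[ℝ] EuclideanSpace ℝ (Fin (finrank ℝ E)))
      (T : F ≃ₗ[ℝ] EuclideanSpace ℝ (Fin (finrank ℝ E))) (c : ℂ), c ≠ 0 ∧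
      (∀ v w, θ * b v w = -2 * Real.pi * inner ℝ (e v) (T w)) ∧
      ∀ f : E → ℂ, ∀ w, ft θ b f w =
        c * FourierTransform.fourier (fun x => f (e.symm x)) (T w) := by
  obtain ⟨e, T, h⟩ := exists_ft_eq_fourier hθ b hb
  obtain ⟨c, hc, hint⟩ := exists_integral_comp_linearEquiv e
  obtain ⟨c', hc', hint'⟩ := exists_integral_eq_mul
    (addHaar : Measure (EuclideanSpace ℝ (Fin (finrank ℝ E)))) volume
  refine ⟨e, T, c * c', mul_ne_zero hc hc', h, fun f w => ?_⟩
  rw [Real.fourier_eq', ft, mul_assoc, ← hint', ← hint]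
  congr 1
  funext v
  rw [e.symm_apply_apply, expi, smul_eq_mul, mul_comm, ← Complex.ofReal_mul, h]

theorem IsSchwartz.ft {θ : ℝ} (hθ : θ ≠ 0) {b : E →ₗ[ℝ] F →ₗ[ℝ] ℝ} (hb : b.Nondegenerate)
    {f : E → ℂ} (hf : IsSchwartz f) : IsSchwartz (ft θ b f) := by
  obtain ⟨e, T, c, -, -, h⟩ := exists_ft_eq_fourier' hθ b hb
  obtain ⟨φ, hφ⟩ := hf.comp_linearEquiv e.symm
  have h1 : IsSchwartz (FourierTransform.fourier (fun x => f (e.symm x))) :=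
    ⟨FourierTransform.fourier φ, by rw [fourier_coe, hφ]⟩
  have := (h1.comp_linearEquiv T).const_mul c
  rwa [← (funext (h f) : Kloosterman.ft θ b f = _)] at this

/-- Fourier inversion. -/
theorem exists_ft_inversion {θ : ℝ} (hθ : θ ≠ 0) {b : E →ₗ[ℝ] F →ₗ[ℝ] ℝ}
    (hb : b.Nondegenerate) : ∃ c : ℂ, c ≠ 0 ∧ ∀ f : E → ℂ, IsSchwartz f → ∀ v,
      ∫ w, ft θ b f w * expi θ (-(b v w)) ∂(addHaar : Measure F) = c * f v := by
  obtain ⟨e, T, c, hc, hT, h⟩ := exists_ft_eq_fourier' hθ b hb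
  obtain ⟨c₁, hc₁, hint⟩ := exists_integral_comp_linearEquiv T
  obtain ⟨c₂, hc₂, hint'⟩ := exists_integral_eq_mul
    (addHaar : Measure (EuclideanSpace ℝ (Fin (finrank ℝ E)))) volume
  refine ⟨c * (c₁ * c₂), mul_ne_zero hc (mul_ne_zero hc₁ hc₂), fun f hf v => ?_⟩
  obtain ⟨φ, hφ⟩ := hf.comp_linearEquiv e.symm
  have h1 : FourierTransformInv.fourierInv
      (FourierTransform.fourier (fun x => f (e.symm x))) (e v) = f v := by
    rw [← hφ, ← fourier_coe, ← fourierInv_coe, FourierTransform.fourierInv_fourier_eq, hφ]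
    exact congrArg f (e.symm_apply_apply v)
  rw [← h1, Real.fourierInv_eq', mul_assoc, mul_assoc, ← hint', ← hint, ← integral_const_mul]
  congr 1
  funext w
  rw [h, mul_assoc, smul_eq_mul, mul_comm (Complex.exp _)]
  congr 2
  rw [expi, ← Complex.ofReal_mul, mul_neg, hT, real_inner_comm]
  congr 3
  ring

theorem eq_zero_of_ft_eq_zero {θ : ℝ} (hθ : θ ≠ 0) {b : E →ₗ[ℝ] F →ₗ[ℝ] ℝ}
    (hb : b.Nondegenerate) {f : E → ℂ} (hf : IsSchwartz f) (h : ∀ w, ft θ b f w = 0) (v : E) :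
    f v = 0 := by
  obtain ⟨c, hc, hinv⟩ := exists_ft_inversion hθ hb
  have := hinv f hf v
  simp only [h, zero_mul, integral_zero] at this
  exact (mul_eq_zero.1 this.symm).resolve_left hc

end Fourier

/-! ### Oscillating Gaussian integrals -/

section Gaussian

open Filter Topology

/-- The oscillating Gaussian is damped by exp(-δ ∑ xᵢ²). For δ > 0 Fubini and the classical Gaussian
integral give the identity; as δ tends to 0, both sides converge by dominated convergence, which is
where the integrability of `f` and of its Fourier transform enters. -/
theorem exists_gaussian_pi {ι : Type*} [Fintype ι] {θ : ℝ} (hθ : θ ≠ 0) (d : ι → ℝ)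
    (hd : ∀ i, d i ≠ 0) : ∃ γ : ℂ, γ ≠ 0 ∧ ∀ f : (ι → ℝ) → ℂ, Integrable f →
      Integrable (fun x : ι → ℝ => ∫ t, f t * expi θ (∑ i, t i * x i)) →
      ∫ x : ι → ℝ, (∫ t, f t * expi θ (∑ i, t i * x i)) * expi θ (2⁻¹ * ∑ i, d i * x i ^ 2) =
        γ * ∫ t, f t * expi θ (-(2⁻¹ * ∑ i, (d i)⁻¹ * t i ^ 2)) := by
  set b : ι → ℝ → ℂ := fun i δ => δ - θ * d i / 2 * Complex.I with hb
  have hre : ∀ i δ, (b i δ).re = δ := fun i δ => by simp [hb]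
  have him : ∀ i δ, (b i δ).im = -(θ * d i / 2) := fun i δ => by
    rw [hb]
    simp only [Complex.sub_im, Complex.ofReal_im, zero_sub]
    norm_cast
    simp
  have him0 : ∀ i δ, (b i δ).im ≠ 0 := fun i δ => by
    rw [him]; simp [hθ, hd i]
  have hb0 : ∀ i δ, b i δ ≠ 0 := fun i δ h => him0 i δ (by rw [h]; rfl)
  have hbc : ∀ i, Continuous (b i) := fun i => by rw [hb]; fun_prop
  refine ⟨∏ i, (Real.pi / b i 0) ^ (1 / 2 : ℂ), ?_, fun f hf hg => ?_⟩
  · refine Finset.prod_ne_zero_iff.2 fun i _ => ?_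
    rw [Complex.cpow_ne_zero_iff]
    left
    exact div_ne_zero (by exact_mod_cast Real.pi_ne_zero) (hb0 i 0)
  set g : (ι → ℝ) → ℂ := fun x => ∫ t, f t * expi θ (∑ i, t i * x i) with hgdef
  set G : ℝ → (ι → ℝ) → ℂ := fun δ x => Complex.exp (-∑ i, b i δ * (x i : ℂ) ^ 2) with hG
  set W : ℝ → (ι → ℝ) → ℂ := fun δ t =>
    ∏ i, Complex.exp ((θ * t i * Complex.I) ^ 2 / (4 * b i δ)) with hW
  -- the identity for a positive damping parameter
  have key : ∀ δ : ℝ, 0 < δ → ∫ x, g x * G δ x =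
      (∏ i, (Real.pi / b i δ) ^ (1 / 2 : ℂ)) * ∫ t, f t * W δ t := by
    intro δ hδ
    have hGi : Integrable (G δ) := by
      simpa using GaussianFourier.integrable_cexp_neg_sum_mul_add (b := fun i => b i δ)
        (fun i => by rw [hre]; exact hδ) 0
    have hprod : Integrable (fun z : (ι → ℝ) × (ι → ℝ) =>
        f z.2 * expi θ (∑ i, z.2 i * z.1 i) * G δ z.1) := by
      have h1 := hGi.mul_prod hf
      refine (h1.bdd_mul (c := 1) (f := fun z => expi θ (∑ i, z.2 i * z.1 i)) ?_ ?_).congr ?_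
      · exact ((continuous_expi θ).comp (by fun_prop)).aestronglyMeasurable
      · exact Eventually.of_forall fun z => by simp
      · exact Eventually.of_forall fun z => by dsimp only; ring
    calc ∫ x, g x * G δ x
        = ∫ x, ∫ t, f t * expi θ (∑ i, t i * x i) * G δ x := by
          congr 1; funext x; rw [hgdef, integral_mul_const]
      _ = ∫ t, ∫ x, f t * expi θ (∑ i, t i * x i) * G δ x := integral_integral_swap hprod
      _ = ∫ t, (∏ i, (Real.pi / b i δ) ^ (1 / 2 : ℂ)) * (f t * W δ t) := by
          congr 1; funext t
          have := GaussianFourier.integral_cexp_neg_sum_mul_add (b := fun i => b i δ)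
            (fun i => by rw [hre]; exact hδ) (fun i => θ * t i * Complex.I)
          simp_rw [mul_assoc (f t)]
          rw [integral_const_mul, mul_left_comm, hW]
          dsimp only
          rw [← Finset.prod_mul_distrib, ← this]
          congr 2
          funext x
          rw [hG, expi, ← Complex.exp_add, add_comm]
          congr 2
          push_cast
          rw [Finset.mul_sum, Finset.sum_mul]
          refine Finset.sum_congr rfl fun i _ => by ring
      _ = _ := integral_const_mul _ _
  -- pass to the limit
  have hGb : ∀ δ, 0 ≤ δ → ∀ x, ‖G δ x‖ ≤ 1 := by
    intro δ hδ x
    rw [hG, Complex.norm_exp, Real.exp_le_one_iff, Complex.neg_re, Complex.re_sum,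
      neg_nonpos]
    refine Finset.sum_nonneg fun i _ => ?_
    rw [← Complex.ofReal_pow, Complex.re_mul_ofReal, hre]
    positivity
  have hWb : ∀ δ, 0 ≤ δ → ∀ t, ‖W δ t‖ ≤ 1 := by
    intro δ hδ t
    rw [hW, norm_prod]
    refine Finset.prod_le_one (fun _ _ => norm_nonneg _) fun i _ => ?_
    rw [Complex.norm_exp, Real.exp_le_one_iff]
    have : (θ * t i * Complex.I) ^ 2 / (4 * b i δ) = ((-(θ * t i) ^ 2 / 4 : ℝ) : ℂ) * (b i δ)⁻¹ := by
      rw [mul_pow, Complex.I_sq]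
      push_cast
      field_simp [hb0 i δ]
    rw [this, Complex.re_ofReal_mul, Complex.inv_re, hre]
    have h1 : 0 ≤ δ / Complex.normSq (b i δ) := div_nonneg hδ (Complex.normSq_nonneg _)
    have h2 : (-(θ * t i) ^ 2 / 4 : ℝ) ≤ 0 := by
      rw [neg_div]; exact neg_nonpos.2 (by positivity)
    exact mul_nonpos_of_nonpos_of_nonneg h2 h1
  have hGc : ∀ δ, Continuous (G δ) := fun δ => by rw [hG]; fun_prop
  have hGc' : ∀ x, Continuous fun δ => G δ x := fun x => by
    rw [hG]
    exact Complex.continuous_exp.comp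
      (continuous_finsetSum _ fun i _ => (hbc i).mul continuous_const).neg
  have hWc : ∀ δ, Continuous (W δ) := fun δ => by
    rw [hW]
    refine continuous_finsetProd _ fun i _ => Complex.continuous_exp.comp ?_
    exact Continuous.div_const (by fun_prop) _
  have hWc' : ∀ t, Continuous fun δ => W δ t := fun t => by
    rw [hW]
    refine continuous_finsetProd _ fun i _ => Complex.continuous_exp.comp ?_
    exact continuous_const.div (continuous_const.mul (hbc i)) fun δ => by
      simp [hb0 i δ]
  have hmem : ∀ᶠ δ : ℝ in 𝓝[>] 0, 0 < δ := eventually_mem_nhdsWithin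
  have hL : Tendsto (fun δ => ∫ x, g x * G δ x) (𝓝[>] 0) (𝓝 (∫ x, g x * G 0 x)) := by
    refine tendsto_integral_filter_of_dominated_convergence (fun x => ‖g x‖) ?_ ?_ hg.norm ?_
    · exact Eventually.of_forall fun δ => hg.1.mul (hGc δ).aestronglyMeasurable
    · filter_upwards [hmem] with δ hδ
      refine Eventually.of_forall fun x => ?_
      rw [norm_mul]
      exact mul_le_of_le_one_right (norm_nonneg _) (hGb δ hδ.le x)
    · exact Eventually.of_forall fun x =>
        (((hGc' x).tendsto 0).mono_left nhdsWithin_le_nhds).const_mul _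
  have hR : Tendsto (fun δ => (∏ i, (Real.pi / b i δ) ^ (1 / 2 : ℂ)) * ∫ t, f t * W δ t)
      (𝓝[>] 0) (𝓝 ((∏ i, (Real.pi / b i 0) ^ (1 / 2 : ℂ)) * ∫ t, f t * W 0 t)) := by
    refine Tendsto.mul ?_ ?_
    · refine Tendsto.mono_left (tendsto_finsetProd _ fun i _ => ?_) nhdsWithin_le_nhds
      have h1 : ContinuousAt (fun δ => (Real.pi / b i δ : ℂ)) 0 :=
        continuousAt_const.div (hbc i).continuousAt (hb0 i 0)
      -- At δ = 0 the imaginary part of `b` is -θ dᵢ / 2 ≠ 0, so π / b stays off the branch cut of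
      -- the square root.
      refine (h1.cpow continuousAt_const (Or.inr ?_)).tendsto
      rw [Complex.div_im]
      simp only [Complex.ofReal_im, zero_mul, zero_div, Complex.ofReal_re, zero_sub]
      have := him0 i 0
      have h2 : Complex.normSq (b i 0) ≠ 0 := by simpa using hb0 i 0
      simp [Real.pi_ne_zero, this, h2]
    · refine tendsto_integral_filter_of_dominated_convergence (fun x => ‖f x‖) ?_ ?_ hf.norm ?_
      · exact Eventually.of_forall fun δ => hf.1.mul (hWc δ).aestronglyMeasurable
      · filter_upwards [hmem] with δ hδ
        refine Eventually.of_forall fun x => ?_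
        rw [norm_mul]
        exact mul_le_of_le_one_right (norm_nonneg _) (hWb δ hδ.le x)
      · exact Eventually.of_forall fun x =>
          (((hWc' x).tendsto 0).mono_left nhdsWithin_le_nhds).const_mul _
  have heq := tendsto_nhds_unique (hL.congr' (hmem.mono fun δ hδ => key δ hδ)) hR
  have hG0 : ∀ x, G 0 x = expi θ (2⁻¹ * ∑ i, d i * x i ^ 2) := fun x => by
    rw [hG, expi, hb]
    dsimp only
    congr 1
    push_cast
    rw [← Finset.sum_neg_distrib, Finset.mul_sum, Finset.mul_sum, Finset.sum_mul]
    refine Finset.sum_congr rfl fun i _ => by ring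
  have hW0 : ∀ t, W 0 t = expi θ (-(2⁻¹ * ∑ i, (d i)⁻¹ * t i ^ 2)) := fun t => by
    rw [hW, expi]
    dsimp only
    rw [← Complex.exp_sum]
    congr 1
    push_cast
    rw [← mul_neg, ← Finset.sum_neg_distrib, Finset.mul_sum, Finset.mul_sum, Finset.sum_mul]
    refine Finset.sum_congr rfl fun i _ => ?_
    have h1 : (d i : ℂ) ≠ 0 := by exact_mod_cast hd i
    have h2 : (θ : ℂ) ≠ 0 := by exact_mod_cast hθ
    rw [hb]
    simp only [Complex.ofReal_zero, zero_sub]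
    rw [mul_pow, Complex.I_sq]
    have h3 : (4 * -(θ * d i / 2 * Complex.I) : ℂ) ≠ 0 := by simp [h1, h2]
    rw [div_eq_iff h3]
    field_simp
    linear_combination (-(t i : ℂ) ^ 2 * 4) * Complex.I_sq
  simp_rw [hG0, hW0] at heq
  exact heq

variable {E : Type*} [NormedAddCommGroup E] [NormedSpace ℝ E] [FiniteDimensional ℝ E]
  [MeasurableSpace E] [BorelSpace E]

/-- The Weil formula: the Fourier transform of an oscillating Gaussian is a multiple of the
oscillating Gaussian of the dual quadratic form. -/
theorem exists_weil_formula {θ : ℝ} (hθ : θ ≠ 0) {β : E →ₗ[ℝ] E →ₗ[ℝ] ℝ} (hβ : β.Nondegenerate)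
    (hsymm : ∀ x y, β x y = β y x) (S : E ≃ₗ[ℝ] E) (hS : ∀ x y, β (S x) y = β x (S y)) :
    ∃ γ : ℂ, γ ≠ 0 ∧ ∀ f : E → ℂ, IsSchwartz f →
      ∫ η, ft θ β f η * expi θ (2⁻¹ * β (S η) η) ∂(addHaar : Measure E) =
        γ * ∫ v, f (S v) * expi θ (-(2⁻¹ * β (S v) v)) ∂(addHaar : Measure E) := by
  classical
  -- Self-adjointness of `S` makes `Q` symmetric; in a `Q`-orthogonal basis the Gaussian is a
  -- product of one-dimensional ones.
  let Q : LinearMap.BilinForm ℝ E := β ∘ₗ S.toLinearMap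
  have hQ : LinearMap.IsSymm Q := ⟨fun x y => by
    change β (S x) y = β (S y) x
    rw [hS, hsymm]⟩
  obtain ⟨v, hv⟩ := LinearMap.BilinForm.exists_orthogonal_basis hQ
  have hv' : ∀ i j, i ≠ j → β (S (v i)) (v j) = 0 := fun i j hij => hv hij
  set d : Fin (finrank ℝ E) → ℝ := fun i => β (S (v i)) (v i) with hd
  have hsum : ∀ (s t : Fin (finrank ℝ E) → ℝ),
      β (S (∑ i, s i • v i)) (∑ i, t i • v i) = ∑ i, s i * t i * d i := by
    intro s t
    simp only [_root_.map_sum, map_smul, LinearMap.sum_apply, LinearMap.smul_apply, smul_eq_mul]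
    refine Finset.sum_congr rfl fun i _ => ?_
    rw [Finset.sum_eq_single i]
    · rw [hd]; ring
    · intro j _ hj
      rw [hv' _ _ hj, mul_zero]
    · simp
  have hd0 : ∀ i, d i ≠ 0 := by
    intro i hi
    have : S (v i) = 0 := by
      refine hβ.1 _ fun w => ?_
      rw [← v.sum_repr w, _root_.map_sum]
      refine Finset.sum_eq_zero fun j _ => ?_
      rw [map_smul]
      by_cases h : i = j
      · subst h
        change _ • d i = 0
        rw [hi, smul_zero]
      · rw [hv' _ _ h, smul_zero]
    exact v.ne_zero i (by simpa using this)
  let e : (Fin (finrank ℝ E) → ℝ) ≃ₗ[ℝ] E := v.equivFun.symm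
  have he : ∀ x, e x = ∑ i, x i • v i := fun x => v.equivFun_symm_apply x
  -- Rescaling by dᵢ⁻¹ makes `e` and `e₂` dual coordinate systems for β, so that `ft` becomes the
  -- standard Fourier integral on coordinate space.
  let m : (Fin (finrank ℝ E) → ℝ) ≃ₗ[ℝ] (Fin (finrank ℝ E) → ℝ) :=
    LinearEquiv.piCongrRight fun i => LinearEquiv.smulOfNeZero ℝ ℝ (d i)⁻¹ (inv_ne_zero (hd0 i))
  have hm : ∀ t i, m t i = (d i)⁻¹ * t i := fun t i => rfl
  let e₂ : (Fin (finrank ℝ E) → ℝ) ≃ₗ[ℝ] E := (m.trans e).trans S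
  have he₂ : ∀ t, e₂ t = S (e (m t)) := fun t => rfl
  have hpair : ∀ t x, β (e₂ t) (e x) = ∑ i, t i * x i := by
    intro t x
    rw [he₂, he, he, hsum]
    refine Finset.sum_congr rfl fun i _ => ?_
    rw [hm]
    have := hd0 i
    field_simp
  obtain ⟨γ, hγ, hG⟩ := exists_gaussian_pi hθ d hd0
  obtain ⟨c₁, hc₁, h₁⟩ := exists_integral_comp_linearEquiv e
  obtain ⟨c₂, hc₂, h₂⟩ := exists_integral_comp_linearEquiv e₂
  obtain ⟨c₃, hc₃, h₃⟩ := exists_integral_comp_linearEquiv (m.trans e)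
  obtain ⟨c₄, hc₄, h₄⟩ := exists_integral_eq_mul
    (addHaar : Measure (Fin (finrank ℝ E) → ℝ)) volume
  refine ⟨c₁⁻¹ * c₂⁻¹ * c₄ * γ * c₃, by simp [hc₁, hc₂, hc₃, hc₄, hγ], fun f hf => ?_⟩
  have hft : ∀ x, ft θ β f (e x) = c₂⁻¹ * c₄ * ∫ t, f (e₂ t) * expi θ (∑ i, t i * x i) := by
    intro x
    rw [mul_assoc, ← h₄]
    simp_rw [← hpair]
    rw [h₂ fun y => f y * expi θ (β y (e x)), inv_mul_cancel_left₀ hc₂]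
    rfl
  have hfi : Integrable fun t => f (e₂ t) := (hf.comp_linearEquiv e₂).integrable volume
  have hFi : Integrable fun x : Fin (finrank ℝ E) → ℝ =>
      ∫ t, f (e₂ t) * expi θ (∑ i, t i * x i) := by
    have := ((hf.ft hθ hβ).comp_linearEquiv e).integrable volume
    simp_rw [hft] at this
    exact (integrable_const_mul_iff (IsUnit.mk0 _ (mul_ne_zero (inv_ne_zero hc₂) hc₄)) _).1 this
  have key := hG _ hfi hFi
  calc ∫ η, ft θ β f η * expi θ (2⁻¹ * β (S η) η) ∂addHaar
      = c₁⁻¹ * ∫ x, ft θ β f (e x) * expi θ (2⁻¹ * β (S (e x)) (e x)) ∂addHaar := by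
        rw [h₁ fun η => ft θ β f η * expi θ (2⁻¹ * β (S η) η), inv_mul_cancel_left₀ hc₁]
    _ = c₁⁻¹ * ∫ x : Fin (finrank ℝ E) → ℝ, (c₂⁻¹ * c₄) * ((∫ t, f (e₂ t) * expi θ (∑ i, t i * x i)) *
          expi θ (2⁻¹ * ∑ i, d i * x i ^ 2)) ∂addHaar := by
        congr 2; funext x
        have : ∑ i, x i * x i * d i = ∑ i, d i * x i ^ 2 :=
          Finset.sum_congr rfl fun i _ => by ring
        rw [hft, he, hsum, mul_assoc, this]
    _ = c₁⁻¹ * (c₂⁻¹ * c₄ * (c₄ * (γ *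
          ∫ t : Fin (finrank ℝ E) → ℝ, f (e₂ t) * expi θ (-(2⁻¹ * ∑ i, (d i)⁻¹ * t i ^ 2))))) := by
        rw [integral_const_mul, h₄, key]
    _ = c₁⁻¹ * (c₂⁻¹ * c₄ * (γ *
          ∫ t : Fin (finrank ℝ E) → ℝ, f (e₂ t) * expi θ (-(2⁻¹ * ∑ i, (d i)⁻¹ * t i ^ 2)) ∂addHaar)) := by
        rw [h₄]; ring
    _ = c₁⁻¹ * (c₂⁻¹ * c₄ * (γ *
          ∫ t, f (S ((m.trans e) t)) * expi θ (-(2⁻¹ * β (S ((m.trans e) t)) ((m.trans e) t)))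
            ∂addHaar)) := by
        congr 4; funext t
        change _ = f (S (e (m t))) * expi θ (-(2⁻¹ * β (S (e (m t))) (e (m t))))
        have : ∑ i, m t i * m t i * d i = ∑ i, (d i)⁻¹ * t i ^ 2 :=
          Finset.sum_congr rfl fun i _ => by
            rw [hm]
            have := hd0 i
            field_simp
        rw [he₂, he, hsum, this]
    _ = _ := by
        rw [h₃ fun v => f (S v) * expi θ (-(2⁻¹ * β (S v) v))]; ring

/-- The Weil formula, with a linear term. -/
theorem exists_weil_formula_linear {θ : ℝ} (hθ : θ ≠ 0) {β : E →ₗ[ℝ] E →ₗ[ℝ] ℝ}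
    (hβ : β.Nondegenerate) (hsymm : ∀ x y, β x y = β y x) (S : E ≃ₗ[ℝ] E)
    (hS : ∀ x y, β (S x) y = β x (S y)) (e : E) {t : ℝ} (ht : t ≠ 0) :
    ∃ γ : ℂ, γ ≠ 0 ∧ ∀ f : E → ℂ, IsSchwartz f →
      ∫ η, ft θ β f η * expi θ (t⁻¹ * (2⁻¹ * β (S η) η) - t⁻¹ * β e η) ∂(addHaar : Measure E) =
        γ * ∫ v, f (S v) * expi θ (β e v - t * (2⁻¹ * β (S v) v)) ∂(addHaar : Measure E) := by
  -- The factor t⁻¹ is absorbed into the operator. The linear term in η arises from translating `f`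
  -- by t⁻¹ e, and on the other side the shift by x₀ = S⁻¹ e completes the square.
  let S' : E ≃ₗ[ℝ] E := S.trans (LinearEquiv.smulOfNeZero ℝ E t⁻¹ (inv_ne_zero ht))
  have hS' : ∀ x, S' x = t⁻¹ • S x := fun x => rfl
  obtain ⟨γ, hγ, h⟩ := exists_weil_formula hθ hβ hsymm S' fun x y => by
    rw [hS', hS', map_smul, map_smul, LinearMap.smul_apply, hS]
  let T : E ≃ₗ[ℝ] E := LinearEquiv.smulOfNeZero ℝ E t ht
  have hT : ∀ x, T x = t • x := fun x => rfl
  obtain ⟨c, hc, hint⟩ := exists_integral_comp_linearEquiv T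
  set x₀ : E := S.symm e with hx₀
  have hSx₀ : S x₀ = e := S.apply_symm_apply e
  refine ⟨γ * c⁻¹ * expi θ (-(t⁻¹ * (2⁻¹ * β e x₀))), by simp [hγ, hc, expi_ne_zero],
    fun f hf => ?_⟩
  have hfs : IsSchwartz fun y => f (y + t⁻¹ • e) := by
    simpa [add_comm] using hf.comp_linearMap LinearMap.id (fun _ _ h => h) (t⁻¹ • e)
  have hft : ∀ η, ft θ β (fun y => f (y + t⁻¹ • e)) η = ft θ β f η * expi θ (-(t⁻¹ * β e η)) := by
    intro η
    rw [ft, ft, ← integral_mul_const,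
      ← integral_add_right_eq_self (fun y => f y * expi θ (β y η) * _) (t⁻¹ • e)]
    congr 1; funext y
    rw [mul_assoc, ← expi_add]
    congr 2
    simp
  have key := h _ hfs
  calc ∫ η, ft θ β f η * expi θ (t⁻¹ * (2⁻¹ * β (S η) η) - t⁻¹ * β e η) ∂addHaar
      = ∫ η, ft θ β (fun y => f (y + t⁻¹ • e)) η * expi θ (2⁻¹ * β (S' η) η) ∂addHaar := by
        congr 1; funext η
        rw [hft, mul_assoc, ← expi_add, hS', map_smul, LinearMap.smul_apply, smul_eq_mul]
        congr 2; ring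
    _ = γ * ∫ v, f (S' v + t⁻¹ • e) * expi θ (-(2⁻¹ * β (S' v) v)) ∂addHaar := key
    _ = γ * (c⁻¹ * ∫ v, f (S' (T v - x₀) + t⁻¹ • e) *
          expi θ (-(2⁻¹ * β (S' (T v - x₀)) (T v - x₀))) ∂addHaar) := by
        rw [hint fun v => f (S' (v - x₀) + t⁻¹ • e) * expi θ (-(2⁻¹ * β (S' (v - x₀)) (v - x₀))),
          inv_mul_cancel_left₀ hc, integral_sub_right_eq_self
            (fun v => f (S' v + t⁻¹ • e) * expi θ (-(2⁻¹ * β (S' v) v)))]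
    _ = γ * (c⁻¹ * ∫ v, expi θ (-(t⁻¹ * (2⁻¹ * β e x₀))) *
          (f (S v) * expi θ (β e v - t * (2⁻¹ * β (S v) v))) ∂addHaar) := by
        congr 3; funext v
        have h1 : S' (T v - x₀) + t⁻¹ • e = S v := by
          rw [hS', hT, map_sub, map_smul, hSx₀, smul_sub, smul_smul, inv_mul_cancel₀ ht, one_smul,
            sub_add_cancel]
        rw [h1, mul_left_comm, ← expi_add]
        congr 2
        have h2 : β (S v) x₀ = β e v := by rw [hS, hSx₀, hsymm]
        simp only [hS', hT, map_sub, map_smul, LinearMap.sub_apply, LinearMap.smul_apply,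
          smul_eq_mul, hSx₀, h2]
        field_simp
        ring
    _ = _ := by
        rw [integral_const_mul]; ring

end Gaussian

/-! ### Temperate growth of linear and bilinear expressions -/

section Temperate

variable {E E₁ E₂ G : Type*} [NormedAddCommGroup E] [NormedSpace ℝ E]
  [NormedAddCommGroup E₁] [NormedSpace ℝ E₁] [FiniteDimensional ℝ E₁]
  [NormedAddCommGroup E₂] [NormedSpace ℝ E₂] [FiniteDimensional ℝ E₂]
  [NormedAddCommGroup G] [NormedSpace ℝ G]

theorem hasTemperateGrowth_linear (f : E₁ →ₗ[ℝ] G) {a : E → E₁} (ha : a.HasTemperateGrowth) :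
    (fun x => f (a x)).HasTemperateGrowth :=
  (LinearMap.hasTemperateGrowth f).comp ha

theorem hasTemperateGrowth_bilinear (f : E₁ →ₗ[ℝ] E₂ →ₗ[ℝ] G) {a : E → E₁} {b : E → E₂}
    (ha : a.HasTemperateGrowth) (hb : b.HasTemperateGrowth) :
    (fun x => f (a x) (b x)).HasTemperateGrowth :=
  ContinuousLinearMap.bilinear_hasTemperateGrowth (𝕜 := ℝ) (LinearMap.toContinuousLinearMap
    ((LinearMap.toContinuousLinearMap : (E₂ →ₗ[ℝ] G) ≃ₗ[ℝ] _).toLinearMap ∘ₗ f)) ha hb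

theorem hasTemperateGrowth_subtype {W : Submodule ℝ E₁} {a : E → W}
    (ha : (fun x => (a x : E₁)).HasTemperateGrowth) : a.HasTemperateGrowth := by
  obtain ⟨r, hr⟩ := W.subtype.exists_leftInverse_of_injective W.ker_subtype
  have := hasTemperateGrowth_linear r ha
  convert this using 1
  funext x
  exact (LinearMap.congr_fun hr (a x)).symm

end Temperate

/-- The properties of the two-dimensional algebra with involution that are used below: `d + star d`
is the trace of `d`, and the trace form is non-degenerate. -/
class IsQuadratic (D : Type*) [NormedCommRing D] [NormedAlgebra ℝ D] [StarRing D] : Prop where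
  algebraMap_trace (d : D) : algebraMap ℝ D (Algebra.trace ℝ D d) = d + star d
  eq_zero_of_trace (d : D) : (∀ e, Algebra.trace ℝ D (d * e) = 0) → d = 0

section

variable {k l m n : ℕ} {D : Type*} [NormedCommRing D]

/-- The uniform structure of the space of matrices, as a normed space. -/
noncomputable abbrev matrixUniformSpace : UniformSpace (Matrix (Fin k) (Fin l) D) :=
  PseudoMetricSpace.toUniformSpace

/-- The topology of the space of matrices, as a normed space. -/
noncomputable abbrev matrixTopologicalSpace : TopologicalSpace (Matrix (Fin k) (Fin l) D) :=
  PseudoMetricSpace.toUniformSpace.toTopologicalSpace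

attribute [local instance] matrixUniformSpace matrixTopologicalSpace

noncomputable instance : MeasurableSpace (Matrix (Fin k) (Fin l) D) := borel _

instance : BorelSpace (Matrix (Fin k) (Fin l) D) := ⟨rfl⟩

/-! ### Block matrices -/

/-- The embedding of the first block of indices. -/
def iL (h : k + l = n) (i : Fin k) : Fin n := ⟨i, by omega⟩

/-- The embedding of the second block of indices. -/
def iR (h : k + l = n) (j : Fin l) : Fin n := ⟨k + j, by omega⟩

/-- The decomposition of the set of indices into two blocks. -/
def eB (h : k + l = n) : Fin k ⊕ Fin l ≃ Fin n := finSumFinEquiv.trans (finCongr h)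

theorem eB_inl (h : k + l = n) (i : Fin k) : eB h (Sum.inl i) = iL h i := rfl

theorem eB_inr (h : k + l = n) (i : Fin l) : eB h (Sum.inr i) = iR h i := rfl

@[simp] theorem eB_symm_iL (h : k + l = n) (i : Fin k) : (eB h).symm (iL h i) = Sum.inl i := by
  rw [← eB_inl h, Equiv.symm_apply_apply]

@[simp] theorem eB_symm_iR (h : k + l = n) (i : Fin l) : (eB h).symm (iR h i) = Sum.inr i := by
  rw [← eB_inr h, Equiv.symm_apply_apply]

theorem forall_fin_block (h : k + l = n) {p : Fin n → Prop} :
    (∀ i, p i) ↔ (∀ i, p (iL h i)) ∧ ∀ j, p (iR h j) := by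
  rw [← (eB h).forall_congr_right, Sum.forall]; rfl

theorem sum_fin_block (h : k + l = n) {M : Type*} [AddCommMonoid M] (f : Fin n → M) :
    ∑ i, f i = ∑ i, f (iL h i) + ∑ j, f (iR h j) := by
  rw [← (eB h).sum_comp, Fintype.sum_sum_type]; rfl

/-- A matrix composed of four blocks. -/
def mblk (h : k + l = n) (A : Matrix (Fin k) (Fin k) D) (B : Matrix (Fin k) (Fin l) D)
    (C : Matrix (Fin l) (Fin k) D) (E : Matrix (Fin l) (Fin l) D) : Matrix (Fin n) (Fin n) D :=
  (Matrix.fromBlocks A B C E).submatrix (eB h).symm (eB h).symm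

section mblk

variable (h : k + l = n) (A A' : Matrix (Fin k) (Fin k) D) (B B' : Matrix (Fin k) (Fin l) D)
  (C C' : Matrix (Fin l) (Fin k) D) (E E' : Matrix (Fin l) (Fin l) D)

@[simp] theorem mblk_LL (i j) : mblk h A B C E (iL h i) (iL h j) = A i j := by simp [mblk]
@[simp] theorem mblk_LR (i j) : mblk h A B C E (iL h i) (iR h j) = B i j := by simp [mblk]
@[simp] theorem mblk_RL (i j) : mblk h A B C E (iR h i) (iL h j) = C i j := by simp [mblk]
@[simp] theorem mblk_RR (i j) : mblk h A B C E (iR h i) (iR h j) = E i j := by simp [mblk]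

theorem matrix_ext_block {M N : Matrix (Fin n) (Fin n) D}
    (h₁ : ∀ i j, M (iL h i) (iL h j) = N (iL h i) (iL h j))
    (h₂ : ∀ i j, M (iL h i) (iR h j) = N (iL h i) (iR h j))
    (h₃ : ∀ i j, M (iR h i) (iL h j) = N (iR h i) (iL h j))
    (h₄ : ∀ i j, M (iR h i) (iR h j) = N (iR h i) (iR h j)) : M = N := by
  ext i j
  revert i j
  refine (forall_fin_block h).2 ⟨fun i => (forall_fin_block h).2 ⟨h₁ i, h₂ i⟩,
    fun i => (forall_fin_block h).2 ⟨h₃ i, h₄ i⟩⟩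

theorem mblk_submatrix (M : Matrix (Fin n) (Fin n) D) :
    mblk h (M.submatrix (iL h) (iL h)) (M.submatrix (iL h) (iR h)) (M.submatrix (iR h) (iL h))
      (M.submatrix (iR h) (iR h)) = M := by
  apply matrix_ext_block h <;> simp

theorem mblk_mul : mblk h A B C E * mblk h A' B' C' E' =
    mblk h (A * A' + B * C') (A * B' + B * E') (C * A' + E * C') (C * B' + E * E') := by
  simp only [mblk]
  rw [Matrix.submatrix_mul_equiv, Matrix.fromBlocks_multiply]

theorem mblk_add : mblk h A B C E + mblk h A' B' C' E' =
    mblk h (A + A') (B + B') (C + C') (E + E') := by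
  apply matrix_ext_block h <;> simp

theorem mblk_one : mblk h (1 : Matrix (Fin k) (Fin k) D) 0 0 1 = 1 := by
  simp [mblk]

theorem one_add_mblk : 1 + mblk h A B C E = mblk h (1 + A) B C (1 + E) := by
  rw [← mblk_one h, mblk_add, zero_add, zero_add]

theorem mblk_conjTranspose [StarRing D] : (mblk h A B C E)ᴴ = mblk h Aᴴ Cᴴ Bᴴ Eᴴ := by
  apply matrix_ext_block h <;> simp

theorem mblk_trace : (mblk h A B C E).trace = A.trace + E.trace := by
  rw [Matrix.trace, sum_fin_block h]; simp [Matrix.trace]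

end mblk

/-! ### Unipotent matrices -/

/-- Upper triangular with unit diagonal. -/
def IsUni (u : Matrix (Fin n) (Fin n) D) : Prop := (∀ i j, j < i → u i j = 0) ∧ ∀ i, u i i = 1

/-- Strictly upper triangular. -/
def IsSUT (p : Matrix (Fin n) (Fin n) D) : Prop := ∀ i j, j ≤ i → p i j = 0

theorem isUni_one_add_iff {p : Matrix (Fin n) (Fin n) D} : IsUni (1 + p) ↔ IsSUT p := by
  constructor
  · rintro ⟨h1, h2⟩ i j hij
    rcases hij.lt_or_eq with hij | rfl
    · simpa [Matrix.one_apply_ne hij.ne'] using h1 i j hij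
    · simpa using h2 j
  · intro h
    refine ⟨fun i j hij => ?_, fun i => ?_⟩
    · simp [Matrix.one_apply_ne hij.ne', h i j hij.le]
    · simp [h i i le_rfl]

theorem IsSUT.pow_apply {p : Matrix (Fin n) (Fin n) D} (hp : IsSUT p) (a : ℕ) :
    ∀ i j : Fin n, (j : ℕ) < i + a → (p ^ a) i j = 0 := by
  induction a with
  | zero => intro i j hij; rw [pow_zero, Matrix.one_apply_ne]; rintro rfl; omega
  | succ a ih =>
    intro i j hij
    rw [pow_succ, Matrix.mul_apply]
    refine Finset.sum_eq_zero fun r _ => ?_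
    by_cases hr : (r : ℕ) < i + a
    · rw [ih i r hr, zero_mul]
    · rw [hp r j (by rw [Fin.le_def]; omega), mul_zero]

theorem IsSUT.pow_eq_zero {p : Matrix (Fin n) (Fin n) D} (hp : IsSUT p) : p ^ n = 0 := by
  ext i j
  exact hp.pow_apply n i j (by omega)

theorem IsSUT.isNilpotent {p : Matrix (Fin n) (Fin n) D} (hp : IsSUT p) : IsNilpotent p :=
  ⟨n, hp.pow_eq_zero⟩

/-- The inverse of `1 + p` for nilpotent `p`. -/
noncomputable def geom (p : Matrix (Fin n) (Fin n) D) : Matrix (Fin n) (Fin n) D :=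
  ∑ i ∈ Finset.range n, (-p) ^ i

theorem geom_mul {p : Matrix (Fin n) (Fin n) D} (hp : IsSUT p) : geom p * (1 + p) = 1 := by
  have h := geom_sum_mul (-p) n
  have h2 : (-p) ^ n = 0 := by rw [neg_pow, hp.pow_eq_zero, mul_zero]
  rw [h2, zero_sub] at h
  calc geom p * (1 + p) = -(geom p * (-p - 1)) := by
        rw [← mul_neg]; congr 1; abel
    _ = 1 := by rw [geom, h, neg_neg]

theorem mul_geom {p : Matrix (Fin n) (Fin n) D} (hp : IsSUT p) : (1 + p) * geom p = 1 :=
  mul_eq_one_comm.1 (geom_mul hp)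

theorem IsUni.isSUT {u : Matrix (Fin n) (Fin n) D} (hu : IsUni u) : IsSUT (u - 1) :=
  isUni_one_add_iff.1 (by rwa [add_sub_cancel])

theorem IsUni.one : IsUni (1 : Matrix (Fin n) (Fin n) D) :=
  ⟨fun i j h => by simp [h.ne'], fun i => by simp⟩

theorem IsUni.mul {u v : Matrix (Fin n) (Fin n) D} (hu : IsUni u) (hv : IsUni v) :
    IsUni (u * v) := by
  refine ⟨fun i j h => ?_, fun i => ?_⟩
  · rw [Matrix.mul_apply]
    refine Finset.sum_eq_zero fun k _ => ?_
    rcases lt_or_ge k i with hk | hk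
    · rw [hu.1 i k hk, zero_mul]
    · rw [hv.1 k j (h.trans_le hk), mul_zero]
  · rw [Matrix.mul_apply, Finset.sum_eq_single i]
    · rw [hu.2, hv.2, mul_one]
    · intro k _ hk
      rcases lt_or_gt_of_ne hk with hk | hk
      · rw [hu.1 i k hk, zero_mul]
      · rw [hv.1 k i hk, mul_zero]
    · simp

theorem IsUni.det_eq_one {u : Matrix (Fin n) (Fin n) D} (hu : IsUni u) : u.det = 1 := by
  rw [Matrix.det_of_isUpperTriangular (fun i j h => hu.1 i j h)]
  simp [hu.2]

theorem IsUni.mblk {h : k + l = n} {u : Matrix (Fin k) (Fin k) D} {w : Matrix (Fin l) (Fin l) D}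
    (hu : IsUni u) (hw : IsUni w) (v : Matrix (Fin k) (Fin l) D) : IsUni (mblk h u v 0 w) := by
  constructor
  · refine (forall_fin_block h).2 ⟨fun i => (forall_fin_block h).2 ⟨fun j hij => ?_, fun j hij => ?_⟩,
      fun i => (forall_fin_block h).2 ⟨fun j hij => ?_, fun j hij => ?_⟩⟩
    · rw [mblk_LL]; exact hu.1 i j hij
    · exfalso; rw [Fin.lt_def] at hij; simp [iL, iR] at hij; omega
    · rw [mblk_RL]; rfl
    · rw [mblk_RR]
      refine hw.1 i j ?_
      rw [Fin.lt_def] at hij ⊢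
      simp only [iR] at hij; omega
  · exact (forall_fin_block h).2 ⟨fun i => by rw [mblk_LL, hu.2], fun j => by rw [mblk_RR, hw.2]⟩

theorem IsUni.exists_mblk (h : k + l = n) {u : Matrix (Fin n) (Fin n) D} (hu : IsUni u) :
    ∃ a v w, IsUni a ∧ IsUni w ∧ u = Kloosterman.mblk h a v 0 w := by
  refine ⟨u.submatrix (iL h) (iL h), u.submatrix (iL h) (iR h), u.submatrix (iR h) (iR h),
    ⟨fun i j hij => hu.1 _ _ hij, fun i => hu.2 _⟩,
    ⟨fun i j hij => hu.1 _ _ ?_, fun i => hu.2 _⟩, ?_⟩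
  · rw [Fin.lt_def] at hij ⊢; simp only [iR]; omega
  · conv_lhs => rw [← mblk_submatrix h u]
    congr 1
    ext i j
    refine hu.1 _ _ ?_
    rw [Fin.lt_def]; simp only [iR, iL]; omega

variable [NormedAlgebra ℝ D]

/-- The sum of the traces of the superdiagonal entries. -/
noncomputable def supdiag : Matrix (Fin n) (Fin n) D →ₗ[ℝ] ℝ where
  toFun u := ∑ i : Fin n, ∑ j : Fin n, if (i : ℕ) + 1 = j then Algebra.trace ℝ D (u i j) else 0
  map_add' u v := by
    rw [← Finset.sum_add_distrib]
    refine Finset.sum_congr rfl fun i _ => ?_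
    rw [← Finset.sum_add_distrib]
    refine Finset.sum_congr rfl fun j _ => ?_
    split_ifs <;> simp
  map_smul' r u := by
    rw [RingHom.id_apply, smul_eq_mul, Finset.mul_sum]
    refine Finset.sum_congr rfl fun i _ => ?_
    rw [Finset.mul_sum]
    refine Finset.sum_congr rfl fun j _ => ?_
    split_ifs <;> simp

theorem supdiag_apply (u : Matrix (Fin n) (Fin n) D) : supdiag u =
    ∑ i : Fin n, ∑ j : Fin n, if (i : ℕ) + 1 = j then Algebra.trace ℝ D (u i j) else 0 := rfl

theorem supdiag_one : supdiag (1 : Matrix (Fin n) (Fin n) D) = 0 := by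
  rw [supdiag_apply]
  refine Finset.sum_eq_zero fun i _ => Finset.sum_eq_zero fun j _ => ?_
  split_ifs with h
  · rw [Matrix.one_apply_ne, map_zero]
    rintro rfl; omega
  · rfl

theorem supdiag_mul {u v : Matrix (Fin n) (Fin n) D} (hu : IsUni u) (hv : IsUni v) :
    supdiag (u * v) = supdiag u + supdiag v := by
  rw [← map_add]
  simp only [supdiag_apply]
  refine Finset.sum_congr rfl fun i _ => Finset.sum_congr rfl fun j _ => ?_
  split_ifs with hij
  · congr 1
    have hne : i ≠ j := by rintro rfl; omega
    rw [Matrix.mul_apply, ← Finset.sum_subset (Finset.subset_univ {i, j}), Finset.sum_pair hne,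
      hu.2 i, hv.2 j, one_mul, mul_one, add_comm]
    · rfl
    intro k _ hk
    simp only [Finset.mem_insert, Finset.mem_singleton, not_or] at hk
    rcases lt_or_gt_of_ne hk.1 with h | h
    · rw [hu.1 i k h, zero_mul]
    · have h3 : j < k := by
        have h4 := hk.2
        rw [Fin.lt_def] at h ⊢
        rw [Fin.ext_iff] at h4
        omega
      rw [hv.1 k j h3, mul_zero]
  · rfl

end

attribute [local instance] matrixUniformSpace matrixTopologicalSpace

section Forms

variable {k l m n : ℕ} {D : Type*} [NormedCommRing D] [NormedAlgebra ℝ D] [StarRing D]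
  [StarModule ℝ D]

/-! ### The action on hermitian matrices -/

theorem conjT (x : Herm n D) : x.1ᴴ = x.1 := x.2

/-- The map `x ↦ vᴴ x v`. -/
noncomputable def hact (v : Matrix (Fin k) (Fin l) D) : Herm k D →ₗ[ℝ] Herm l D where
  toFun x := ⟨vᴴ * x.1 * v, by
    change (vᴴ * x.1 * v)ᴴ = _
    simp [Matrix.conjTranspose_mul, conjT x, Matrix.mul_assoc]⟩
  map_add' x y := Subtype.ext (by simp [Matrix.mul_add, Matrix.add_mul])
  map_smul' r x := Subtype.ext (by simp)

@[simp] theorem hact_coe (v : Matrix (Fin k) (Fin l) D) (x : Herm k D) :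
    (hact v x).1 = vᴴ * x.1 * v := rfl

theorem hact_mul (u : Matrix (Fin k) (Fin l) D) (v : Matrix (Fin l) (Fin m) D) (x : Herm k D) :
    hact (u * v) x = hact v (hact u x) :=
  Subtype.ext (by simp [Matrix.conjTranspose_mul, Matrix.mul_assoc])

@[simp] theorem hact_one (x : Herm k D) : hact 1 x = x := Subtype.ext (by simp)

@[simp] theorem hact_zero (x : Herm k D) : hact (0 : Matrix (Fin k) (Fin l) D) x = 0 :=
  Subtype.ext (by simp)

theorem act_eq_hact (u : unip n D) (x : Herm n D) : act u x = hact u.1.val x := rfl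

/-- The hermitian matrix `m + mᴴ`. -/
noncomputable def hsym : Matrix (Fin n) (Fin n) D →ₗ[ℝ] Herm n D where
  toFun m := ⟨m + mᴴ, by
    change (m + mᴴ)ᴴ = _
    simp [add_comm]⟩
  map_add' x y := Subtype.ext (by simp; abel)
  map_smul' r x := Subtype.ext (by simp)

@[simp] theorem hsym_coe (x : Matrix (Fin n) (Fin n) D) : (hsym x).1 = x + xᴴ := rfl

/-- The hermitian matrix with the given blocks. -/
noncomputable def hblk (h : k + l = n) (s : Herm k D) (y : Matrix (Fin k) (Fin l) D)
    (c : Herm l D) : Herm n D :=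
  ⟨mblk h s.1 y yᴴ c.1, by
    change (mblk h s.1 y yᴴ c.1)ᴴ = _
    rw [mblk_conjTranspose, conjT s, conjT c, Matrix.conjTranspose_conjTranspose]⟩

@[simp] theorem hblk_coe (h : k + l = n) (s : Herm k D) (y : Matrix (Fin k) (Fin l) D)
    (c : Herm l D) : (hblk h s y c).1 = mblk h s.1 y yᴴ c.1 := rfl

/-- The block decomposition of hermitian matrices. -/
noncomputable def hblkE (h : k + l = n) :
    (Herm k D × Matrix (Fin k) (Fin l) D × Herm l D) ≃ₗ[ℝ] Herm n D where
  toFun z := hblk h z.1 z.2.1 z.2.2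
  map_add' z w := Subtype.ext (by simp [mblk_add])
  map_smul' r z := Subtype.ext (by
    apply matrix_ext_block h <;> simp)
  invFun x := (⟨x.1.submatrix (iL h) (iL h), by
      change (x.1.submatrix (iL h) (iL h))ᴴ = _
      rw [Matrix.conjTranspose_submatrix, conjT x]⟩, x.1.submatrix (iL h) (iR h),
    ⟨x.1.submatrix (iR h) (iR h), by
      change (x.1.submatrix (iR h) (iR h))ᴴ = _
      rw [Matrix.conjTranspose_submatrix, conjT x]⟩)
  left_inv z := by
    refine Prod.ext (Subtype.ext ?_) (Prod.ext ?_ (Subtype.ext ?_)) <;> ext i j <;> simp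
  right_inv x := Subtype.ext (by
    conv_rhs => rw [← mblk_submatrix h x.1]
    rw [hblk_coe]
    congr 1
    rw [Matrix.conjTranspose_submatrix, conjT x])

theorem hblkE_apply (h : k + l = n) (z) : hblkE (D := D) h z = hblk h z.1 z.2.1 z.2.2 := rfl

theorem exists_hblk (h : k + l = n) (x : Herm n D) : ∃ s y c, x = hblk h s y c :=
  ⟨_, _, _, ((hblkE h).apply_symm_apply x).symm⟩

theorem hact_mblk (h : k + l = n) (u : Matrix (Fin k) (Fin k) D) (v : Matrix (Fin k) (Fin l) D)
    (w : Matrix (Fin l) (Fin l) D) (s : Herm k D) (c : Herm l D) :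
    hact (mblk h u v 0 w) (hblk h s 0 c) =
      hblk h (hact u s) (uᴴ * s.1 * v) (hact v s + hact w c) := Subtype.ext (by
  simp [mblk_conjTranspose, mblk_mul, Matrix.conjTranspose_mul, conjT s, Matrix.mul_assoc])

/-! ### The trace forms -/

variable [IsQuadratic D] [FiniteDimensional ℝ D] [Nontrivial D]

open Algebra (trace)

theorem trace_star (d : D) : trace ℝ D (star d) = trace ℝ D d := by
  apply (algebraMap ℝ D).injective
  rw [IsQuadratic.algebraMap_trace, IsQuadratic.algebraMap_trace, star_star, add_comm]

theorem trace_one : trace ℝ D 1 = 2 := by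
  apply (algebraMap ℝ D).injective
  rw [IsQuadratic.algebraMap_trace, star_one, map_ofNat]
  norm_num

theorem trace_algebraMap (t : ℝ) : trace ℝ D (algebraMap ℝ D t) = 2 * t := by
  rw [Algebra.algebraMap_eq_smul_one, map_smul, trace_one, smul_eq_mul, mul_comm]

theorem algebraMap_of_star_eq {d : D} (hd : star d = d) :
    algebraMap ℝ D (2⁻¹ * trace ℝ D d) = d := by
  rw [map_mul, IsQuadratic.algebraMap_trace, hd, ← two_mul, ← mul_assoc,
    ← map_ofNat (algebraMap ℝ D) 2, ← map_mul]
  norm_num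

/-- The trace form on rectangular matrices. -/
noncomputable def mform : Matrix (Fin k) (Fin l) D →ₗ[ℝ] Matrix (Fin k) (Fin l) D →ₗ[ℝ] ℝ :=
  LinearMap.mk₂ ℝ (fun y η => trace ℝ D (yᴴ * η).trace)
    (by intros; simp [Matrix.add_mul]) (by intros; simp)
    (by intros; simp [Matrix.mul_add]) (by intros; simp)

theorem mform_apply (y η : Matrix (Fin k) (Fin l) D) :
    mform y η = trace ℝ D (yᴴ * η).trace := rfl

theorem mform_eq_sum (y η : Matrix (Fin k) (Fin l) D) :
    mform y η = ∑ i, ∑ j, trace ℝ D (star (y i j) * η i j) := by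
  rw [mform_apply, Matrix.trace, _root_.map_sum, Finset.sum_comm]
  simp [Matrix.mul_apply]

theorem mform_symm (y η : Matrix (Fin k) (Fin l) D) : mform y η = mform η y := by
  rw [mform_apply, mform_apply, ← trace_star, ← Matrix.trace_conjTranspose]
  simp [Matrix.conjTranspose_mul]

theorem mform_nondegenerate :
    (mform : Matrix (Fin k) (Fin l) D →ₗ[ℝ] Matrix (Fin k) (Fin l) D →ₗ[ℝ] ℝ).Nondegenerate := by
  have : (mform : Matrix (Fin k) (Fin l) D →ₗ[ℝ] Matrix (Fin k) (Fin l) D →ₗ[ℝ] ℝ).SeparatingLeft := by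
    intro y hy
    ext i j
    rw [Matrix.zero_apply, ← star_eq_zero]
    refine IsQuadratic.eq_zero_of_trace _ fun d => ?_
    have := hy (Matrix.single i j d)
    rwa [mform_eq_sum, Finset.sum_eq_single i, Finset.sum_eq_single j,
      Matrix.single_apply_same] at this
    · intro b _ hb; rw [Matrix.single_apply_of_col_ne _ _ hb.symm]; simp
    · simp
    · intro b _ hb; simp [Matrix.single_apply_of_row_ne hb.symm]
    · simp
  exact ⟨this, fun y hy => this y fun η => by rw [mform_symm]; exact hy η⟩

/-- The trace form on hermitian matrices. -/
noncomputable def hform : Herm n D →ₗ[ℝ] Herm n D →ₗ[ℝ] ℝ :=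
  LinearMap.mk₂ ℝ (fun x y => 2⁻¹ * trace ℝ D (x.1 * y.1).trace)
    (by intros; simp [Matrix.add_mul, mul_add]) (by intros; simp; ring)
    (by intros; simp [mul_add]) (by intros; simp; ring)

theorem hform_apply (x y : Herm n D) : hform x y = 2⁻¹ * trace ℝ D (x.1 * y.1).trace := rfl

theorem hform_symm (x y : Herm n D) : hform x y = hform y x := by
  rw [hform_apply, hform_apply, Matrix.trace_mul_comm]

theorem hform_hsym (x : Herm n D) (y : Matrix (Fin n) (Fin n) D) :
    hform x (hsym y) = trace ℝ D (x.1 * y).trace := by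
  have : (x.1 * yᴴ).trace = star (x.1 * y).trace := by
    rw [← Matrix.trace_conjTranspose, Matrix.conjTranspose_mul, conjT x,
      Matrix.trace_mul_comm]
  rw [hform_apply, hsym_coe, Matrix.mul_add, Matrix.trace_add, this, map_add, trace_star]
  ring

theorem trace_mul_single (x : Matrix (Fin n) (Fin n) D) (i j : Fin n) (d : D) :
    (x * Matrix.single i j d).trace = x j i * d := by
  rw [Matrix.trace, Finset.sum_eq_single j]
  · simp
  · intro b _ hb
    rw [Matrix.diag_apply, Matrix.mul_single_apply_of_ne _ _ _ _ _ hb]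
  · simp

theorem hform_nondegenerate : (hform : Herm n D →ₗ[ℝ] Herm n D →ₗ[ℝ] ℝ).Nondegenerate := by
  have : (hform : Herm n D →ₗ[ℝ] Herm n D →ₗ[ℝ] ℝ).SeparatingLeft := by
    intro y hy
    apply Subtype.ext
    ext i j
    refine IsQuadratic.eq_zero_of_trace _ fun d => ?_
    have := hy (hsym (Matrix.single j i d))
    rwa [hform_hsym, trace_mul_single] at this
  exact ⟨this, fun y hy => this y fun η => by rw [hform_symm]; exact hy η⟩

theorem hform_hblk (h : k + l = n) (s s' : Herm k D) (y y' : Matrix (Fin k) (Fin l) D)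
    (c c' : Herm l D) :
    hform (hblk h s y c) (hblk h s' y' c') = hform s s' + mform y y' + hform c c' := by
  have h1 : trace ℝ D (y * y'ᴴ).trace = mform y y' := by
    rw [mform_symm, mform_apply, Matrix.trace_mul_comm]
  simp only [hform_apply, hblk_coe, mblk_mul, mblk_trace, Matrix.trace_add, map_add, h1]
  rw [mform_apply]
  ring

theorem hform_hact (v : Matrix (Fin k) (Fin l) D) (x : Herm k D) (y : Herm l D) :
    hform (hact v x) y = hform x (hact vᴴ y) := by
  rw [hform_apply, hform_apply, hact_coe, hact_coe, Matrix.conjTranspose_conjTranspose,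
    Matrix.mul_assoc, Matrix.mul_assoc, Matrix.trace_mul_comm]
  simp only [Matrix.mul_assoc]

/-- The real number `t` as a hermitian matrix of size one. -/
noncomputable def hreal : ℝ →ₗ[ℝ] Herm 1 D where
  toFun t := ⟨algebraMap ℝ (Matrix (Fin 1) (Fin 1) D) t, by
    change (algebraMap ℝ (Matrix (Fin 1) (Fin 1) D) t)ᴴ = _
    rw [Algebra.algebraMap_eq_smul_one]; simp⟩
  map_add' s t := Subtype.ext (by simp)
  map_smul' s t := Subtype.ext (by simp [Algebra.smul_def])

theorem hreal_coe (t : ℝ) : (hreal (D := D) t).1 = t • 1 := by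
  rw [← Algebra.algebraMap_eq_smul_one]; rfl

theorem exists_hreal (x : Herm 1 D) : ∃ t : ℝ, x = hreal t := by
  refine ⟨2⁻¹ * trace ℝ D (x.1 0 0), Subtype.ext ?_⟩
  ext i j
  rw [Subsingleton.elim i 0, Subsingleton.elim j 0, hreal_coe, Matrix.smul_apply,
    Matrix.one_apply_eq, ← Algebra.algebraMap_eq_smul_one, algebraMap_of_star_eq]
  exact congrFun (congrFun (conjT x) 0) 0

theorem hact_hreal (η : Matrix (Fin 1) (Fin l) D) (t : ℝ) :
    hact η (hreal t) = t • hact η (hreal 1) := by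
  rw [← map_smul, ← map_smul, smul_eq_mul, mul_one]

/-- Translation of `s` by multiples of η ηᴴ is a phase under the Fourier transform; this identity
makes that phase a Gaussian in η with the quadratic form of `s`. -/
theorem hform_hact_hreal (s : Herm k D) (η : Matrix (Fin k) (Fin 1) D) :
    hform s (hact ηᴴ (hreal 1)) = 2⁻¹ * mform (s.1 * η) η := by
  rw [hform_apply, mform_apply, hact_coe, hreal_coe, one_smul, Matrix.mul_one,
    Matrix.conjTranspose_conjTranspose, Matrix.conjTranspose_mul, conjT s,
    ← Matrix.mul_assoc, Matrix.trace_mul_comm, Matrix.mul_assoc]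

/-! ### The superdiagonal of block matrices -/

variable (k l D) in
/-- The corner matrix, with the entry `1` next to the diagonal. -/
def corner : Matrix (Fin k) (Fin l) D :=
  fun i j => if (i : ℕ) + 1 = k ∧ (j : ℕ) = 0 then 1 else 0

/-- The two diagonal blocks are joined on the superdiagonal by the lower left entry of the upper
right block, which is what `corner` selects. -/
theorem supdiag_mblk (h : k + l = n) (p : Matrix (Fin k) (Fin k) D) (v : Matrix (Fin k) (Fin l) D)
    (q : Matrix (Fin l) (Fin l) D) :
    supdiag (mblk h p v 0 q) = supdiag p + mform (corner k l D) v + supdiag q := by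
  simp only [supdiag_apply, sum_fin_block h, mblk_LL, mblk_LR, mblk_RL, mblk_RR, mform_eq_sum,
    Finset.sum_add_distrib, Matrix.zero_apply, map_zero, ite_self, Finset.sum_const_zero, zero_add]
  congr 1
  · congr 1
    refine Finset.sum_congr rfl fun i _ => Finset.sum_congr rfl fun j _ => ?_
    have : ((iL h i : ℕ) + 1 = iR h j) ↔ ((i : ℕ) + 1 = k ∧ (j : ℕ) = 0) := by
      simp only [iL, iR]; omega
    simp only [this, corner]
    split_ifs <;> simp
  · refine Finset.sum_congr rfl fun i _ => Finset.sum_congr rfl fun j _ => ?_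
    have : ((iR h i : ℕ) + 1 = iR h j) ↔ ((i : ℕ) + 1 = j) := by
      simp only [iR]; omega
    simp only [this]

/-! ### Reversal of the order of the indices -/

/-- Conjugation by the longest permutation. -/
noncomputable def hrev : Herm n D ≃ₗ[ℝ] Herm n D where
  toFun x := ⟨x.1.submatrix Fin.rev Fin.rev, by
    change (x.1.submatrix Fin.rev Fin.rev)ᴴ = _
    rw [Matrix.conjTranspose_submatrix, conjT x]⟩
  map_add' x y := rfl
  map_smul' r x := rfl
  invFun x := ⟨x.1.submatrix Fin.rev Fin.rev, by
    change (x.1.submatrix Fin.rev Fin.rev)ᴴ = _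
    rw [Matrix.conjTranspose_submatrix, conjT x]⟩
  left_inv x := Subtype.ext (by ext; simp)
  right_inv x := Subtype.ext (by ext; simp)

@[simp] theorem hrev_coe (x : Herm n D) : (hrev x).1 = x.1.submatrix Fin.rev Fin.rev := rfl

@[simp] theorem hrev_hrev (x : Herm n D) : hrev (hrev x) = x := hrev.left_inv x

variable (k l D) in
/-- The anti-transposition of rectangular matrices. -/
noncomputable def mrev : Matrix (Fin k) (Fin l) D ≃ₗ[ℝ] Matrix (Fin l) (Fin k) D where
  toFun y := yᴴ.submatrix Fin.rev Fin.rev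
  map_add' x y := by ext; simp
  map_smul' r x := by ext; simp
  invFun y := yᴴ.submatrix Fin.rev Fin.rev
  left_inv x := by ext; simp
  right_inv x := by ext; simp

theorem mrev_apply (y : Matrix (Fin k) (Fin l) D) : mrev k l D y = yᴴ.submatrix Fin.rev Fin.rev :=
  rfl

theorem hrev_hblk (h : k + l = n) (h' : l + k = n) (s : Herm k D) (y : Matrix (Fin k) (Fin l) D)
    (c : Herm l D) : hrev (hblk h s y c) = hblk h' (hrev c) (mrev k l D y) (hrev s) := by
  have hL : ∀ i, Fin.rev (iL h' i) = iR h (Fin.rev i) := fun i => by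
    apply Fin.ext; simp only [iL, iR, Fin.val_rev]; omega
  have hR : ∀ i, Fin.rev (iR h' i) = iL h (Fin.rev i) := fun i => by
    apply Fin.ext; simp only [iL, iR, Fin.val_rev]; omega
  apply Subtype.ext
  apply matrix_ext_block h' <;> intro i j <;> simp [hL, hR, mrev_apply]

theorem mform_corner_mrev (y : Matrix (Fin k) (Fin l) D) :
    mform (corner l k D) (mrev k l D y) = mform (corner k l D) y := by
  rw [mform_eq_sum, mform_eq_sum, ← Equiv.sum_comp Fin.revPerm, Finset.sum_comm,
    ← Equiv.sum_comp Fin.revPerm]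
  refine Finset.sum_congr rfl fun i _ => Finset.sum_congr rfl fun j _ => ?_
  have : (((Fin.rev j : Fin l) : ℕ) + 1 = l ∧ ((Fin.rev i : Fin k) : ℕ) = 0) ↔
      ((i : ℕ) + 1 = k ∧ (j : ℕ) = 0) := by
    simp only [Fin.val_rev]; omega
  simp only [corner, mrev_apply, Fin.revPerm_apply, this]
  split_ifs <;> simp [trace_star]

end Forms

section Charts

variable {k l m n : ℕ} {D : Type*} [NormedCommRing D] [NormedAlgebra ℝ D] [StarRing D]
  [StarModule ℝ D] [FiniteDimensional ℝ D]

/-! ### Temperate growth of polynomial matrix operations -/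

section TemperateMatrix

variable {E : Type*} [NormedAddCommGroup E] [NormedSpace ℝ E]

theorem htg_const {G : Type*} [NormedAddCommGroup G] [NormedSpace ℝ G] (c : G) :
    (fun _ : E => c).HasTemperateGrowth := Function.HasTemperateGrowth.const c

theorem htg_mul {a : E → Matrix (Fin k) (Fin l) D} {b : E → Matrix (Fin l) (Fin m) D}
    (ha : a.HasTemperateGrowth) (hb : b.HasTemperateGrowth) :
    (fun x => a x * b x).HasTemperateGrowth :=
  hasTemperateGrowth_bilinear (LinearMap.mk₂ ℝ
    (fun (A : Matrix (Fin k) (Fin l) D) (B : Matrix (Fin l) (Fin m) D) => A * B)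
    (by intros; rw [Matrix.add_mul]) (by intros; simp) (by intros; rw [Matrix.mul_add])
    (by intros; simp)) ha hb

theorem htg_conjTranspose {a : E → Matrix (Fin k) (Fin l) D} (ha : a.HasTemperateGrowth) :
    (fun x => (a x)ᴴ).HasTemperateGrowth :=
  hasTemperateGrowth_linear (⟨⟨fun A => Aᴴ, fun A B => Matrix.conjTranspose_add A B⟩,
    fun r A => by simp⟩ : Matrix (Fin k) (Fin l) D →ₗ[ℝ] Matrix (Fin l) (Fin k) D) ha

theorem htg_neg {G : Type*} [NormedAddCommGroup G] [NormedSpace ℝ G] [FiniteDimensional ℝ G]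
    {a : E → G} (ha : a.HasTemperateGrowth) : (fun x => -a x).HasTemperateGrowth :=
  hasTemperateGrowth_linear (-LinearMap.id : G →ₗ[ℝ] G) ha

theorem htg_pow {a : E → Matrix (Fin n) (Fin n) D} (ha : a.HasTemperateGrowth) (i : ℕ) :
    (fun x => (a x) ^ i).HasTemperateGrowth := by
  induction i with
  | zero => simp only [pow_zero]; exact htg_const _
  | succ i ih => simpa only [pow_succ] using htg_mul ih ha

theorem htg_geom {a : E → Matrix (Fin n) (Fin n) D} (ha : a.HasTemperateGrowth) :
    (fun x => geom (a x)).HasTemperateGrowth := by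
  have : ∀ s : Finset ℕ, (fun x => ∑ i ∈ s, (-a x) ^ i).HasTemperateGrowth := by
    intro s
    induction s using Finset.induction_on with
    | empty => simp only [Finset.sum_empty]; exact htg_const _
    | insert i s his ih =>
      simp only [Finset.sum_insert his]
      exact (htg_pow (htg_neg ha) i).add ih
  exact this _

theorem htg_coe {a : E → Herm n D} (ha : a.HasTemperateGrowth) :
    (fun x => (a x).1).HasTemperateGrowth :=
  hasTemperateGrowth_linear (Herm n D).subtype ha

theorem htg_hact {a : E → Matrix (Fin k) (Fin l) D} {b : E → Herm k D}
    (ha : a.HasTemperateGrowth) (hb : b.HasTemperateGrowth) :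
    (fun x => hact (a x) (b x)).HasTemperateGrowth :=
  hasTemperateGrowth_subtype (htg_mul (htg_mul (htg_conjTranspose ha) (htg_coe hb)) ha)

end TemperateMatrix

/-! ### Charts of orbits -/

/-- The subspace `P` of strictly upper triangular matrices parametrizes the orbit of `g`. -/
structure IsChart (g : Herm n D) (P : Submodule ℝ (Matrix (Fin n) (Fin n) D)) : Prop where
  sut : ∀ p ∈ P, IsSUT p
  mul_mem : ∀ p ∈ P, ∀ q ∈ P, p * q ∈ P
  surj : ∀ u, IsUni u → ∃ p ∈ P, hact (1 + p) g = hact u g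
  leftInv : ∃ R : Herm n D → Matrix (Fin n) (Fin n) D, R.HasTemperateGrowth ∧
    ∀ p ∈ P, R (hact (1 + p) g) = p

/-- The orbital integral with respect to a chart. -/
noncomputable def OI (θ : ℝ) (g : Herm n D) (P : Submodule ℝ (Matrix (Fin n) (Fin n) D))
    (Φ : Herm n D → ℂ) : ℂ :=
  ∫ p : P, Φ (hact (1 + p.1) g) * expi θ (supdiag p.1) ∂addHaar

/-- Upper triangular block matrices with diagonal blocks in `P₁` and `P₂`. -/
def pblk (h : k + l = n) (P₁ : Submodule ℝ (Matrix (Fin k) (Fin k) D))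
    (P₂ : Submodule ℝ (Matrix (Fin l) (Fin l) D)) : Submodule ℝ (Matrix (Fin n) (Fin n) D) where
  carrier := {p | p.submatrix (iL h) (iL h) ∈ P₁ ∧ p.submatrix (iR h) (iR h) ∈ P₂ ∧
    p.submatrix (iR h) (iL h) = 0}
  add_mem' := by
    rintro p q ⟨h1, h2, h3⟩ ⟨h4, h5, h6⟩
    refine ⟨P₁.add_mem h1 h4, P₂.add_mem h2 h5, ?_⟩
    rw [Matrix.submatrix_add, Pi.add_apply, Pi.add_apply, h3, h6, add_zero]
  zero_mem' := ⟨P₁.zero_mem, P₂.zero_mem, rfl⟩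
  smul_mem' := by
    rintro r p ⟨h1, h2, h3⟩
    refine ⟨P₁.smul_mem r h1, P₂.smul_mem r h2, ?_⟩
    rw [Matrix.submatrix_smul, Pi.smul_apply, Pi.smul_apply, h3, smul_zero]

theorem mem_pblk {h : k + l = n} {P₁ : Submodule ℝ (Matrix (Fin k) (Fin k) D)}
    {P₂ : Submodule ℝ (Matrix (Fin l) (Fin l) D)} {p : Matrix (Fin n) (Fin n) D} :
    p ∈ pblk h P₁ P₂ ↔ ∃ p₁ ∈ P₁, ∃ v, ∃ p₂ ∈ P₂, p = mblk h p₁ v 0 p₂ := by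
  constructor
  · rintro ⟨h1, h2, h3⟩
    refine ⟨_, h1, p.submatrix (iL h) (iR h), _, h2, ?_⟩
    rw [← h3, mblk_submatrix]
  · rintro ⟨p₁, h1, v, p₂, h2, rfl⟩
    refine ⟨?_, ?_, ?_⟩
    · convert h1; ext; simp
    · convert h2; ext; simp
    · ext; simp

/-- The coordinates on the space of upper triangular block matrices. -/
noncomputable def pblkE (h : k + l = n) (P₁ : Submodule ℝ (Matrix (Fin k) (Fin k) D))
    (P₂ : Submodule ℝ (Matrix (Fin l) (Fin l) D)) :
    (P₂ × P₁ × Matrix (Fin k) (Fin l) D) ≃ₗ[ℝ] pblk h P₁ P₂ where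
  toFun z := ⟨mblk h z.2.1.1 z.2.2 0 z.1.1, mem_pblk.2 ⟨_, z.2.1.2, _, _, z.1.2, rfl⟩⟩
  map_add' z w := Subtype.ext (by simp [mblk_add])
  map_smul' r z := Subtype.ext (by apply matrix_ext_block h <;> simp)
  invFun p := (⟨_, p.2.2.1⟩, ⟨_, p.2.1⟩, p.1.submatrix (iL h) (iR h))
  left_inv z := by
    refine Prod.ext (Subtype.ext ?_) (Prod.ext (Subtype.ext ?_) ?_) <;> ext i j <;> simp
  right_inv p := Subtype.ext (by
    conv_rhs => rw [← mblk_submatrix h p.1]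
    rw [p.2.2.2])

theorem pblkE_coe (h : k + l = n) (P₁ : Submodule ℝ (Matrix (Fin k) (Fin k) D))
    (P₂ : Submodule ℝ (Matrix (Fin l) (Fin l) D)) (z) :
    (pblkE h P₁ P₂ z).1 = mblk h z.2.1.1 z.2.2 0 z.1.1 := rfl

theorem IsSUT.mblk {h : k + l = n} {p : Matrix (Fin k) (Fin k) D} {q : Matrix (Fin l) (Fin l) D}
    (hp : IsSUT p) (hq : IsSUT q) (v : Matrix (Fin k) (Fin l) D) : IsSUT (mblk h p v 0 q) := by
  rw [← isUni_one_add_iff, one_add_mblk]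
  exact (isUni_one_add_iff.2 hp).mblk (isUni_one_add_iff.2 hq) v

/-- The coordinates on the set of hermitian matrices whose upper left block is in the orbit of
`g₁`. -/
noncomputable def blockMap (h : k + l = n) (g₁ : Herm k D)
    (P₁ : Submodule ℝ (Matrix (Fin k) (Fin k) D))
    (z : Herm l D × P₁ × Matrix (Fin k) (Fin l) D) : Herm n D :=
  hblk h (hact (1 + z.2.1.1) g₁) ((1 + z.2.1.1)ᴴ * g₁.1 * z.2.2) (hact z.2.2 g₁ + z.1)

theorem hact_mblk_eq_blockMap (h : k + l = n) (g₁ : Herm k D) (g₂ : Herm l D)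
    {P₁ : Submodule ℝ (Matrix (Fin k) (Fin k) D)} (p : P₁) (v : Matrix (Fin k) (Fin l) D)
    (q : Matrix (Fin l) (Fin l) D) :
    hact (1 + mblk h p.1 v 0 q) (hblk h g₁ 0 g₂) = blockMap h g₁ P₁ (hact (1 + q) g₂, p, v) := by
  rw [one_add_mblk, hact_mblk, blockMap]

theorem hasTemperateGrowth_blockMap (h : k + l = n) (g₁ : Herm k D)
    (P₁ : Submodule ℝ (Matrix (Fin k) (Fin k) D)) :
    (blockMap h g₁ P₁).HasTemperateGrowth := by
  have h1 : (fun z : Herm l D × P₁ × Matrix (Fin k) (Fin l) D =>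
      1 + z.2.1.1).HasTemperateGrowth :=
    (htg_const _).add (LinearMap.hasTemperateGrowth (P₁.subtype ∘ₗ LinearMap.fst ℝ _ _ ∘ₗ
      LinearMap.snd ℝ (Herm l D) (P₁ × Matrix (Fin k) (Fin l) D)))
  have h2 : (fun z : Herm l D × P₁ × Matrix (Fin k) (Fin l) D => z.2.2).HasTemperateGrowth :=
    LinearMap.hasTemperateGrowth (LinearMap.snd ℝ _ _ ∘ₗ
      LinearMap.snd ℝ (Herm l D) (P₁ × Matrix (Fin k) (Fin l) D))
  have h3 : (fun z : Herm l D × P₁ × Matrix (Fin k) (Fin l) D => z.1).HasTemperateGrowth :=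
    LinearMap.hasTemperateGrowth (LinearMap.fst ℝ (Herm l D) (P₁ × Matrix (Fin k) (Fin l) D))
  exact hasTemperateGrowth_linear (hblkE (D := D) h).toLinearMap (hasTemperateGrowth_prodMk
    (htg_hact h1 (htg_const g₁)) (hasTemperateGrowth_prodMk
      (htg_mul (htg_mul (htg_conjTranspose h1) (htg_const g₁.1)) h2)
      ((htg_hact h2 (htg_const g₁)).add h3)))

theorem IsChart.exists_leftInverse {g : Herm n D} {P : Submodule ℝ (Matrix (Fin n) (Fin n) D)}
    (hc : IsChart g P) : ∃ r : Herm n D → P, r.HasTemperateGrowth ∧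
      ∀ p : P, r (hact (1 + p.1) g) = p := by
  obtain ⟨R, hR, h⟩ := hc.leftInv
  obtain ⟨π, hπ⟩ := P.subtype.exists_leftInverse_of_injective P.ker_subtype
  refine ⟨fun x => π (R x), hasTemperateGrowth_linear π hR, fun p => ?_⟩
  change π (R _) = p
  rw [h p.1 p.2]
  exact LinearMap.congr_fun hπ p

theorem IsChart.hasTemperateGrowth (g : Herm n D) (P : Submodule ℝ (Matrix (Fin n) (Fin n) D)) :
    (fun p : P => hact (1 + p.1) g).HasTemperateGrowth :=
  htg_hact ((htg_const _).add (LinearMap.hasTemperateGrowth P.subtype)) (htg_const g)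

/-- The blocks are decoded one after another: `p` from the upper left block by the chart, `v` from
the off-diagonal block by inverting g₁ and (1 + p)ᴴ, and the last variable by subtracting `hact v
g₁`. The inverse of 1 + p is the polynomial `geom p`, so growth stays temperate. -/
theorem exists_leftInverse_blockMap (h : k + l = n) {g₁ : Herm k D}
    {P₁ : Submodule ℝ (Matrix (Fin k) (Fin k) D)} (hc : IsChart g₁ P₁)
    {g' : Matrix (Fin k) (Fin k) D} (hg : g' * g₁.1 = 1) :
    ∃ r : Herm n D → Herm l D × P₁ × Matrix (Fin k) (Fin l) D, r.HasTemperateGrowth ∧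
      ∀ z, r (blockMap h g₁ P₁ z) = z := by
  obtain ⟨R, hR, hRp⟩ := hc.exists_leftInverse
  have key : ∃ r : (Herm k D × Matrix (Fin k) (Fin l) D × Herm l D) →
      Herm l D × P₁ × Matrix (Fin k) (Fin l) D, r.HasTemperateGrowth ∧
      ∀ c q w, r (hact (1 + q.1) g₁, (1 + q.1)ᴴ * g₁.1 * w, hact w g₁ + c) = (c, q, w) := by
    have hf : (fun x : Herm k D × Matrix (Fin k) (Fin l) D × Herm l D =>
        R x.1).HasTemperateGrowth := hR.comp (LinearMap.hasTemperateGrowth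
          (LinearMap.fst ℝ (Herm k D) (Matrix (Fin k) (Fin l) D × Herm l D)))
    have hv : (fun x : Herm k D × Matrix (Fin k) (Fin l) D × Herm l D =>
        g' * (geom (R x.1).1)ᴴ * x.2.1).HasTemperateGrowth :=
      htg_mul (htg_mul (htg_const _) (htg_conjTranspose
        (htg_geom (hasTemperateGrowth_linear P₁.subtype hf))))
        (LinearMap.hasTemperateGrowth (LinearMap.fst ℝ _ _ ∘ₗ
          LinearMap.snd ℝ (Herm k D) (Matrix (Fin k) (Fin l) D × Herm l D)))
    refine ⟨fun x => (x.2.2 - hact (g' * (geom (R x.1).1)ᴴ * x.2.1) g₁, R x.1,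
      g' * (geom (R x.1).1)ᴴ * x.2.1), hasTemperateGrowth_prodMk
      ((LinearMap.hasTemperateGrowth (LinearMap.snd ℝ _ _ ∘ₗ
        LinearMap.snd ℝ (Herm k D) (Matrix (Fin k) (Fin l) D × Herm l D))).sub
        (htg_hact hv (htg_const g₁))) (hasTemperateGrowth_prodMk hf hv), fun c q w => ?_⟩
    have h3 : g' * (geom q.1)ᴴ * ((1 + q.1)ᴴ * g₁.1 * w) = w := by
      rw [Matrix.mul_assoc, Matrix.mul_assoc (1 + q.1)ᴴ, ← Matrix.mul_assoc (geom q.1)ᴴ,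
        ← Matrix.conjTranspose_mul, mul_geom (hc.sut _ q.2), Matrix.conjTranspose_one,
        Matrix.one_mul, ← Matrix.mul_assoc, hg, Matrix.one_mul]
    simp only [hRp, h3, add_sub_cancel_left]
  obtain ⟨r, hr, hrz⟩ := key
  refine ⟨fun x => r ((hblkE h).symm x),
    hr.comp (LinearMap.hasTemperateGrowth (hblkE (D := D) h).symm.toLinearMap), ?_⟩
  rintro ⟨c, q, w⟩
  have := (hblkE (D := D) h).symm_apply_apply
    (hact (1 + q.1) g₁, (1 + q.1)ᴴ * g₁.1 * w, hact w g₁ + c)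
  rw [hblkE_apply] at this
  simp only [blockMap, this, hrz]

theorem IsChart.block (h : k + l = n) {g₁ : Herm k D} {g₂ : Herm l D}
    {P₁ : Submodule ℝ (Matrix (Fin k) (Fin k) D)} {P₂ : Submodule ℝ (Matrix (Fin l) (Fin l) D)}
    (hc₁ : IsChart g₁ P₁) (hc₂ : IsChart g₂ P₂) {g' : Matrix (Fin k) (Fin k) D}
    (hg : g' * g₁.1 = 1) : IsChart (hblk h g₁ 0 g₂) (pblk h P₁ P₂) := by
  refine ⟨?_, ?_, ?_, ?_⟩
  · intro p hp
    obtain ⟨p₁, h1, v, p₂, h2, rfl⟩ := mem_pblk.1 hp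
    exact (hc₁.sut _ h1).mblk (hc₂.sut _ h2) v
  · intro p hp q hq
    obtain ⟨p₁, h1, v, p₂, h2, rfl⟩ := mem_pblk.1 hp
    obtain ⟨q₁, h3, w, q₂, h4, rfl⟩ := mem_pblk.1 hq
    refine mem_pblk.2 ⟨_, hc₁.mul_mem _ h1 _ h3, p₁ * w + v * q₂, _, hc₂.mul_mem _ h2 _ h4, ?_⟩
    rw [mblk_mul]
    simp
  · intro u hu
    obtain ⟨a, v, w, ha, hw, rfl⟩ := hu.exists_mblk h
    obtain ⟨p₁, hp₁, h1⟩ := hc₁.surj a ha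
    obtain ⟨p₂, hp₂, h2⟩ := hc₂.surj w hw
    have hav : a * (geom (a - 1) * v) = v := by
      have := mul_geom ha.isSUT
      rw [add_sub_cancel] at this
      rw [← Matrix.mul_assoc, this, Matrix.one_mul]
    -- `geom (a - 1)` is a⁻¹. Since `a` and 1 + p₁ carry g₁ to the same matrix, replacing `v` by (1
    -- + p₁) a⁻¹ v leaves the off-diagonal and the last block unchanged.
    refine ⟨mblk h p₁ ((1 + p₁) * (geom (a - 1) * v)) 0 p₂, mem_pblk.2 ⟨_, hp₁, _, _, hp₂, rfl⟩, ?_⟩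
    rw [one_add_mblk, hact_mblk, hact_mblk, h1, h2, hact_mul, h1, ← hact_mul, hav,
      ← Matrix.mul_assoc, ← hact_coe, h1, hact_coe, Matrix.mul_assoc, hav]
  · obtain ⟨r, hr, hrz⟩ := exists_leftInverse_blockMap h hc₁ hg
    obtain ⟨R, hR, hRp⟩ := hc₂.exists_leftInverse
    refine ⟨fun x => (pblkE h P₁ P₂ (R (r x).1, (r x).2)).1, ?_, ?_⟩
    · exact hasTemperateGrowth_linear ((pblk h P₁ P₂).subtype ∘ₗ (pblkE h P₁ P₂).toLinearMap)
        (hasTemperateGrowth_prodMk (hR.comp (hasTemperateGrowth_linear (LinearMap.fst ℝ _ _) hr))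
          (hasTemperateGrowth_linear (LinearMap.snd ℝ _ _) hr))
    · intro p hp
      obtain ⟨p₁, h1, v, p₂, h2, rfl⟩ := mem_pblk.1 hp
      rw [hact_mblk_eq_blockMap h g₁ g₂ ⟨p₁, h1⟩]
      simp only [hrz, pblkE_coe]
      rw [hRp ⟨p₂, h2⟩]

theorem IsChart.trivial (g : Herm n D) (hn : n ≤ 1) : IsChart g ⊥ where
  sut p hp := by rw [(Submodule.mem_bot ℝ).1 hp]; intro i j _; rfl
  mul_mem p hp q _ := by rw [(Submodule.mem_bot ℝ).1 hp, Matrix.zero_mul]; exact zero_mem _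
  surj u hu := ⟨0, zero_mem _, by
    congr 2
    ext i j
    have : i = j := Fin.ext (by omega)
    subst this
    simp [hu.2]⟩
  leftInv := ⟨fun _ => 0, htg_const _, fun p hp => ((Submodule.mem_bot ℝ).1 hp).symm⟩

/-- This is the source of all absolute convergence: the integrand of an orbital integral is a
Schwartz function in the chart. -/
theorem IsChart.isSchwartz {g : Herm n D} {P : Submodule ℝ (Matrix (Fin n) (Fin n) D)}
    (hc : IsChart g P) (θ : ℝ) {Φ : Herm n D → ℂ} (hΦ : IsSchwartz Φ) :
    IsSchwartz fun p : P => Φ (hact (1 + p.1) g) * expi θ (supdiag p.1) := by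
  obtain ⟨r, hr, h⟩ := hc.exists_leftInverse
  exact (hΦ.comp_leftInverse (IsChart.hasTemperateGrowth g P) hr h).mul_temperate
    (hasTemperateGrowth_expi_comp θ (LinearMap.hasTemperateGrowth (supdiag ∘ₗ P.subtype)))

end Charts

section Antidiagonal

variable {k l m n : ℕ} {D : Type*} [NormedCommRing D]

/-! ### The antidiagonal blocks -/

variable (k D) in
/-- The matrix of the longest permutation. -/
def wmat : Matrix (Fin k) (Fin k) D := fun i j => if Fin.rev i = j then 1 else 0

theorem wmat_mul_apply (T : Matrix (Fin k) (Fin l) D) (i j) :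
    (wmat k D * T) i j = T (Fin.rev i) j := by
  simp [wmat, Matrix.mul_apply]

theorem wmat_mul_wmat : wmat k D * wmat k D = 1 := by
  ext i j
  rw [wmat_mul_apply]
  simp [wmat, Matrix.one_apply]

theorem wmat_conjTranspose [StarRing D] : (wmat k D)ᴴ = wmat k D := by
  ext i j
  simp only [Matrix.conjTranspose_apply, wmat]
  have : (Fin.rev j = i) ↔ (Fin.rev i = j) := by rw [Fin.rev_eq_iff, eq_comm]
  simp only [this]
  split_ifs <;> simp

theorem conjTranspose_wmat_mul_apply [StarRing D] (T T' : Matrix (Fin k) (Fin k) D) (i j) :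
    (Tᴴ * wmat k D * T') i j = ∑ r, star (T r i) * T' (Fin.rev r) j := by
  rw [Matrix.mul_assoc, Matrix.mul_apply]
  simp [wmat_mul_apply]

/-- In the sum for the entry (i, j) the two factors have index sums that add up to i + j + k - 1,
and both must be at least `k` to contribute; so each is less than i + j. The quadratic term at a
given depth below the antidiagonal therefore depends only on entries of smaller depth, which makes
the equation for `wsol` triangular. -/
theorem conjTranspose_wmat_mul_congr [StarRing D] {T T' : Matrix (Fin k) (Fin k) D} {a : ℕ}
    (hT : ∀ i j : Fin k, (i : ℕ) + j < k → T i j = 0)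
    (hT' : ∀ i j : Fin k, (i : ℕ) + j < k → T' i j = 0)
    (h : ∀ i j : Fin k, (i : ℕ) + j < k + a → T i j = T' i j) (i j : Fin k)
    (hij : (i : ℕ) + j < k + a + 1) :
    (Tᴴ * wmat k D * T) i j = (T'ᴴ * wmat k D * T') i j := by
  rw [conjTranspose_wmat_mul_apply, conjTranspose_wmat_mul_apply]
  refine Finset.sum_congr rfl fun r _ => ?_
  by_cases h1 : (r : ℕ) + i < k
  · rw [hT r i h1, hT' r i h1]; simp
  by_cases h2 : ((Fin.rev r : Fin k) : ℕ) + j < k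
  · rw [hT _ j h2, hT' _ j h2]; simp
  rw [Fin.val_rev] at h2
  rw [h r i (by omega), h (Fin.rev r) j (by rw [Fin.val_rev]; omega)]

variable [NormedAlgebra ℝ D]

/-- The upper triangular part of a matrix, with half of the diagonal. -/
noncomputable def upperHalf : Matrix (Fin k) (Fin k) D →ₗ[ℝ] Matrix (Fin k) (Fin k) D where
  toFun X := Matrix.of fun i j =>
    if i < j then X i j else if i = j then (2 : ℝ)⁻¹ • X i j else 0
  map_add' X Y := by
    ext i j
    simp only [Matrix.of_apply, Matrix.add_apply]
    split_ifs <;> simp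
  map_smul' r X := by
    ext i j
    simp only [Matrix.of_apply, Matrix.smul_apply, RingHom.id_apply]
    split_ifs
    · rfl
    · rw [smul_comm]
    · rw [smul_zero]

theorem upperHalf_apply (X : Matrix (Fin k) (Fin k) D) (i j) :
    upperHalf X i j = if i < j then X i j else if i = j then (2 : ℝ)⁻¹ • X i j else 0 := rfl

variable [StarRing D]

theorem upperHalf_add_conjTranspose [StarModule ℝ D] {X : Matrix (Fin k) (Fin k) D}
    (hX : Xᴴ = X) : upperHalf X + (upperHalf X)ᴴ = X := by
  have h : ∀ i j, star (X i j) = X j i := fun i j => by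
    conv_rhs => rw [← hX]
    rfl
  ext i j
  rw [Matrix.add_apply, Matrix.conjTranspose_apply, upperHalf_apply, upperHalf_apply]
  rcases lt_trichotomy i j with hij | rfl | hij
  · rw [if_pos hij, if_neg hij.not_gt, if_neg hij.ne', star_zero, add_zero]
  · simp only [lt_irrefl, if_false, if_true, star_smul, h]
    rw [star_trivial, ← add_smul]
    norm_num
  · rw [if_pos hij, if_neg hij.not_gt, if_neg hij.ne', h, zero_add]

theorem upperHalf_eq {T : Matrix (Fin k) (Fin k) D} (h1 : ∀ i j, j < i → T i j = 0)
    (h2 : ∀ i, star (T i i) = T i i) : upperHalf (T + Tᴴ) = T := by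
  ext i j
  rw [upperHalf_apply]
  rcases lt_trichotomy i j with hij | rfl | hij
  · rw [if_pos hij, Matrix.add_apply, Matrix.conjTranspose_apply, h1 j i hij]; simp
  · simp only [lt_irrefl, if_false, if_true, Matrix.add_apply, Matrix.conjTranspose_apply, h2]
    rw [← two_smul ℝ, smul_smul]
    norm_num
  · rw [if_neg hij.not_gt, if_neg hij.ne', h1 i j hij]

/-- Successive approximations to the solution of `T + Tᴴ + Tᴴ w T = A`. -/
noncomputable def wsol (A : Matrix (Fin k) (Fin k) D) : ℕ → Matrix (Fin k) (Fin k) D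
  | 0 => 0
  | a + 1 => upperHalf (A - (wsol A a)ᴴ * wmat k D * wsol A a)

theorem htg_wsol [FiniteDimensional ℝ D] [StarModule ℝ D] {E : Type*} [NormedAddCommGroup E]
    [NormedSpace ℝ E] {A : E → Matrix (Fin k) (Fin k) D} (hA : A.HasTemperateGrowth) (a : ℕ) :
    (fun x => wsol (A x) a).HasTemperateGrowth := by
  induction a with
  | zero => exact htg_const _
  | succ a ih =>
    exact hasTemperateGrowth_linear upperHalf
      (hA.sub (htg_mul (htg_mul (htg_conjTranspose ih) (htg_const _)) ih))

theorem wsol_apply_eq_zero {A : Matrix (Fin k) (Fin k) D}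
    (hA : ∀ i j : Fin k, (i : ℕ) + j < k → A i j = 0) (a : ℕ) :
    ∀ i j : Fin k, (i : ℕ) + j < k → wsol A a i j = 0 := by
  induction a with
  | zero => intro i j _; rfl
  | succ a ih =>
    intro i j hij
    have h0 := conjTranspose_wmat_mul_congr (T := wsol A a) (T' := 0) (a := 0) ih
      (fun _ _ _ => rfl) (fun i j h => by rw [ih i j (by omega)]; rfl) i j (by omega)
    rw [Matrix.mul_zero, Matrix.zero_apply] at h0
    rw [wsol, upperHalf_apply, Matrix.sub_apply, h0, hA i j hij]
    simp

/-- By the triangularity of the quadratic term, each iteration makes one more antidiagonal final. -/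
theorem wsol_succ_eq {A : Matrix (Fin k) (Fin k) D}
    (hA : ∀ i j : Fin k, (i : ℕ) + j < k → A i j = 0) (a : ℕ) :
    ∀ i j : Fin k, (i : ℕ) + j < k + a → wsol A a i j = wsol A (a + 1) i j := by
  induction a with
  | zero =>
    intro i j hij
    rw [wsol_apply_eq_zero hA _ i j hij, wsol_apply_eq_zero hA _ i j hij]
  | succ a ih =>
    intro i j hij
    conv_lhs => rw [wsol]
    conv_rhs => rw [wsol]
    rw [upperHalf_apply, upperHalf_apply, Matrix.sub_apply, Matrix.sub_apply,
      conjTranspose_wmat_mul_congr (wsol_apply_eq_zero hA _) (wsol_apply_eq_zero hA _) ih i j hij]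

/-- The conditions on `T` in the coordinates `p = w T` on the orbit of an antidiagonal matrix. -/
structure IsWT (T : Matrix (Fin k) (Fin k) D) : Prop where
  upper : ∀ i j, j < i → T i j = 0
  diag : ∀ i, star (T i i) = T i i
  supp : ∀ i j : Fin k, (i : ℕ) + j < k → T i j = 0

theorem isWT_wsol [StarModule ℝ D] {A : Matrix (Fin k) (Fin k) D}
    (hA : ∀ i j : Fin k, (i : ℕ) + j < k → A i j = 0) (hA' : Aᴴ = A) :
    IsWT (wsol A k) ∧
      wsol A k + (wsol A k)ᴴ + (wsol A k)ᴴ * wmat k D * wsol A k = A := by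
  -- All index sums are below k + k, so the k-th approximation is a fixed point of the iteration.
  have h1 : wsol A k = upperHalf (A - (wsol A k)ᴴ * wmat k D * wsol A k) := by
    ext i j
    rw [wsol_succ_eq hA k i j (by omega)]
    rfl
  have h2 : (A - (wsol A k)ᴴ * wmat k D * wsol A k)ᴴ =
      A - (wsol A k)ᴴ * wmat k D * wsol A k := by
    rw [Matrix.conjTranspose_sub, hA', Matrix.conjTranspose_mul, Matrix.conjTranspose_mul,
      Matrix.conjTranspose_conjTranspose, wmat_conjTranspose, Matrix.mul_assoc]
  have h3 := upperHalf_add_conjTranspose h2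
  rw [← h1] at h3
  refine ⟨⟨fun i j hij => ?_, fun i => ?_, wsol_apply_eq_zero hA k⟩, ?_⟩
  · rw [h1, upperHalf_apply, if_neg hij.not_gt, if_neg hij.ne']
  · rw [h1, upperHalf_apply, if_neg (lt_irrefl _), if_pos rfl, star_smul, star_trivial,
      ← Matrix.conjTranspose_apply, h2]
  · rw [h3, sub_add_cancel]

/-- Uniqueness of the solution, by induction on the depth: once the quadratic terms agree,
`upperHalf` recovers `T` from T + Tᴴ, because `T` is upper triangular with self-conjugate diagonal.
-/
theorem IsWT.wsol_eq {T : Matrix (Fin k) (Fin k) D} (hT : IsWT T) (a : ℕ) :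
    ∀ i j : Fin k, (i : ℕ) + j < k + a →
      wsol (T + Tᴴ + Tᴴ * wmat k D * T) a i j = T i j := by
  have hA : ∀ i j : Fin k, (i : ℕ) + j < k → (T + Tᴴ + Tᴴ * wmat k D * T) i j = 0 := by
    intro i j hij
    have h0 := conjTranspose_wmat_mul_congr (T := T) (T' := 0) (a := 0) hT.supp
      (fun _ _ _ => rfl) (fun i j h => by rw [hT.supp i j (by omega)]; rfl) i j (by omega)
    rw [Matrix.mul_zero, Matrix.zero_apply] at h0
    rw [Matrix.add_apply, h0, Matrix.add_apply, Matrix.conjTranspose_apply, hT.supp i j hij,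
      hT.supp j i (by omega)]
    simp
  induction a with
  | zero =>
    intro i j hij
    rw [wsol_apply_eq_zero hA 0 i j hij, hT.supp i j hij]
  | succ a ih =>
    intro i j hij
    conv_rhs => rw [← upperHalf_eq hT.upper hT.diag]
    rw [wsol, upperHalf_apply, upperHalf_apply, Matrix.sub_apply,
      conjTranspose_wmat_mul_congr (wsol_apply_eq_zero hA _) hT.supp ih i j hij,
      Matrix.add_apply (T + Tᴴ), add_sub_cancel_right]

theorem IsWT.wsol_eq_self {T : Matrix (Fin k) (Fin k) D} (hT : IsWT T) :
    wsol (T + Tᴴ + Tᴴ * wmat k D * T) k = T := by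
  ext i j
  exact hT.wsol_eq k i j (by omega)

variable [StarModule ℝ D]

variable (k D) in
/-- The space of coordinates on the orbit of an antidiagonal matrix. -/
def PW : Submodule ℝ (Matrix (Fin k) (Fin k) D) where
  carrier := {p | IsSUT p ∧ IsWT (wmat k D * p)}
  add_mem' := by
    rintro p q ⟨h1, h2⟩ ⟨h3, h4⟩
    rw [Set.mem_ofPred, Matrix.mul_add]
    refine ⟨fun i j hij => by rw [Matrix.add_apply, h1 i j hij, h3 i j hij, add_zero],
      fun i j hij => by rw [Matrix.add_apply, h2.upper i j hij, h4.upper i j hij, add_zero],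
      fun i => by rw [Matrix.add_apply, star_add, h2.diag, h4.diag],
      fun i j hij => by rw [Matrix.add_apply, h2.supp i j hij, h4.supp i j hij, add_zero]⟩
  zero_mem' := by
    rw [Set.mem_ofPred, Matrix.mul_zero]
    exact ⟨fun _ _ _ => rfl, fun _ _ _ => rfl, fun _ => star_zero _, fun _ _ _ => rfl⟩
  smul_mem' := by
    rintro r p ⟨h1, h2⟩
    rw [Set.mem_ofPred, Matrix.mul_smul]
    exact ⟨fun i j hij => by rw [Matrix.smul_apply, h1 i j hij, smul_zero],
      fun i j hij => by rw [Matrix.smul_apply, h2.upper i j hij, smul_zero],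
      fun i => by rw [Matrix.smul_apply, star_smul, h2.diag, star_trivial],
      fun i j hij => by rw [Matrix.smul_apply, h2.supp i j hij, smul_zero]⟩

theorem IsWT.mem_PW {T : Matrix (Fin k) (Fin k) D} (hT : IsWT T) : wmat k D * T ∈ PW k D := by
  refine ⟨fun i j hij => ?_, ?_⟩
  · rw [wmat_mul_apply]
    refine hT.supp _ _ ?_
    rw [Fin.val_rev]
    rw [Fin.le_def] at hij
    omega
  · rw [← Matrix.mul_assoc, wmat_mul_wmat, Matrix.one_mul]
    exact hT

variable (k D) in
/-- The real antidiagonal matrix with entries `b`. -/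
noncomputable def wH (b : ℝ) : Herm k D :=
  ⟨b • wmat k D, by
    change (b • wmat k D)ᴴ = _
    rw [Matrix.conjTranspose_smul, wmat_conjTranspose, star_trivial]⟩

theorem wH_coe (b : ℝ) : (wH k D b).1 = b • wmat k D := rfl

theorem wH_mul_wH {b c : ℝ} (hbc : b * c = 1) : (wH k D b).1 * (wH k D c).1 = 1 := by
  rw [wH_coe, wH_coe, Matrix.smul_mul, Matrix.mul_smul, smul_smul, hbc, one_smul, wmat_mul_wmat]

theorem hact_wH (p : Matrix (Fin k) (Fin k) D) (b : ℝ) :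
    (hact (1 + p) (wH k D b)).1 = b • (wmat k D + (wmat k D * p + (wmat k D * p)ᴴ +
      (wmat k D * p)ᴴ * wmat k D * (wmat k D * p))) := by
  rw [hact_coe, wH_coe, Matrix.mul_smul, Matrix.smul_mul, Matrix.conjTranspose_mul,
    wmat_conjTranspose, Matrix.conjTranspose_add, Matrix.conjTranspose_one,
    Matrix.mul_assoc pᴴ (wmat k D) (wmat k D), wmat_mul_wmat, Matrix.mul_one]
  congr 1
  simp only [Matrix.add_mul, Matrix.mul_add, Matrix.one_mul, Matrix.mul_one, Matrix.mul_assoc]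
  abel

/-- The range i + j < k includes the antidiagonal itself, so the orbit of `w` lies in the affine
space `w` + `LW`. -/
theorem IsUni.hact_wmat_apply {u : Matrix (Fin k) (Fin k) D} (hu : IsUni u) (i j : Fin k)
    (hij : (i : ℕ) + j < k) : (uᴴ * wmat k D * u) i j = wmat k D i j := by
  rw [conjTranspose_wmat_mul_apply, Finset.sum_eq_single i]
  · rw [hu.2 i, star_one, one_mul, wmat]
    split_ifs with h
    · rw [h, hu.2]
    · refine hu.1 _ _ ?_
      rw [Fin.lt_def, Fin.val_rev]
      rw [Fin.ext_iff, Fin.val_rev] at h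
      omega
  · intro r _ hr
    rcases lt_or_gt_of_ne hr with h | h
    · rw [hu.1 _ j, mul_zero]
      rw [Fin.lt_def] at h ⊢
      rw [Fin.val_rev]
      omega
    · rw [hu.1 _ _ h, star_zero, zero_mul]
  · simp

theorem exists_mem_PW {A : Matrix (Fin k) (Fin k) D}
    (hA : ∀ i j : Fin k, (i : ℕ) + j < k → A i j = 0) (hA' : Aᴴ = A) (b : ℝ) :
    wmat k D * wsol A k ∈ PW k D ∧
      (hact (1 + wmat k D * wsol A k) (wH k D b)).1 = b • (wmat k D + A) := by
  obtain ⟨h1, h2⟩ := isWT_wsol hA hA'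
  refine ⟨h1.mem_PW, ?_⟩
  rw [hact_wH, ← Matrix.mul_assoc (wmat k D) (wmat k D), wmat_mul_wmat, Matrix.one_mul, h2]

theorem IsChart.wH [FiniteDimensional ℝ D] {b : ℝ} (hb : b ≠ 0) :
    IsChart (wH k D b) (PW k D) where
  sut p hp := hp.1
  mul_mem p hp q hq := by
    have hp' : ∀ i j : Fin k, (i : ℕ) + j + 1 < k → p i j = 0 := fun i j h => by
      have := hp.2.upper (Fin.rev i) j (by rw [Fin.lt_def, Fin.val_rev]; omega)
      rwa [wmat_mul_apply, Fin.rev_rev] at this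
    -- Elements of `PW` may be non-zero on the antidiagonal, but their products vanish there, so the
    -- condition of self-conjugacy on the antidiagonal is automatic for products.
    have hpq : ∀ i j : Fin k, (i : ℕ) + j < k → (p * q) i j = 0 := by
      intro i j hij
      rw [Matrix.mul_apply]
      refine Finset.sum_eq_zero fun r _ => ?_
      rcases lt_or_ge r j with h | h
      · rw [hp' i r (by rw [Fin.lt_def] at h; omega), zero_mul]
      · rw [hq.1 r j h, mul_zero]
    have hs : IsSUT (p * q) := fun i j hij => by
      rw [Matrix.mul_apply]
      refine Finset.sum_eq_zero fun r _ => ?_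
      rcases le_or_gt r i with h | h
      · rw [hp.1 i r h, zero_mul]
      · rw [hq.1 r j (hij.trans h.le), mul_zero]
    refine ⟨hs, fun i j hij => ?_, fun i => ?_, fun i j hij => ?_⟩
    · rw [wmat_mul_apply]
      refine hpq _ _ ?_
      rw [Fin.lt_def] at hij
      rw [Fin.val_rev]; omega
    · rw [wmat_mul_apply, hpq _ _ (by rw [Fin.val_rev]; omega), star_zero]
    · rw [wmat_mul_apply]
      refine hs _ _ ?_
      rw [Fin.le_def, Fin.val_rev]; omega
  surj u hu := by
    obtain ⟨h1, h2⟩ := exists_mem_PW (A := uᴴ * wmat k D * u - wmat k D) (fun i j hij => by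
      rw [Matrix.sub_apply, hu.hact_wmat_apply i j hij, sub_self]) (by
      rw [Matrix.conjTranspose_sub, Matrix.conjTranspose_mul, Matrix.conjTranspose_mul,
        Matrix.conjTranspose_conjTranspose, wmat_conjTranspose, Matrix.mul_assoc]) b
    refine ⟨_, h1, Subtype.ext ?_⟩
    rw [h2, add_sub_cancel, hact_coe, wH_coe, Matrix.mul_smul, Matrix.smul_mul]
  leftInv := by
    refine ⟨fun x => wmat k D * wsol (b⁻¹ • x.1 - wmat k D) k, htg_mul (htg_const _)
      (htg_wsol ((LinearMap.hasTemperateGrowth (b⁻¹ • (Herm k D).subtype)).sub (htg_const _)) k), fun p hp => ?_⟩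
    change wmat k D * wsol (b⁻¹ • (hact (1 + p) (Kloosterman.wH k D b)).1 - wmat k D) k = p
    rw [hact_wH, smul_smul, inv_mul_cancel₀ hb, one_smul, add_sub_cancel_left,
      hp.2.wsol_eq_self, ← Matrix.mul_assoc, wmat_mul_wmat, Matrix.one_mul]

/-! ### The affine coordinates on the orbit of an antidiagonal matrix -/

variable (k D) in
/-- The hermitian matrices that are supported below the antidiagonal. -/
noncomputable def LW : Submodule ℝ (Herm k D) where
  carrier := {A | ∀ i j : Fin k, (i : ℕ) + j < k → A.1 i j = 0}
  add_mem' := by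
    intro A B hA hB i j hij
    change A.1 i j + B.1 i j = 0
    rw [hA i j hij, hB i j hij, add_zero]
  zero_mem' i j _ := rfl
  smul_mem' := by
    intro r A hA i j hij
    change r • A.1 i j = 0
    rw [hA i j hij, smul_zero]

variable (k D) in
/-- The hermitian matrix with entries `b` immediately below the antidiagonal. -/
noncomputable def JW (b : ℝ) : Herm k D :=
  ⟨Matrix.of fun i j => if (i : ℕ) + j = k then algebraMap ℝ D b else 0, by
    change (Matrix.conjTranspose _) = _
    ext i j
    rw [Matrix.conjTranspose_apply, Matrix.of_apply, Matrix.of_apply, add_comm]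
    split_ifs
    · simp [Algebra.algebraMap_eq_smul_one]
    · exact star_zero _⟩

theorem JW_coe_apply (b : ℝ) (i j : Fin k) :
    (JW k D b).1 i j = if (i : ℕ) + j = k then algebraMap ℝ D b else 0 := rfl

theorem hform_JW [IsQuadratic D] [FiniteDimensional ℝ D] [Nontrivial D] (A : Herm k D) (b : ℝ) :
    hform A (JW k D b) = 2⁻¹ * (b * ∑ i : Fin k, ∑ j : Fin k,
      if (i : ℕ) + j = k then Algebra.trace ℝ D (A.1 i j) else 0) := by
  rw [hform_apply, Matrix.trace, _root_.map_sum, Finset.mul_sum (s := Finset.univ) (a := b)]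
  congr 1
  refine Finset.sum_congr rfl fun i _ => ?_
  rw [Matrix.diag_apply, Matrix.mul_apply, _root_.map_sum, Finset.mul_sum]
  refine Finset.sum_congr rfl fun j _ => ?_
  rw [JW_coe_apply, add_comm (j : ℕ)]
  split_ifs
  · rw [mul_comm, ← Algebra.smul_def, map_smul, smul_eq_mul]
  · simp

/-- The superdiagonal of `p` is the line i + j = k of T = w p, where the quadratic term of `A`
vanishes and `A` is T + Tᴴ. Hence the phase is linear in the affine coordinate `A`. -/
theorem supdiag_of_mem_PW [IsQuadratic D] [FiniteDimensional ℝ D] [Nontrivial D]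
    {p : Matrix (Fin k) (Fin k) D} (hp : p ∈ PW k D) (A : Herm k D)
    (hA : A.1 = wmat k D * p + (wmat k D * p)ᴴ +
      (wmat k D * p)ᴴ * wmat k D * (wmat k D * p)) :
    supdiag p = hform A (JW k D 1) := by
  set T := wmat k D * p with hT
  have h1 : ∀ i j : Fin k, (i : ℕ) + j = k → A.1 i j = T i j + star (T j i) := by
    intro i j hij
    have h0 := conjTranspose_wmat_mul_congr (T := T) (T' := 0) (a := 0) hp.2.supp
      (fun _ _ _ => rfl) (fun i j h => hp.2.supp i j (by omega)) i j (by omega)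
    rw [Matrix.mul_zero, Matrix.zero_apply] at h0
    rw [hA, Matrix.add_apply, h0, add_zero]
    rfl
  have h2 : supdiag p = ∑ i : Fin k, ∑ j : Fin k,
      if (i : ℕ) + j = k then Algebra.trace ℝ D (T i j) else 0 := by
    rw [supdiag_apply, ← Equiv.sum_comp Fin.revPerm]
    refine Finset.sum_congr rfl fun i _ => Finset.sum_congr rfl fun j _ => ?_
    rw [hT, wmat_mul_apply, Fin.revPerm_apply]
    have : (((Fin.rev i : Fin k) : ℕ) + 1 = j) ↔ ((i : ℕ) + j = k) := by
      rw [Fin.val_rev]; omega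
    simp only [this]
  have h3 : supdiag p = ∑ i : Fin k, ∑ j : Fin k,
      if (i : ℕ) + j = k then Algebra.trace ℝ D (star (T j i)) else 0 := by
    rw [h2, Finset.sum_comm]
    refine Finset.sum_congr rfl fun i _ => Finset.sum_congr rfl fun j _ => ?_
    rw [add_comm, trace_star]
  rw [hform_JW, one_mul, eq_inv_mul_iff_mul_eq₀ two_ne_zero, two_mul]
  nth_rewrite 1 [h2]
  rw [h3, ← Finset.sum_add_distrib]
  refine Finset.sum_congr rfl fun i _ => ?_
  rw [← Finset.sum_add_distrib]
  refine Finset.sum_congr rfl fun j _ => ?_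
  split_ifs with hij
  · rw [h1 i j hij, map_add]
  · rw [add_zero]

end Antidiagonal

/-! ### Invariant measures on unipotent groups -/

theorem isNilpotent_of_injective {E M : Type*} [AddCommGroup E] [Module ℝ E] [AddCommGroup M]
    [Module ℝ M] (ι : E →ₗ[ℝ] M) (hι : Function.Injective ι) {T : Module.End ℝ E}
    {N : Module.End ℝ M} (h : ∀ x, ι (T x) = N (ι x)) (hN : IsNilpotent N) : IsNilpotent T := by
  obtain ⟨a, ha⟩ := hN
  refine ⟨a, LinearMap.ext fun x => hι ?_⟩
  have : ∀ i x, ι ((T ^ i) x) = (N ^ i) (ι x) := by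
    intro i
    induction i with
    | zero => intro x; rfl
    | succ i ih => intro x; rw [pow_succ, pow_succ, Module.End.mul_apply, ih, h]; rfl
  rw [this, ha]
  simp

/-- An affine map with unipotent linear part has Jacobian 1. Nilpotency is tested in an ambient
space `M`, where the operator is explicit. -/
theorem measurePreserving_of_isNilpotent {E M : Type*} [NormedAddCommGroup E] [NormedSpace ℝ E]
    [FiniteDimensional ℝ E] [MeasurableSpace E] [BorelSpace E] [AddCommGroup M]
    [Module ℝ M] (ι : E →ₗ[ℝ] M) (hι : Function.Injective ι) {T : E → E} {c : E}
    {N : Module.End ℝ M} (h : ∀ x, ι (T x) = ι c + (ι x + N (ι x))) (hN : IsNilpotent N)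
    (μ : Measure E) [μ.IsAddHaarMeasure] : MeasurePreserving T μ μ := by
  have hr : ∀ x, N (ι x) ∈ LinearMap.range ι := fun x => by
    have : N (ι x) = ι (T x) - ι c - ι x := by rw [h]; abel
    rw [this, ← map_sub, ← map_sub]
    exact ⟨_, rfl⟩
  let e := LinearEquiv.ofInjective ι hι
  let T₀ : Module.End ℝ E := e.symm.toLinearMap ∘ₗ
    ((N ∘ₗ ι).codRestrict (LinearMap.range ι) hr)
  have hT₀ : ∀ x, ι (T₀ x) = N (ι x) := fun x => by
    have : (e (T₀ x) : M) = N (ι x) := by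
      simp only [T₀, LinearMap.comp_apply, LinearEquiv.coe_coe, LinearEquiv.apply_symm_apply]
      rfl
    exact this
  have h1 := measurePreserving_of_isNilpotent_sub_one (1 + T₀) (by
    rw [add_sub_cancel_left]
    exact isNilpotent_of_injective ι hι hT₀ hN) μ
  have h2 := (measurePreserving_add_left μ c).comp h1
  convert h2 using 1
  funext x
  apply hι
  rw [h]
  simp [hT₀]

theorem isMulLeftInvariant_map {X G : Type*} [TopologicalSpace X] [MeasurableSpace X] [BorelSpace X]
    [TopologicalSpace G] [MeasurableSpace G] [BorelSpace G] [Group G] [IsTopologicalGroup G]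
    (j : X ≃ₜ G) {τ : X → X → X} (hτ : ∀ q x, j (τ q x) = j q * j x) {m : Measure X}
    (hm : ∀ q, map (τ q) m = m) : (map j m).IsMulLeftInvariant := by
  refine ⟨fun a => ?_⟩
  have h1 : τ (j.symm a) = j.symm ∘ (fun y => a * y) ∘ j := by
    funext x
    rw [Function.comp_apply, Function.comp_apply, eq_comm, j.symm_apply_eq, hτ,
      j.apply_symm_apply]
  have h2 : Measurable (τ (j.symm a)) := by
    rw [h1]
    exact (j.symm.continuous.comp ((continuous_const_mul a).comp j.continuous)).measurable
  rw [map_map (measurable_const_mul a) j.measurable]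
  conv_rhs => rw [← hm (j.symm a), map_map j.measurable h2]
  congr 1
  funext x
  simp [hτ]

section Group

variable {n : ℕ} {D : Type*} [NormedCommRing D]

instance : ContinuousMul (Matrix (Fin n) (Fin n) D) :=
  (inferInstance : @ContinuousMul (Matrix (Fin n) (Fin n) D) instTopologicalSpaceMatrix _)

instance : ContinuousAdd (Matrix (Fin n) (Fin n) D) :=
  (inferInstance : @ContinuousAdd (Matrix (Fin n) (Fin n) D) instTopologicalSpaceMatrix _)

instance : ContinuousNeg (Matrix (Fin n) (Fin n) D) :=
  (inferInstance : @ContinuousNeg (Matrix (Fin n) (Fin n) D) instTopologicalSpaceMatrix _)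

theorem continuous_geom : Continuous (geom : Matrix (Fin n) (Fin n) D → _) :=
  continuous_finsetSum _ fun i _ => (continuous_neg.pow i)

variable [NormedAlgebra ℝ D]

/-- A space of strictly upper triangular matrices that is closed under multiplication. -/
structure IsNilAlg (P : Submodule ℝ (Matrix (Fin n) (Fin n) D)) : Prop where
  sut : ∀ p ∈ P, IsSUT p
  mul_mem : ∀ p ∈ P, ∀ q ∈ P, p * q ∈ P

variable {P : Submodule ℝ (Matrix (Fin n) (Fin n) D)}

theorem IsNilAlg.geom_sub_one_mem (hP : IsNilAlg P) {p : Matrix (Fin n) (Fin n) D} (hp : p ∈ P) :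
    geom p - 1 ∈ P := by
  have h : ∀ i : ℕ, (-p) ^ (i + 1) ∈ P := by
    intro i
    induction i with
    | zero => rw [zero_add, pow_one]; exact P.neg_mem hp
    | succ i ih => rw [pow_succ]; exact hP.mul_mem _ ih _ (P.neg_mem hp)
  rcases Nat.eq_zero_or_pos n with rfl | hn
  · rw [Subsingleton.elim (geom p - 1) 0]; exact P.zero_mem
  · obtain ⟨a, rfl⟩ := Nat.exists_eq_succ_of_ne_zero hn.ne'
    rw [geom, Finset.sum_range_succ', pow_zero, add_sub_cancel_right]
    exact P.sum_mem fun i _ => h i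

/-- The element `1 + p` of the group of invertible matrices. -/
noncomputable def oneAdd {p : Matrix (Fin n) (Fin n) D} (hp : IsSUT p) : GL (Fin n) D :=
  ⟨1 + p, geom p, mul_geom hp, geom_mul hp⟩

/-- The group of the matrices `1 + p` for `p ∈ P`. -/
noncomputable def IsNilAlg.group (hP : IsNilAlg P) : Subgroup (GL (Fin n) D) where
  carrier := {u | u.val - 1 ∈ P}
  one_mem' := by
    change (1 : Matrix (Fin n) (Fin n) D) - 1 ∈ P
    rw [sub_self]; exact P.zero_mem
  mul_mem' := by
    intro u v hu hv
    change u.val * v.val - 1 ∈ P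
    have : u.val * v.val - 1 = (u.val - 1) + (v.val - 1) + (u.val - 1) * (v.val - 1) := by
      noncomm_ring
    rw [this]
    exact P.add_mem (P.add_mem hu hv) (hP.mul_mem _ hu _ hv)
  inv_mem' := by
    intro u hu
    have : (u⁻¹).val = geom (u.val - 1) := by
      have h1 := geom_mul (hP.sut _ hu)
      rw [add_sub_cancel] at h1
      have h2 : u.val * (u⁻¹).val = 1 := u.mul_inv
      calc (u⁻¹).val = geom (u.val - 1) * u.val * (u⁻¹).val := by rw [h1, Matrix.one_mul]
        _ = geom (u.val - 1) := by rw [Matrix.mul_assoc, h2, Matrix.mul_one]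
    change (u⁻¹).val - 1 ∈ P
    rw [this]
    exact hP.geom_sub_one_mem hu

/-- The bijection `p ↦ 1 + p`. -/
noncomputable def IsNilAlg.homeo (hP : IsNilAlg P) : P ≃ₜ hP.group where
  toFun p := ⟨oneAdd (hP.sut p.1 p.2), by
    change 1 + p.1 - 1 ∈ P
    rw [add_sub_cancel_left]; exact p.2⟩
  invFun u := ⟨u.1.val - 1, u.2⟩
  left_inv p := Subtype.ext (add_sub_cancel_left _ _)
  right_inv u := Subtype.ext (Units.ext (add_sub_cancel _ _))
  continuous_toFun := by
    refine Continuous.subtype_mk (Units.continuous_iff.2 ⟨?_, ?_⟩) _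
    · exact continuous_const.add continuous_subtype_val
    · exact continuous_geom.comp continuous_subtype_val
  continuous_invFun := by
    refine Continuous.subtype_mk ?_ _
    exact (Units.continuous_val.comp continuous_subtype_val).sub continuous_const

/-- The group law `p + q + p q`. -/
noncomputable def IsNilAlg.op (hP : IsNilAlg P) (q p : P) : P :=
  ⟨p.1 + q.1 + p.1 * q.1, P.add_mem (P.add_mem p.2 q.2) (hP.mul_mem _ p.2 _ q.2)⟩

theorem IsNilAlg.op_coe (hP : IsNilAlg P) (q p : P) :
    (hP.op q p).1 = p.1 + q.1 + p.1 * q.1 := rfl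

theorem IsNilAlg.one_add_op (hP : IsNilAlg P) (q p : P) :
    1 + (hP.op q p).1 = (1 + p.1) * (1 + q.1) := by
  rw [op_coe]; noncomm_ring

variable [FiniteDimensional ℝ D]

theorem IsNilAlg.map_op (hP : IsNilAlg P) (q : P) : map (hP.op q) addHaar = addHaar := by
  refine (measurePreserving_of_isNilpotent P.subtype P.injective_subtype (c := q)
    (N := LinearMap.mulRight ℝ q.1) (fun x => ?_) ?_ addHaar).map_eq
  · simp only [Submodule.subtype_apply, op_coe, LinearMap.mulRight_apply]; abel
  · rw [LinearMap.isNilpotent_mulRight_iff]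
    exact (hP.sut _ q.2).isNilpotent

theorem IsNilAlg.map_op_left (hP : IsNilAlg P) (q : P) :
    map (fun p => hP.op p q) addHaar = addHaar := by
  refine (measurePreserving_of_isNilpotent P.subtype P.injective_subtype (c := q)
    (N := LinearMap.mulLeft ℝ q.1) (fun x => ?_) ?_ addHaar).map_eq
  · simp only [Submodule.subtype_apply, op_coe, LinearMap.mulLeft_apply]; abel
  · rw [LinearMap.isNilpotent_mulLeft_iff]
    exact (hP.sut _ q.2).isNilpotent

/-- Uniqueness of the invariant measure. -/
theorem IsNilAlg.exists_eq_smul_addHaar (hP : IsNilAlg P) (m : Measure P)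
    [IsFiniteMeasureOnCompacts m] (hm : ∀ q, map (hP.op q) m = m) :
    ∃ κ : NNReal, m = κ • (addHaar : Measure P) := by
  let : MeasurableSpace hP.group := borel _
  have : BorelSpace hP.group := ⟨rfl⟩
  -- The operation `op q` is right multiplication by 1 + q; inversion turns it into the left
  -- translations required for uniqueness of Haar measure.
  let j : P ≃ₜ hP.group := hP.homeo.trans (Homeomorph.inv _)
  have hj : ∀ q p, j (hP.op q p) = j q * j p := by
    intro q p
    change (hP.homeo (hP.op q p))⁻¹ = (hP.homeo q)⁻¹ * (hP.homeo p)⁻¹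
    rw [← mul_inv_rev]
    congr 1
    exact Subtype.ext (Units.ext (hP.one_add_op q p))
  have : LocallyCompactSpace hP.group := j.symm.isClosedEmbedding.locallyCompactSpace
  have : SecondCountableTopology hP.group := j.symm.isEmbedding.secondCountableTopology
  have h1 := isMulLeftInvariant_map j hj hm
  have h2 := isMulLeftInvariant_map j hj hP.map_op
  have : IsFiniteMeasureOnCompacts (map j m) := IsFiniteMeasureOnCompacts.map m j
  have : IsFiniteMeasureOnCompacts (map j (addHaar : Measure P)) :=
    IsFiniteMeasureOnCompacts.map _ j
  have : (map j (addHaar : Measure P)).IsOpenPosMeasure :=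
    j.continuous.isOpenPosMeasure_map j.surjective
  have : (map j (addHaar : Measure P)).IsHaarMeasure := {}
  have h3 := isMulLeftInvariant_eq_smul (map j m) (map j (addHaar : Measure P))
  refine ⟨haarScalarFactor (map j m) (map j (addHaar : Measure P)), ?_⟩
  rw [← Measure.map_smul] at h3
  have h4 := congrArg (map j.symm) h3
  rwa [map_map j.symm.measurable j.measurable, map_map j.symm.measurable j.measurable,
    j.symm_comp_self, map_id, map_id] at h4

end Group

/-! ### Integrals over N and over N/N_g in chart coordinates -/

section Orbits

variable {k n : ℕ} {D : Type*} [NormedCommRing D]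

theorem borelSpace_unip : BorelSpace (unip n D) := ⟨rfl⟩

attribute [local instance] borelSpace_unip

/-- The element `1 + p` of the unipotent group. -/
noncomputable def unipOf {p : Matrix (Fin n) (Fin n) D} (hp : IsSUT p) : unip n D :=
  ⟨oneAdd hp, isUni_one_add_iff.2 hp⟩

theorem unipOf_coe {p : Matrix (Fin n) (Fin n) D} (hp : IsSUT p) :
    (unipOf hp).1.val = 1 + p := rfl

theorem isUni_coe (u : unip n D) : IsUni u.1.val := u.2

theorem unipOf_coe_sub_one (u : unip n D) : unipOf (isUni_coe u).isSUT = u :=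
  Subtype.ext (Units.ext (add_sub_cancel _ _))

theorem continuous_unipOf {X : Type*} [TopologicalSpace X] {f : X → Matrix (Fin n) (Fin n) D}
    (hf : Continuous f) (h : ∀ x, IsSUT (f x)) : Continuous fun x => unipOf (h x) := by
  refine Continuous.subtype_mk (Units.continuous_iff.2 ⟨?_, ?_⟩) _
  · exact continuous_const.add hf
  · exact continuous_geom.comp hf

variable [NormedAlgebra ℝ D]

variable (n D) in
/-- The space of all strictly upper triangular matrices. -/
def sutP : Submodule ℝ (Matrix (Fin n) (Fin n) D) where
  carrier := {p | IsSUT p}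
  add_mem' hp hq i j hij := by rw [Matrix.add_apply, hp i j hij, hq i j hij, add_zero]
  zero_mem' _ _ _ := rfl
  smul_mem' r p hp i j hij := by rw [Matrix.smul_apply, hp i j hij, smul_zero]

theorem isNilAlg_sutP : IsNilAlg (sutP n D) := by
  refine ⟨fun p hp => hp, fun p hp q hq => ?_⟩
  have h := ((isUni_one_add_iff.2 hp).mul (isUni_one_add_iff.2 hq)).isSUT
  have h2 : p * q = ((1 + p) * (1 + q) - 1) - p - q := by noncomm_ring
  rw [h2]
  exact (sutP n D).sub_mem ((sutP n D).sub_mem h hp) hq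

/-- The bijection `p ↦ 1 + p` onto the group of unipotent matrices. -/
noncomputable def unipHomeo : sutP n D ≃ₜ unip n D where
  toFun p := unipOf p.2
  invFun u := ⟨u.1.val - 1, (isUni_coe u).isSUT⟩
  left_inv p := Subtype.ext (add_sub_cancel_left _ _)
  right_inv u := unipOf_coe_sub_one u
  continuous_toFun := continuous_unipOf continuous_subtype_val _
  continuous_invFun := by
    refine Continuous.subtype_mk ?_ _
    exact (Units.continuous_val.comp continuous_subtype_val).sub continuous_const

theorem chi_unipOf {ψ : AddChar ℝ Circle} {θ : ℝ} (hψ : ∀ t, (ψ t : ℂ) = expi θ t)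
    {p : Matrix (Fin n) (Fin n) D} (hp : IsSUT p) :
    (chi ψ (unipOf hp) : ℂ) = expi θ (supdiag p) := by
  rw [chi, hψ]
  congr 1
  change supdiag (1 + p) = _
  rw [map_add, supdiag_one, zero_add]

variable [StarRing D] [StarModule ℝ D] [FiniteDimensional ℝ D]

theorem exists_regularIntegral_eq' {ψ : AddChar ℝ Circle} {θ : ℝ}
    (hψ : ∀ t, (ψ t : ℂ) = expi θ t) (ν : Measure (unip n D)) [ν.IsHaarMeasure] :
    ∃ c : ℂ, c ≠ 0 ∧ ∀ (Φ : Herm n D → ℂ) (a : Fin n → ℝˣ),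
      regularIntegral ψ ν Φ a = c * OI θ (diagA a) (sutP n D) Φ := by
  let j : sutP n D ≃ₜ unip n D := unipHomeo
  have hP := isNilAlg_sutP (n := n) (D := D)
  have hj : ∀ q p, j (hP.op p q) = j q * j p := by
    intro q p
    exact Subtype.ext (Units.ext (hP.one_add_op p q))
  have : LocallyCompactSpace (unip n D) := j.symm.isClosedEmbedding.locallyCompactSpace
  have : SecondCountableTopology (unip n D) := j.symm.isEmbedding.secondCountableTopology
  have := isMulLeftInvariant_map j (τ := fun q p => hP.op p q) hj hP.map_op_left
  have : IsFiniteMeasureOnCompacts (map j (addHaar : Measure (sutP n D))) :=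
    IsFiniteMeasureOnCompacts.map _ j
  have : (map j (addHaar : Measure (sutP n D))).IsOpenPosMeasure :=
    j.continuous.isOpenPosMeasure_map j.surjective
  have : (map j (addHaar : Measure (sutP n D))).IsHaarMeasure := {}
  obtain ⟨c, hc, h3⟩ : ∃ c : NNReal, c ≠ 0 ∧ ν = c • map j (addHaar : Measure (sutP n D)) :=
    ⟨_, (haarScalarFactor_pos_of_isHaarMeasure ν (map j (addHaar : Measure (sutP n D)))).ne',
      isMulLeftInvariant_eq_smul ν (map j (addHaar : Measure (sutP n D)))⟩
  refine ⟨((c : ℝ) : ℂ), by exact_mod_cast hc, fun Φ a => ?_⟩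
  · rw [regularIntegral, h3, integral_smul_nnreal_measure, NNReal.smul_def, Complex.real_smul,
      j.measurableEmbedding.integral_map, OI]
    congr 2
    funext p
    exact congrArg₂ (· * ·) rfl (chi_unipOf hψ p.2)

theorem IsChart.isNilAlg {g : Herm n D} {P : Submodule ℝ (Matrix (Fin n) (Fin n) D)}
    (hc : IsChart g P) : IsNilAlg P := ⟨hc.sut, hc.mul_mem⟩

/-- After moving `g` by `u₀` to a point with a chart, the coset space is identified with `P`. The
action of 1 + P becomes its group law, so the push-forward of μ is a multiple of Lebesgue measure.
The constant may be zero, since μ may be. -/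
theorem exists_orbitIntegral_eq' {ψ : AddChar ℝ Circle} {θ : ℝ}
    (hψ : ∀ t, (ψ t : ℂ) = expi θ t) {g : Herm n D} (hg : IsRelevant ψ g) (u₀ : unip n D)
    {P : Submodule ℝ (Matrix (Fin n) (Fin n) D)} (hc : IsChart (act u₀ g) P)
    (μ : Measure (unip n D ⧸ stab g)) [IsLocallyFiniteMeasure μ]
    [SMulInvariantMeasure (unip n D) (unip n D ⧸ stab g) μ] :
    ∃ κ : ℂ, ∀ Φ : Herm n D → ℂ, IsSchwartz Φ → Integrable (orbitFun ψ Φ g hg) μ ∧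
      orbitIntegral ψ Φ g hg μ = κ * OI θ (act u₀ g) P Φ := by
  obtain ⟨r, hr, hrp⟩ := hc.exists_leftInverse
  have hP := hc.isNilAlg
  let el : P → unip n D := fun p => u₀ * unipOf (hc.sut p.1 p.2)
  have hel : ∀ p, act (el p) g = hact (1 + p.1) (act u₀ g) := fun p => act_mul _ _ _
  have hel' : ∀ p, r (act (el p) g) = p := fun p => by rw [hel, hrp]
  have hact' : ∀ v : unip n D, act (el (r (act v g))) g = act v g := by
    intro v
    obtain ⟨p, hp, h⟩ := hc.surj _ (isUni_coe (u₀⁻¹ * v))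
    have h2 : act v g = act (el ⟨p, hp⟩) g := by
      rw [hel, h, ← act_eq_hact, ← act_mul, mul_inv_cancel_left]
    rw [h2, hel']
  have hcont : Continuous el := continuous_const.mul (continuous_unipOf continuous_subtype_val _)
  -- the coordinate on the coset space
  let j : unip n D ⧸ stab g → P := Quotient.lift (fun v => r (act v⁻¹ g)) (by
    intro v w hvw
    have hs : v⁻¹ * w ∈ stab g := QuotientGroup.leftRel_apply.mp hvw
    have h1 : act v⁻¹ g = act w⁻¹ g := by
      rw [show v⁻¹ = (v⁻¹ * w) * w⁻¹ by group, act_mul, show act (v⁻¹ * w) g = g from hs]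
    simp only [h1])
  have hjmk : ∀ v : unip n D, j (v : unip n D ⧸ stab g) = r (act v⁻¹ g) := fun v => rfl
  let σ : P → unip n D ⧸ stab g := fun p => ((el p)⁻¹ : unip n D)
  have hσ : Continuous σ := continuous_quotient_mk'.comp hcont.inv
  have hjσ : ∀ p, j (σ p) = p := fun p => by
    simp only [σ, hjmk, inv_inv, hel']
  have hσj : ∀ x, σ (j x) = x := by
    intro x
    induction x using QuotientGroup.induction_on with
    | _ v =>
      refine QuotientGroup.eq.2 ?_
      rw [inv_inv]
      change act _ g = g
      rw [act_mul, hjmk, hact', ← act_mul, inv_mul_cancel, act_one]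
  have hjm : Measurable j := by
    refine measurable_from_quotient.2 ?_
    refine Continuous.measurable ?_
    refine hr.1.continuous.comp ?_
    exact (htg_hact (E := Matrix (Fin n) (Fin n) D) Function.HasTemperateGrowth.id
      (htg_const g)).1.continuous.comp (Units.continuous_val.comp
        (continuous_subtype_val.comp continuous_inv))
  -- The preimage of a compact set under `j` is its image under the continuous inverse σ, hence
  -- compact.
  have hcompact : IsFiniteMeasureOnCompacts (map j μ) := by
    refine ⟨fun K hK => ?_⟩
    rw [map_apply hjm hK.measurableSet]
    have : j ⁻¹' K = σ '' K := by
      ext x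
      refine ⟨fun hx => ⟨j x, hx, hσj x⟩, ?_⟩
      rintro ⟨p, hp, rfl⟩
      rwa [Set.mem_preimage, hjσ]
    rw [this]
    exact (hK.image hσ).measure_lt_top
  have hop : ∀ q, Measurable (hP.op q) := fun q => by
    refine Continuous.measurable (Continuous.subtype_mk ?_ _)
    exact (continuous_subtype_val.add continuous_const).add
      (continuous_subtype_val.mul continuous_const)
  have hinv : ∀ q, map (hP.op q) (map j μ) = map j μ := by
    intro q
    have hq : ∀ x, hP.op q (j x) = j ((unipOf (hc.sut q.1 q.2))⁻¹ • x) := by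
      intro x
      induction x using QuotientGroup.induction_on with
      | _ v =>
        have h2 : el (hP.op q (r (act v⁻¹ g))) =
            el (r (act v⁻¹ g)) * unipOf (hc.sut q.1 q.2) := by
          simp only [el, mul_assoc]
          congr 1
          exact Subtype.ext (Units.ext (hP.one_add_op q _))
        change hP.op q (r (act v⁻¹ g)) = r (act ((unipOf (hc.sut q.1 q.2))⁻¹ * v)⁻¹ g)
        have h3 : act (v⁻¹ * unipOf (hc.sut q.1 q.2)) g =
            act (el (hP.op q (r (act v⁻¹ g)))) g := by
          rw [h2, act_mul (el _), hact', ← act_mul]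
        rw [mul_inv_rev, inv_inv, h3, hel']
    ext s hs
    rw [map_apply (hop q) hs, map_apply hjm (hop q hs), map_apply hjm hs]
    have : j ⁻¹' (hP.op q ⁻¹' s) = (fun x => (unipOf (hc.sut q.1 q.2))⁻¹ • x) ⁻¹' (j ⁻¹' s) := by
      ext x
      simp only [Set.mem_preimage, hq]
    rw [this]
    exact SMulInvariantMeasure.measure_preimage_smul _ (hjm hs)
  obtain ⟨κ, hκ⟩ := hP.exists_eq_smul_addHaar (map j μ) hinv
  -- The representative `el (j v)` differs from v⁻¹ by an element of the stabilizer, on which the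
  -- character is trivial; the base point contributes the constant phase of `u₀`.
  have hfun : ∀ Φ : Herm n D → ℂ, orbitFun ψ Φ g hg = fun x =>
      (chi ψ u₀ : ℂ) * (Φ (hact (1 + (j x).1) (act u₀ g)) * expi θ (supdiag (j x).1)) := by
    intro Φ
    funext x
    induction x using QuotientGroup.induction_on with
    | _ v =>
      have h1 : act (el (j v)) g = act v⁻¹ g := hact' _
      have h2 : chi ψ v⁻¹ = chi ψ (el (j v)) := by
        have h3 : el (j v) * v ∈ stab g := by
          change act _ g = g
          rw [act_mul, h1, ← act_mul, inv_mul_cancel, act_one]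
        have h4 := hg _ h3
        rw [chi_mul] at h4
        have h5 : chi ψ v⁻¹ * chi ψ v = 1 := by
          rw [← chi_mul, inv_mul_cancel]
          exact hg _ (one_mem _)
        exact mul_right_cancel (h5.trans h4.symm)
      change Φ (act v⁻¹ g) * (chi ψ v⁻¹ : ℂ) = _
      rw [h2, ← h1, hel, chi_mul, Circle.coe_mul, chi_unipOf hψ]
      ring
  refine ⟨chi ψ u₀ * ((κ : ℝ) : ℂ), fun Φ hΦ => ?_⟩
  have hs := (hc.isSchwartz θ hΦ).const_mul (chi ψ u₀ : ℂ)
  have hint := hs.integrable (addHaar : Measure P)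
  constructor
  · rw [hfun]
    have h1 : Integrable (fun p : P => (chi ψ u₀ : ℂ) * (Φ (hact (1 + p.1) (act u₀ g)) *
        expi θ (supdiag p.1))) (map j μ) := by
      rw [hκ]
      exact hint.smul_measure_nnreal
    exact h1.comp_measurable hjm
  · have h1 := integral_map (μ := μ) hjm.aemeasurable (f := fun p : P =>
      (chi ψ u₀ : ℂ) * (Φ (hact (1 + p.1) (act u₀ g)) * expi θ (supdiag p.1)))
      hs.continuous.aestronglyMeasurable
    rw [orbitIntegral, hfun, ← h1, hκ, integral_smul_nnreal_measure, NNReal.smul_def,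
      Complex.real_smul, integral_const_mul, OI]
    ring

/-! ### Integration over the orbit of an antidiagonal matrix -/

theorem IsWT.quad_apply_eq_zero {T : Matrix (Fin k) (Fin k) D} (hT : IsWT T) (i j : Fin k)
    (hij : (i : ℕ) + j < k) : (T + Tᴴ + Tᴴ * wmat k D * T) i j = 0 := by
  have h0 := conjTranspose_wmat_mul_congr (T := T) (T' := 0) (a := 0) hT.supp
    (fun _ _ _ => rfl) (fun i j h => hT.supp i j (by omega)) i j (by omega)
  rw [Matrix.mul_zero, Matrix.zero_apply] at h0
  rw [Matrix.add_apply, h0, Matrix.add_apply, Matrix.conjTranspose_apply, hT.supp i j hij,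
    hT.supp j i (by omega)]
  simp

/-- The affine coordinates on the orbit of an antidiagonal matrix. -/
noncomputable def wHomeo : LW k D ≃ₜ PW k D where
  toFun A := ⟨wmat k D * wsol A.1.1 k, (exists_mem_PW A.2 (conjT A.1) 1).1⟩
  invFun p := ⟨⟨wmat k D * p.1 + (wmat k D * p.1)ᴴ +
      (wmat k D * p.1)ᴴ * wmat k D * (wmat k D * p.1), by
    change Matrix.conjTranspose _ = _
    simp only [Matrix.conjTranspose_add, Matrix.conjTranspose_mul, Matrix.conjTranspose_conjTranspose,
      wmat_conjTranspose, Matrix.mul_assoc]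
    abel⟩, p.2.2.quad_apply_eq_zero⟩
  left_inv A := by
    obtain ⟨h1, h2⟩ := isWT_wsol A.2 (conjT A.1)
    refine Subtype.ext (Subtype.ext ?_)
    change wmat k D * (wmat k D * wsol A.1.1 k) + _ + _ = A.1.1
    rw [← Matrix.mul_assoc, wmat_mul_wmat, Matrix.one_mul, h2]
  right_inv p := Subtype.ext (by
    change wmat k D * wsol _ k = p.1
    rw [p.2.2.wsol_eq_self, ← Matrix.mul_assoc, wmat_mul_wmat, Matrix.one_mul])
  continuous_toFun := by
    refine Continuous.subtype_mk ?_ _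
    exact (htg_mul (htg_const _) (htg_wsol (htg_coe
      (LinearMap.hasTemperateGrowth (E := LW k D) (F := Herm k D) (LW k D).subtype)) k)).1.continuous
  continuous_invFun := by
    refine Continuous.subtype_mk (Continuous.subtype_mk ?_ _) _
    have h : (fun p : PW k D => wmat k D * p.1).HasTemperateGrowth :=
      htg_mul (htg_const _) (LinearMap.hasTemperateGrowth (PW k D).subtype)
    exact ((h.add (htg_conjTranspose h)).add
      (htg_mul (htg_mul (htg_conjTranspose h) (htg_const _)) h)).1.continuous

theorem hact_wHomeo (A : LW k D) (b : ℝ) :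
    hact (1 + (wHomeo A).1) (wH k D b) = wH k D b + b • A.1 :=
  Subtype.ext (by
    rw [wHomeo]
    refine (exists_mem_PW A.2 (conjT A.1) b).2.trans ?_
    rw [smul_add]
    rfl)

/-- The operator is x ↦ (1 + q)ᴴ x (1 + q) minus the identity, a sum of commuting nilpotent
operators. -/
theorem isNilpotent_hact_sub_one {q : Matrix (Fin k) (Fin k) D} (hq : IsSUT q) :
    IsNilpotent (LinearMap.mulLeft ℝ qᴴ + LinearMap.mulRight ℝ q +
      LinearMap.mulLeft ℝ qᴴ * LinearMap.mulRight ℝ q : Module.End ℝ (Matrix (Fin k) (Fin k) D)) := by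
  have h1 : IsNilpotent (LinearMap.mulLeft ℝ qᴴ) := by
    rw [LinearMap.isNilpotent_mulLeft_iff]
    obtain ⟨a, ha⟩ := hq.isNilpotent
    exact ⟨a, by rw [← Matrix.conjTranspose_pow, ha, Matrix.conjTranspose_zero]⟩
  have h2 : IsNilpotent (LinearMap.mulRight ℝ q) := by
    rw [LinearMap.isNilpotent_mulRight_iff]
    exact hq.isNilpotent
  have hcomm := LinearMap.commute_mulLeft_right (R := ℝ) qᴴ q
  refine Commute.isNilpotent_add ?_ (hcomm.isNilpotent_add h1 h2) (hcomm.isNilpotent_mul_right h1)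
  exact Commute.add_left ((Commute.refl _).mul_right hcomm) (hcomm.symm.mul_right (Commute.refl _))

/-- In the coordinate of `wHomeo` the group 1 + `PW` acts on `LW` by affine unipotent maps, so
Lebesgue measure on `LW` is invariant and corresponds to that of `PW` up to a constant. The final
substitution A ↦ b A changes the linear phase from `JW 1` to `JW b⁻¹`. -/
theorem exists_OI_wH [IsQuadratic D] [Nontrivial D] (θ : ℝ) {b : ℝ} (hb : b ≠ 0) :
    ∃ c : ℂ, c ≠ 0 ∧ ∀ f : Herm k D → ℂ, OI θ (wH k D b) (PW k D) f =
      c * ∫ A : LW k D, f (wH k D b + A.1) * expi θ (hform A.1 (JW k D b⁻¹)) ∂addHaar := by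
  have hP : IsNilAlg (PW k D) := (IsChart.wH (b := 1) one_ne_zero).isNilAlg
  let J : LW k D ≃ₜ PW k D := wHomeo
  have hfin : IsFiniteMeasureOnCompacts (map J (addHaar : Measure (LW k D))) :=
    IsFiniteMeasureOnCompacts.map _ J
  have hinv : ∀ q, map (hP.op q) (map J addHaar) = map J addHaar := by
    intro q
    have h1 : ∀ A, (J.symm (hP.op q (J A))).1 = hact (1 + q.1) (wH k D 1) - wH k D 1 +
        hact (1 + q.1) A.1 := by
      intro A
      have h2 := hact_wHomeo (J.symm (hP.op q (J A))) 1
      rw [show wHomeo (J.symm (hP.op q (J A))) = hP.op q (J A) from J.apply_symm_apply _,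
        hP.one_add_op, hact_mul, show (J A).1 = (wHomeo A).1 from rfl, hact_wHomeo, map_add,
        one_smul, one_smul] at h2
      rw [eq_sub_of_add_eq' h2.symm]
      abel
    have h3 : MeasurePreserving (fun A => J.symm (hP.op q (J A))) addHaar addHaar := by
      refine measurePreserving_of_isNilpotent ((Herm k D).subtype ∘ₗ (LW k D).subtype)
        (Subtype.val_injective.comp Subtype.val_injective) (c := J.symm q)
        (fun A => ?_) (isNilpotent_hact_sub_one (hP.sut _ q.2)) addHaar
      have h4 : (J.symm q).1 = hact (1 + q.1) (wH k D 1) - wH k D 1 := by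
        have h2 := hact_wHomeo (J.symm q) 1
        rw [show wHomeo (J.symm q) = q from J.apply_symm_apply _, one_smul] at h2
        rw [eq_sub_of_add_eq' h2.symm]
      simp only [LinearMap.comp_apply, Submodule.subtype_apply]
      rw [h1, h4]
      simp only [Submodule.coe_add, hact_coe, LinearMap.add_apply, Module.End.mul_apply,
        LinearMap.mulLeft_apply, LinearMap.mulRight_apply, Matrix.conjTranspose_add,
        Matrix.conjTranspose_one]
      noncomm_ring
    have hop : Measurable (hP.op q) := by
      refine Continuous.measurable (Continuous.subtype_mk ?_ _)
      exact (continuous_subtype_val.add continuous_const).add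
        (continuous_subtype_val.mul continuous_const)
    conv_rhs => rw [← h3.map_eq, map_map J.measurable h3.measurable]
    rw [map_map hop J.measurable]
    congr 1
    funext A
    simp
  obtain ⟨κ, hκ⟩ := hP.exists_eq_smul_addHaar _ hinv
  have hκ0 : κ ≠ 0 := by
    rintro rfl
    rw [zero_smul, Measure.map_eq_zero_iff J.measurable.aemeasurable] at hκ
    exact NeZero.ne _ hκ
  obtain ⟨c, hc, hint⟩ := exists_integral_comp_linearEquiv (E := LW k D) (F := LW k D)
    (LinearEquiv.smulOfNeZero ℝ (LW k D) b hb)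
  refine ⟨((κ : ℝ) : ℂ)⁻¹ * c, mul_ne_zero (inv_ne_zero (by exact_mod_cast hκ0)) hc, fun f => ?_⟩
  rw [mul_assoc, ← hint, eq_inv_mul_iff_mul_eq₀ (by exact_mod_cast hκ0), OI, ← Complex.real_smul,
    ← NNReal.smul_def, ← integral_smul_nnreal_measure, ← hκ, J.measurableEmbedding.integral_map]
  congr 1
  funext A
  rw [show (J A).1 = (wHomeo A).1 from rfl, hact_wHomeo, supdiag_of_mem_PW (wHomeo A).2 A.1]
  · congr 2
    rw [LinearEquiv.smulOfNeZero_apply, Submodule.coe_smul, map_smul, LinearMap.smul_apply,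
      hform_JW, hform_JW, smul_eq_mul]
    field_simp
  · exact congrArg (fun x : LW k D => x.1.1) (wHomeo.symm_apply_apply A).symm

end Orbits

theorem exists_integral_subsingleton (E : Type*) [NormedAddCommGroup E] [NormedSpace ℝ E]
    [FiniteDimensional ℝ E] [MeasurableSpace E] [BorelSpace E] [Subsingleton E] :
    ∃ c : ℂ, c ≠ 0 ∧ ∀ f : E → ℂ, ∫ x, f x ∂(addHaar : Measure E) = c * f 0 := by
  have h1 : (addHaar : Measure E) Set.univ ≠ ⊤ := (Set.finite_univ.isCompact.measure_lt_top).ne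
  have h2 : (addHaar : Measure E) Set.univ ≠ 0 := by
    rw [Ne, measure_univ_eq_zero]; exact NeZero.ne _
  refine ⟨(((addHaar : Measure E).real Set.univ : ℝ) : ℂ), ?_, fun f => ?_⟩
  · rw [measureReal_def]
    exact_mod_cast (ENNReal.toReal_pos h2 h1).ne'
  · have : f = fun _ => f 0 := funext fun x => by rw [Subsingleton.elim x 0]
    rw [this, integral_const, Complex.real_smul]

theorem IsSchwartz.integral_addHaar {E F : Type*} [NormedAddCommGroup E] [NormedSpace ℝ E]
    [NormedAddCommGroup F] [NormedSpace ℝ F] [FiniteDimensional ℝ F] [MeasurableSpace F]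
    [BorelSpace F] {f : E × F → ℂ} (hf : IsSchwartz f) :
    IsSchwartz fun x => ∫ y, f (x, y) ∂(addHaar : Measure F) :=
  hf.integral_right _

theorem IsSchwartz.integrable_addHaar {F : Type*} [NormedAddCommGroup F] [NormedSpace ℝ F]
    [FiniteDimensional ℝ F] [MeasurableSpace F] [BorelSpace F] {f : F → ℂ} (hf : IsSchwartz f) :
    Integrable f (addHaar : Measure F) :=
  hf.integrable _

section Blocks

variable {k l m n : ℕ} {D : Type*} [NormedCommRing D] [NormedAlgebra ℝ D] [StarRing D]
  [StarModule ℝ D] [FiniteDimensional ℝ D] [IsQuadratic D] [Nontrivial D]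

/-! ### Integration over the orbit of the upper left block -/

variable (h : k + l = n) (g₁ : Herm k D) (P₁ : Submodule ℝ (Matrix (Fin k) (Fin k) D))

/-- The phase on the coordinates of the upper left block. -/
noncomputable def blockPhase (k l : ℕ) {D : Type*} [NormedCommRing D] [NormedAlgebra ℝ D]
    [StarRing D] [StarModule ℝ D] [FiniteDimensional ℝ D] [IsQuadratic D] [Nontrivial D]
    (P₁ : Submodule ℝ (Matrix (Fin k) (Fin k) D)) :
    (P₁ × Matrix (Fin k) (Fin l) D) →ₗ[ℝ] ℝ :=
  (supdiag ∘ₗ P₁.subtype).coprod (mform (corner k l D))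

theorem blockPhase_apply (z : P₁ × Matrix (Fin k) (Fin l) D) :
    blockPhase k l P₁ z = supdiag z.1.1 + mform (corner k l D) z.2 := rfl

/-- The integral of a function over the part of the orbit that belongs to the upper left block. -/
noncomputable def MS (θ : ℝ) (Φ : Herm n D → ℂ) (s : Herm l D) : ℂ :=
  ∫ z : P₁ × Matrix (Fin k) (Fin l) D,
    Φ (blockMap h g₁ P₁ (s, z)) * expi θ (blockPhase k l P₁ z) ∂addHaar

variable {h g₁ P₁} {g' : Matrix (Fin k) (Fin k) D}

theorem isSchwartz_blockMap (hc : IsChart g₁ P₁) (hg : g' * g₁.1 = 1) (θ : ℝ) {Φ : Herm n D → ℂ}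
    (hΦ : IsSchwartz Φ) : IsSchwartz fun w : Herm l D × P₁ × Matrix (Fin k) (Fin l) D =>
      Φ (blockMap h g₁ P₁ w) * expi θ (blockPhase k l P₁ w.2) := by
  obtain ⟨r, hr, hrz⟩ := exists_leftInverse_blockMap h hc hg
  exact (hΦ.comp_leftInverse (hasTemperateGrowth_blockMap h g₁ P₁) hr hrz).mul_temperate
    (hasTemperateGrowth_expi_comp θ (hasTemperateGrowth_linear (blockPhase k l P₁)
      (LinearMap.hasTemperateGrowth (E := Herm l D × P₁ × Matrix (Fin k) (Fin l) D)
        (F := P₁ × Matrix (Fin k) (Fin l) D) (LinearMap.snd ℝ _ _))))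

theorem IsSchwartz.MS (hc : IsChart g₁ P₁) (hg : g' * g₁.1 = 1) (θ : ℝ) {Φ : Herm n D → ℂ}
    (hΦ : IsSchwartz Φ) : IsSchwartz (MS h g₁ P₁ θ Φ) :=
  (isSchwartz_blockMap hc hg θ hΦ).integral_addHaar

/-- Fubini in the coordinates of `pblkE`: with the `P₂` variable fixed, the integral over the
remaining ones is `MS` at a point of the orbit of g₂. -/
theorem exists_OI_block (hc : IsChart g₁ P₁) (hg : g' * g₁.1 = 1) {g₂ : Herm l D}
    {P₂ : Submodule ℝ (Matrix (Fin l) (Fin l) D)} (hc₂ : IsChart g₂ P₂) (θ : ℝ) :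
    ∃ c : ℂ, c ≠ 0 ∧ ∀ Φ : Herm n D → ℂ, IsSchwartz Φ →
      OI θ (hblk h g₁ 0 g₂) (pblk h P₁ P₂) Φ = c * OI θ g₂ P₂ (Kloosterman.MS h g₁ P₁ θ Φ) := by
  obtain ⟨c₁, hc1, h1⟩ := exists_integral_comp_linearEquiv
    (E := P₂ × P₁ × Matrix (Fin k) (Fin l) D) (F := pblk h P₁ P₂) (pblkE h P₁ P₂)
  obtain ⟨c₂, hc2, h2⟩ := exists_integral_prod (E := P₂) (F := P₁ × Matrix (Fin k) (Fin l) D)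
  refine ⟨c₁⁻¹ * c₂, mul_ne_zero (inv_ne_zero hc1) hc2, fun Φ hΦ => ?_⟩
  have hs := ((hc.block h hc₂ hg).isSchwartz θ hΦ).comp_linearEquiv
    (E := P₂ × P₁ × Matrix (Fin k) (Fin l) D) (F := pblk h P₁ P₂) (pblkE h P₁ P₂)
  rw [OI, mul_assoc, eq_inv_mul_iff_mul_eq₀ hc1, ← h1, h2 _ hs.integrable_addHaar, OI]
  congr 2
  funext p₂
  rw [Kloosterman.MS, ← integral_mul_const]
  congr 1
  funext z
  rw [pblkE_coe, hact_mblk_eq_blockMap, supdiag_mblk, blockPhase_apply, expi_add, mul_assoc]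

/-- The translation of the last block by -`hact v g₁` removes the dependence of the argument of Φ on
that term and produces a phase quadratic in `v`. This is one side of the Weil formula. -/
theorem exists_ft_MS (hc : IsChart g₁ P₁) (hg : g' * g₁.1 = 1) :
    ∃ κ : ℂ, κ ≠ 0 ∧ ∀ (θ : ℝ) (Φ : Herm n D → ℂ), IsSchwartz Φ → ∀ t : Herm l D,
      ft θ hform (MS h g₁ P₁ θ Φ) t = κ * ∫ p : P₁, (∫ v : Matrix (Fin k) (Fin l) D,
        (∫ c : Herm l D, Φ (hblk h (hact (1 + p.1) g₁) ((1 + p.1)ᴴ * g₁.1 * v) c) *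
          expi θ (hform c t) ∂addHaar) *
        expi θ (mform (corner k l D) v - hform (hact v g₁) t) ∂addHaar) *
        expi θ (supdiag p.1) ∂addHaar := by
  obtain ⟨κ, hκ, hint⟩ := exists_integral_prod (E := P₁) (F := Matrix (Fin k) (Fin l) D)
  refine ⟨κ, hκ, fun θ Φ hΦ t => ?_⟩
  have hs : IsSchwartz fun w : Herm l D × P₁ × Matrix (Fin k) (Fin l) D =>
      Φ (blockMap h g₁ P₁ w) * expi θ (blockPhase k l P₁ w.2) * expi θ (hform w.1 t) :=
    (isSchwartz_blockMap hc hg θ hΦ).mul_temperate (hasTemperateGrowth_expi_comp θ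
      (hasTemperateGrowth_linear (hform.flip t)
        (LinearMap.hasTemperateGrowth (E := Herm l D × P₁ × Matrix (Fin k) (Fin l) D)
          (F := Herm l D) (LinearMap.fst ℝ _ _))))
  have hs2 := (hs.comp_linearEquiv (E := (P₁ × Matrix (Fin k) (Fin l) D) × Herm l D)
    (LinearEquiv.prodComm ℝ _ _)).integral_addHaar
  rw [ft]
  simp only [MS, ← integral_mul_const]
  rw [hs.integral_swap]
  refine (hint _ hs2.integrable_addHaar).trans ?_
  congr 2
  funext p
  congr 1
  funext v
  have h1 : ∀ c : Herm l D, Φ (blockMap h g₁ P₁ (c, p, v)) * expi θ (blockPhase k l P₁ (p, v)) *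
      expi θ (hform c t) = (fun c => Φ (hblk h (hact (1 + p.1) g₁) ((1 + p.1)ᴴ * g₁.1 * v) c) *
          expi θ (hform c t) * expi θ (mform (corner k l D) v - hform (hact v g₁) t) *
          expi θ (supdiag p.1)) (hact v g₁ + c) := by
    intro c
    simp only [blockMap, blockPhase_apply, map_add, LinearMap.add_apply]
    simp only [mul_assoc, ← expi_add]
    congr 2
    ring
  refine (integral_congr_ae (.of_forall h1)).trans ?_
  exact integral_add_left_eq_self (μ := (addHaar : Measure (Herm l D))) (fun c =>
    Φ (hblk h (hact (1 + p.1) g₁) ((1 + p.1)ᴴ * g₁.1 * v) c) * expi θ (hform c t) *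
      expi θ (mform (corner k l D) v - hform (hact v g₁) t) * expi θ (supdiag p.1)) (hact v g₁)

/-! ### Diagonal matrices -/

theorem diagA_block (h : k + l = n) (a : Fin n → ℝˣ) :
    diagA (D := D) a = hblk h (diagA fun i => a (iL h i)) 0 (diagA fun i => a (iR h i)) := by
  apply Subtype.ext
  apply matrix_ext_block h <;> intro i j
  · have : iL h i = iL h j ↔ i = j := by simp only [iL, Fin.ext_iff]
    simp only [diagA, hblk_coe, mblk_LL, Matrix.diagonal_apply, this]
  · simp only [diagA, hblk_coe, mblk_LR, Matrix.diagonal_apply, Matrix.zero_apply]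
    rw [if_neg]
    simp only [iL, iR, Fin.ext_iff]; omega
  · simp only [diagA, hblk_coe, mblk_RL, Matrix.diagonal_apply, Matrix.conjTranspose_zero,
      Matrix.zero_apply]
    rw [if_neg]
    simp only [iL, iR, Fin.ext_iff]; omega
  · have : iR h i = iR h j ↔ i = j := by simp only [iR, Fin.ext_iff, Nat.add_left_cancel_iff]
    simp only [diagA, hblk_coe, mblk_RR, Matrix.diagonal_apply, this]

theorem hblk_diagA (h : k + l = n) (a : Fin k → ℝˣ) (a' : Fin l → ℝˣ) :
    hblk h (diagA (D := D) a) 0 (diagA a') = diagA fun i => Sum.elim a a' ((eB h).symm i) := by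
  rw [diagA_block h]
  simp

theorem diagA_one (a : Fin 1 → ℝˣ) : diagA (D := D) a = hreal (a 0 : ℝ) := by
  apply Subtype.ext
  ext i j
  rw [Subsingleton.elim i 0, Subsingleton.elim j 0, hreal_coe]
  simp [diagA, Algebra.algebraMap_eq_smul_one]

theorem pblk_sutP (h : k + l = n) : pblk h (sutP k D) (sutP l D) = sutP n D := by
  ext p
  constructor
  · intro hp
    obtain ⟨p₁, h1, v, p₂, h2, rfl⟩ := mem_pblk.1 hp
    exact IsSUT.mblk h1 h2 v
  · intro hp
    refine ⟨fun i j hij => hp _ _ hij, fun i j hij => hp _ _ ?_, ?_⟩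
    · rw [Fin.le_def] at hij ⊢; simp only [iR]; omega
    · ext i j
      refine hp _ _ ?_
      rw [Fin.le_def]; simp only [iR, iL]; omega

theorem sutP_eq_bot (hn : n ≤ 1) : sutP n D = ⊥ := by
  refine (Submodule.eq_bot_iff _).2 fun p hp => ?_
  ext i j
  exact hp i j (by rw [Fin.le_def]; omega)

theorem diagA_inv (a : Fin n → ℝˣ) : (diagA (D := D) a⁻¹).1 * (diagA (D := D) a).1 = 1 := by
  change Matrix.diagonal _ * Matrix.diagonal _ = _
  rw [Matrix.diagonal_mul_diagonal, ← Matrix.diagonal_one]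
  congr 1
  funext i
  rw [← map_mul]
  simp

theorem IsChart.diagA (a : Fin n → ℝˣ) : IsChart (diagA (D := D) a) (sutP n D) := by
  induction n with
  | zero =>
    rw [sutP_eq_bot (by omega)]
    exact IsChart.trivial _ (by omega)
  | succ n ih =>
    rw [diagA_block rfl, ← pblk_sutP rfl]
    refine IsChart.block rfl (ih _) ?_ (diagA_inv _)
    rw [sutP_eq_bot le_rfl]
    exact IsChart.trivial _ le_rfl

theorem exists_OI_bot (θ : ℝ) (g : Herm n D) :
    ∃ c : ℂ, c ≠ 0 ∧ ∀ Φ : Herm n D → ℂ, OI θ g ⊥ Φ = c * Φ g := by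
  obtain ⟨c, hc, h⟩ := exists_integral_subsingleton
    (⊥ : Submodule ℝ (Matrix (Fin n) (Fin n) D))
  refine ⟨c, hc, fun Φ => ?_⟩
  rw [OI, h]
  simp

/-- A Schwartz function on hermitian matrices of size one that vanishes at invertible matrices
vanishes. -/
theorem IsSchwartz.eq_zero_of_hreal {f : Herm 1 D → ℂ} (hf : IsSchwartz f)
    (h : ∀ t : ℝ, t ≠ 0 → f (hreal t) = 0) (s : Herm 1 D) : f s = 0 := by
  obtain ⟨t, rfl⟩ := exists_hreal s
  have hc : Continuous fun t : ℝ => f (hreal t) :=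
    hf.continuous.comp (LinearMap.continuous_of_finiteDimensional (E := ℝ) (F' := Herm 1 D) hreal)
  have h1 : (fun t : ℝ => f (hreal t)) = fun _ => 0 :=
    Continuous.ext_on (dense_compl_singleton (0 : ℝ)) hc continuous_const fun t ht => h t ht
  exact congrFun h1 t

/-- The vanishing of the regular orbital integrals implies the vanishing of the orbital integral
of `g`. -/
def IsLimit (θ : ℝ) (g : Herm n D) (P : Submodule ℝ (Matrix (Fin n) (Fin n) D)) : Prop :=
  ∀ Φ : Herm n D → ℂ, IsSchwartz Φ →
    (∀ a : Fin n → ℝˣ, OI θ (Kloosterman.diagA a) (sutP n D) Φ = 0) → OI θ g P Φ = 0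

/-- The reduction of diagonal matrices to smaller size. -/
theorem MS_diagA_eq_zero {n' : ℕ} (h : n' + 1 = n) {θ : ℝ} {Φ : Herm n D → ℂ} (hΦ : IsSchwartz Φ)
    (hreg : ∀ a : Fin n → ℝˣ, OI θ (Kloosterman.diagA a) (sutP n D) Φ = 0) (a : Fin n' → ℝˣ)
    (s : Herm 1 D) : Kloosterman.MS h (Kloosterman.diagA a) (sutP n' D) θ Φ s = 0 := by
  -- Appending t ≠ 0 to `a` gives a regular matrix of size n; the value at 0 follows by continuity.
  refine (IsSchwartz.MS (IsChart.diagA a) (diagA_inv a) θ hΦ).eq_zero_of_hreal (fun t ht => ?_) s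
  obtain ⟨c, hc, h1⟩ := exists_OI_block (h := h) (IsChart.diagA a) (diagA_inv a)
    (IsChart.diagA (D := D) (fun _ => Units.mk0 t ht)) θ
  have h2 := h1 Φ hΦ
  rw [hblk_diagA, pblk_sutP, hreg] at h2
  have h3 := (mul_eq_zero.1 h2.symm).resolve_left hc
  rw [sutP_eq_bot le_rfl, diagA_one, Units.val_mk0] at h3
  obtain ⟨c', hc', h4⟩ := exists_OI_bot θ (hreal (D := D) t)
  rw [h4] at h3
  exact (mul_eq_zero.1 h3).resolve_left hc'

end Blocks

section Shortcuts

variable (k l : ℕ) (D : Type*) [NormedCommRing D] [NormedAlgebra ℝ D] [StarRing D]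
  [StarModule ℝ D]

/-- The norm on hermitian matrices, found without search. -/
noncomputable abbrev hermNormedAddCommGroup : NormedAddCommGroup (Herm k D) :=
  Submodule.normedAddCommGroup _

/-- The norm on matrices, found without search. -/
noncomputable abbrev matNormedAddCommGroup :
    NormedAddCommGroup (Matrix (Fin k) (Fin l) D) := Matrix.normedAddCommGroup

end Shortcuts
attribute [local instance] hermNormedAddCommGroup matNormedAddCommGroup

/-! ### Fourier transforms in product coordinates -/

section Abstract

variable {E F H : Type*} [NormedAddCommGroup E] [NormedSpace ℝ E] [FiniteDimensional ℝ E]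
  [MeasurableSpace E] [BorelSpace E] [NormedAddCommGroup F] [NormedSpace ℝ F]
  [FiniteDimensional ℝ F] [MeasurableSpace F] [BorelSpace F] [NormedAddCommGroup H]
  [NormedSpace ℝ H] [FiniteDimensional ℝ H] [MeasurableSpace H] [BorelSpace H]

theorem exists_integral_prod_equiv (e : (E × F) ≃ₗ[ℝ] H) : ∃ c : ℂ, c ≠ 0 ∧
    ∀ Φ : H → ℂ, IsSchwartz Φ → ∫ x, Φ x ∂addHaar =
      c * ∫ s : E, ∫ z : F, Φ (e (s, z)) ∂addHaar ∂addHaar := by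
  obtain ⟨c₁, hc1, h1⟩ := exists_integral_comp_linearEquiv e
  obtain ⟨c₂, hc2, h2⟩ := exists_integral_prod (E := E) (F := F)
  refine ⟨c₁⁻¹ * c₂, mul_ne_zero (inv_ne_zero hc1) hc2, fun Φ hΦ => ?_⟩
  rw [mul_assoc, eq_inv_mul_iff_mul_eq₀ hc1, ← h1,
    h2 _ (hΦ.comp_linearEquiv e).integrable_addHaar]

theorem IsSchwartz.mul_expi {f : E → ℂ} (hf : IsSchwartz f) (θ : ℝ) (q : E →ₗ[ℝ] ℝ) :
    IsSchwartz fun x => f x * expi θ (q x) :=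
  hf.mul_temperate (hasTemperateGrowth_expi_comp θ (LinearMap.hasTemperateGrowth q))

/-- The Fourier transform in block coordinates. -/
theorem exists_ft_equiv (e : (E × F) ≃ₗ[ℝ] H) : ∃ c : ℂ, c ≠ 0 ∧
    ∀ (θ : ℝ) (Φ : H → ℂ), IsSchwartz Φ → ∀ (b : H →ₗ[ℝ] H →ₗ[ℝ] ℝ) (b₁ : E →ₗ[ℝ] E →ₗ[ℝ] ℝ)
      (q : F →ₗ[ℝ] ℝ) (w : H) (σ : E), (∀ s z, b (e (s, z)) w = b₁ s σ + q z) →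
      ft θ b Φ w = c * ft θ b₁ (fun s => ∫ z, Φ (e (s, z)) * expi θ (q z) ∂addHaar) σ := by
  obtain ⟨c, hc, h⟩ := exists_integral_prod_equiv e
  refine ⟨c, hc, fun θ Φ hΦ b b₁ q w σ hb => ?_⟩
  rw [ft]
  refine (h _ (hΦ.mul_expi θ (b.flip w))).trans ?_
  rw [ft]
  congr 2
  funext s
  rw [← integral_mul_const]
  congr 1
  funext z
  rw [LinearMap.flip_apply, hb, mul_assoc, ← expi_add, add_comm]

/-- The Fourier transform of a partially shifted function. -/
theorem ft_integral_shift {θ : ℝ} (b : E →ₗ[ℝ] E →ₗ[ℝ] ℝ) (f : E → F → ℂ) (a : F → E)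
    (q : F → ℝ) (hf : IsSchwartz fun z : E × F => f (a z.2 + z.1) z.2 * expi θ (q z.2)) (s : E) :
    ft (-θ) b (fun σ => ∫ η, f (a η + σ) η * expi θ (q η) ∂addHaar) s =
      ∫ η, (∫ σ, f σ η * expi θ (-b σ s) ∂addHaar) * expi θ (q η + b (a η) s) ∂addHaar := by
  have hs : IsSchwartz fun z : E × F => f (a z.2 + z.1) z.2 * expi θ (q z.2) *
      expi (-θ) (b z.1 s) := hf.mul_expi (-θ) (b.flip s ∘ₗ LinearMap.fst ℝ E F)
  rw [ft]
  simp only [← integral_mul_const]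
  refine hs.integral_swap.trans ?_
  congr 1
  funext η
  have h6 : ∀ σ : E, f (a η + σ) η * expi θ (q η) * expi (-θ) (b σ s) =
      (fun σ => f σ η * expi θ (-b σ s) * expi θ (q η + b (a η) s)) (a η + σ) := by
    intro σ
    simp only [map_add, LinearMap.add_apply]
    rw [mul_assoc, mul_assoc, expi_neg_left, ← expi_add, ← expi_add]
    congr 2
    ring
  exact (integral_congr_ae (.of_forall h6)).trans (integral_add_left_eq_self
    (μ := (addHaar : Measure E))
    (fun σ => f σ η * expi θ (-b σ s) * expi θ (q η + b (a η) s)) (a η))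

theorem IsSchwartz.slice {f : E × F → ℂ} (hf : IsSchwartz f) (s : E) :
    IsSchwartz fun z => f (s, z) := by
  have h4 := hf.comp_linearMap (LinearMap.inr ℝ E F) LinearMap.inr_injective (s, 0)
  simpa using h4

theorem IsSchwartz.integral_mul_expi {f : E × F → ℂ} (hf : IsSchwartz f) (θ : ℝ)
    (q : F →ₗ[ℝ] ℝ) : IsSchwartz fun x => ∫ y, f (x, y) * expi θ (q y) ∂addHaar :=
  (hf.mul_expi θ (q ∘ₗ LinearMap.snd ℝ E F)).integral_addHaar

theorem exists_integral_mul_expi_prod : ∃ c : ℂ, c ≠ 0 ∧ ∀ f : E × F → ℂ, IsSchwartz f →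
    ∀ (θ : ℝ) (b : E →ₗ[ℝ] E →ₗ[ℝ] ℝ) (r : F →ₗ[ℝ] ℝ) (η : E),
    ∫ z, f z * expi θ ((b.flip η).coprod r z) ∂addHaar =
      c * ft θ b (fun y => ∫ x, f (y, x) * expi θ (r x) ∂addHaar) η := by
  obtain ⟨c, hc, h⟩ := exists_integral_prod (E := E) (F := F)
  refine ⟨c, hc, fun f hf θ b r η => ?_⟩
  rw [h _ (hf.mul_expi θ _).integrable_addHaar, ft]
  congr 2
  funext y
  rw [← integral_mul_const]
  congr 1
  funext x
  rw [mul_assoc, ← expi_add, add_comm (r x)]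
  rfl

end Abstract

theorem integral_comp_of_isNilpotent_sub_one {E : Type*} [NormedAddCommGroup E] [NormedSpace ℝ E]
    [FiniteDimensional ℝ E] [MeasurableSpace E] [BorelSpace E] (T : E →ₗ[ℝ] E)
    (hT : IsNilpotent (T - 1)) (f : E → ℂ) :
    ∫ x, f (T x) ∂(addHaar : Measure E) = ∫ x, f x ∂(addHaar : Measure E) := by
  have hu : IsUnit T := by simpa using hT.isUnit_one_add
  have hinj : Function.Injective T := ((Module.End.isUnit_iff T).1 hu).1
  exact (measurePreserving_of_isNilpotent_sub_one T hT addHaar).integral_comp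
    (LinearMap.isClosedEmbedding_of_injective (LinearMap.ker_eq_bot.2 hinj)).measurableEmbedding f

/-! ### Reduction of the size by one through the Weil formula -/

section Reduction

variable {m n : ℕ} {D : Type*} [NormedCommRing D] [NormedAlgebra ℝ D] [StarRing D]
  [StarModule ℝ D] [FiniteDimensional ℝ D] [IsQuadratic D] [Nontrivial D]

/-- Left multiplication on rectangular matrices. -/
noncomputable def mulL (l : ℕ) (q : Matrix (Fin m) (Fin m) D) :
    Matrix (Fin m) (Fin l) D →ₗ[ℝ] Matrix (Fin m) (Fin l) D where
  toFun y := q * y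
  map_add' y z := Matrix.mul_add _ _ _
  map_smul' r y := by simp

theorem mulL_apply {l : ℕ} (q : Matrix (Fin m) (Fin m) D) (y : Matrix (Fin m) (Fin l) D) :
    mulL l q y = q * y := rfl

theorem integral_mul_left_unipotent {l : ℕ} {q : Matrix (Fin m) (Fin m) D} (hq : IsNilpotent q)
    (f : Matrix (Fin m) (Fin l) D → ℂ) :
    ∫ y : Matrix (Fin m) (Fin l) D, f ((1 + q) * y) ∂addHaar =
      ∫ y : Matrix (Fin m) (Fin l) D, f y ∂addHaar := by
  refine integral_comp_of_isNilpotent_sub_one (E := Matrix (Fin m) (Fin l) D) (mulL l (1 + q)) ?_ f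
  have h1 : (mulL l (1 + q) - 1 : Module.End ℝ (Matrix (Fin m) (Fin l) D)) = mulL l q := by
    refine LinearMap.ext fun y => ?_
    simp only [LinearMap.sub_apply, mulL_apply, Module.End.one_apply, Matrix.add_mul,
      Matrix.one_mul, add_sub_cancel_left]
  obtain ⟨a, ha⟩ := hq
  have h2 : ∀ (i : ℕ) (y : Matrix (Fin m) (Fin l) D), ((mulL l q) ^ i) y = q ^ i * y := by
    intro i
    induction i with
    | zero => intro y; simp
    | succ i ih => intro y; rw [pow_succ, pow_succ, Module.End.mul_apply, ih, mulL_apply,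
        Matrix.mul_assoc]
  change IsNilpotent (mulL l (1 + q) - 1 : Module.End ℝ (Matrix (Fin m) (Fin l) D))
  rw [h1]
  exact ⟨a, LinearMap.ext fun y => by rw [h2, ha, Matrix.zero_mul]; rfl⟩

theorem mform_mul_left {l : ℕ} (q : Matrix (Fin m) (Fin m) D) (y z : Matrix (Fin m) (Fin l) D) :
    mform y (q * z) = mform (qᴴ * y) z := by
  rw [mform_apply, mform_apply, Matrix.conjTranspose_mul, Matrix.conjTranspose_conjTranspose,
    Matrix.mul_assoc]

/-- The corner vector lives in the last row, which is fixed by lower unipotent matrices. Hence the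
linear term of the phase is unaffected by unipotent substitutions. -/
theorem IsUni.conjTranspose_mul_corner {l : ℕ} {u : Matrix (Fin m) (Fin m) D} (hu : IsUni u) :
    uᴴ * corner m l D = corner m l D := by
  ext i j
  rw [Matrix.mul_apply, Finset.sum_eq_single i]
  · rw [Matrix.conjTranspose_apply, hu.2, star_one, one_mul]
  · intro r _ hr
    rw [Matrix.conjTranspose_apply, corner]
    split_ifs with h
    · rw [hu.1 r i, star_zero, zero_mul]
      rw [Fin.lt_def]
      rw [Ne, Fin.ext_iff] at hr
      omega
    · rw [mul_zero]
  · simp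

/-- The Weil formula is applied once, with multiplication by `g` as the operator. Every other point
of the orbit is reached by the substitutions η ↦ (1 + p) η and y ↦ (1 + p)ᴴ y, which have Jacobian 1
and fix the corner, so γ does not depend on `p`. -/
theorem exists_gaussian_orbit {θ : ℝ} (hθ : θ ≠ 0) {t : ℝ} (ht : t ≠ 0) (g : Herm m D)
    {g' : Matrix (Fin m) (Fin m) D} (hg : g' * g.1 = 1) :
    ∃ γ : ℂ, γ ≠ 0 ∧ ∀ (f : Matrix (Fin m) (Fin 1) D → ℂ), IsSchwartz f →
      ∀ p : Matrix (Fin m) (Fin m) D, IsSUT p →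
      ∫ η, ft θ mform f η * expi θ (t⁻¹ * (2⁻¹ * mform ((hact (1 + p) g).1 * η) η) -
        t⁻¹ * mform (corner m 1 D) η) ∂addHaar =
      γ * ∫ v, f ((1 + p)ᴴ * g.1 * v) * expi θ (mform (corner m 1 D) v -
        t * (2⁻¹ * mform (g.1 * v) v)) ∂addHaar := by
  have hg2 : g.1 * g' = 1 := mul_eq_one_comm.1 hg
  let S : Matrix (Fin m) (Fin 1) D ≃ₗ[ℝ] Matrix (Fin m) (Fin 1) D :=
    LinearEquiv.ofLinearMap (mulL 1 g.1) (mulL 1 g')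
      (LinearMap.ext fun y => by
        rw [LinearMap.comp_apply, mulL_apply, mulL_apply, ← Matrix.mul_assoc, hg2, Matrix.one_mul]
        rfl)
      (LinearMap.ext fun y => by
        rw [LinearMap.comp_apply, mulL_apply, mulL_apply, ← Matrix.mul_assoc, hg, Matrix.one_mul]
        rfl)
  have hS : ∀ y, S y = g.1 * y := fun y => rfl
  obtain ⟨γ, hγ, hw⟩ := exists_weil_formula_linear (E := Matrix (Fin m) (Fin 1) D) hθ
    (β := mform) mform_nondegenerate mform_symm S (fun x y => by
      rw [hS, hS, mform_mul_left, conjT]) (corner m 1 D) ht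
  refine ⟨γ, hγ, fun f hf p hp => ?_⟩
  have hu := isUni_one_add_iff.2 hp
  have hq : (1 + p)ᴴ = 1 + pᴴ := by
    rw [Matrix.conjTranspose_add, Matrix.conjTranspose_one]
  have hpn : IsNilpotent pᴴ := by
    obtain ⟨a, ha⟩ := hp.isNilpotent
    exact ⟨a, by rw [← Matrix.conjTranspose_pow, ha, Matrix.conjTranspose_zero]⟩
  have hfu : IsSchwartz fun y : Matrix (Fin m) (Fin 1) D => f ((1 + p)ᴴ * y) := by
    have := hf.comp_linearMap (E := Matrix (Fin m) (Fin 1) D) (F := Matrix (Fin m) (Fin 1) D)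
      (mulL 1 (1 + p)ᴴ) (fun y z hyz => by
        have h1 : (geom p)ᴴ * ((1 + p)ᴴ * y) = (geom p)ᴴ * ((1 + p)ᴴ * z) :=
          congrArg ((geom p)ᴴ * ·) hyz
        rwa [← Matrix.mul_assoc, ← Matrix.mul_assoc, ← Matrix.conjTranspose_mul, mul_geom hp,
          Matrix.conjTranspose_one, Matrix.one_mul, Matrix.one_mul] at h1) 0
    simpa only [zero_add, mulL_apply] using this
  have h1 := hw _ hfu
  have h2 : ∀ v : Matrix (Fin m) (Fin 1) D, (1 + p)ᴴ * S v = (1 + p)ᴴ * g.1 * v := fun v => by rw [hS, Matrix.mul_assoc]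
  simp only [h2] at h1
  refine Eq.trans ?_ ((integral_mul_left_unipotent hp.isNilpotent _).trans h1)
  congr 1
  funext η
  have h3 : ft θ mform (fun y : Matrix (Fin m) (Fin 1) D => f ((1 + p)ᴴ * y)) ((1 + p) * η) = ft θ mform f η := by
    rw [ft, ft, ← integral_mul_left_unipotent hpn (fun y => f y * expi θ (mform y η)), ← hq]
    simp only [mform_mul_left]
  rw [h3, hS, mform_mul_left (1 + p) (corner m 1 D), hu.conjTranspose_mul_corner, mform_mul_left,
    hact_coe]
  simp only [Matrix.mul_assoc]

/-! ### The descent of the Fourier transform -/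

variable (h : m + 1 = n)

/-- The argument of the Fourier transform in the descent. -/
noncomputable def descArg (t : ℝ) (z : Herm m D × Matrix (Fin m) (Fin 1) D) : Herm n D :=
  hblk h (t⁻¹ • hact z.2ᴴ (hreal 1) + z.1) z.2 (hreal t)

/-- The descent of the Fourier transform of `Φ`. -/
noncomputable def Desc (θ t : ℝ) (Φ : Herm n D → ℂ) (σ : Herm m D) : ℂ :=
  ∫ η : Matrix (Fin m) (Fin 1) D, ft θ hform Φ (descArg h t (σ, η)) *
    expi θ (-(t⁻¹ * mform (corner m 1 D) η)) ∂addHaar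

theorem isSchwartz_descArg {t : ℝ} {F : Herm n D → ℂ} (hF : IsSchwartz F) (θ : ℝ) :
    IsSchwartz fun z : Herm m D × Matrix (Fin m) (Fin 1) D =>
      F (descArg h t z) * expi θ (-(t⁻¹ * mform (corner m 1 D) z.2)) := by
  have h1 : (fun z : Herm m D × Matrix (Fin m) (Fin 1) D => z.1).HasTemperateGrowth :=
    LinearMap.hasTemperateGrowth (LinearMap.fst ℝ (Herm m D) (Matrix (Fin m) (Fin 1) D))
  have h2 : (fun z : Herm m D × Matrix (Fin m) (Fin 1) D => z.2).HasTemperateGrowth :=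
    LinearMap.hasTemperateGrowth (LinearMap.snd ℝ (Herm m D) (Matrix (Fin m) (Fin 1) D))
  have h3 : ∀ {E : Type _} [NormedAddCommGroup E] [NormedSpace ℝ E]
      {a : E → Matrix (Fin m) (Fin 1) D}, a.HasTemperateGrowth →
      (fun z => t⁻¹ • hact (a z)ᴴ (hreal (D := D) 1)).HasTemperateGrowth := fun ha =>
    hasTemperateGrowth_linear (t⁻¹ • LinearMap.id : Herm m D →ₗ[ℝ] Herm m D)
      (htg_hact (htg_conjTranspose ha) (htg_const _))
  have hm : (descArg (D := D) h t).HasTemperateGrowth :=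
    hasTemperateGrowth_linear (hblkE (D := D) h).toLinearMap (hasTemperateGrowth_prodMk
      ((h3 h2).add h1) (hasTemperateGrowth_prodMk h2 (htg_const _)))
  have h4 : (fun z : Herm m D × Matrix (Fin m) (Fin 1) D × Herm 1 D => z.2.1).HasTemperateGrowth :=
    LinearMap.hasTemperateGrowth (LinearMap.fst ℝ _ _ ∘ₗ
      LinearMap.snd ℝ (Herm m D) (Matrix (Fin m) (Fin 1) D × Herm 1 D))
  have h5 : (fun z : Herm m D × Matrix (Fin m) (Fin 1) D × Herm 1 D => z.1).HasTemperateGrowth :=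
    LinearMap.hasTemperateGrowth (LinearMap.fst ℝ (Herm m D) (Matrix (Fin m) (Fin 1) D × Herm 1 D))
  have hr : (fun z : Herm m D × Matrix (Fin m) (Fin 1) D × Herm 1 D =>
      (z.1 - t⁻¹ • hact z.2.1ᴴ (hreal (D := D) 1), z.2.1)).HasTemperateGrowth :=
    hasTemperateGrowth_prodMk (h5.sub (h3 h4)) h4
  refine (hF.comp_leftInverse hm (hr.comp (LinearMap.hasTemperateGrowth
    (E := Herm n D) (hblkE (D := D) h).symm.toLinearMap)) ?_).mul_temperate
    (hasTemperateGrowth_expi_comp θ (hasTemperateGrowth_linear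
      (-(t⁻¹ • mform (corner m 1 D))) h2))
  rintro ⟨σ, η⟩
  have h6 := (hblkE (D := D) h).symm_apply_apply
    (t⁻¹ • hact ηᴴ (hreal 1) + σ, η, hreal t)
  rw [hblkE_apply] at h6
  simp only [Function.comp_apply, descArg, LinearEquiv.coe_coe, h6, add_sub_cancel_left]

theorem IsSchwartz.ft_hform {θ : ℝ} (hθ : θ ≠ 0) {Φ : Herm n D → ℂ} (hΦ : IsSchwartz Φ) :
    IsSchwartz (Kloosterman.ft θ hform Φ) :=
  IsSchwartz.ft (E := Herm n D) (F := Herm n D) hθ hform_nondegenerate hΦ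

theorem IsSchwartz.desc {θ t : ℝ} (hθ : θ ≠ 0) {Φ : Herm n D → ℂ} (hΦ : IsSchwartz Φ) :
    IsSchwartz (Desc h θ t Φ) :=
  (isSchwartz_descArg h (hΦ.ft_hform hθ) θ).integral_addHaar

theorem isSchwartz_hblk {Φ : Herm n D → ℂ} (hΦ : IsSchwartz Φ) (s : Herm m D) :
    IsSchwartz fun z : Matrix (Fin m) (Fin 1) D × Herm 1 D => Φ (hblkE h (s, z)) := by
  exact (hΦ.comp_linearEquiv (E := Herm m D × Matrix (Fin m) (Fin 1) D × Herm 1 D)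
    (F := Herm n D) (hblkE h)).slice s

-- Fourier inversion in the upper left block undoes the transform in that variable and leaves the
-- partial transform of Φ in the other two blocks. The shift by t⁻¹ η ηᴴ built into `descArg`
-- becomes the Gaussian factor with the quadratic form of `s`.
set_option maxHeartbeats 1000000 in
theorem exists_ft_desc {θ t : ℝ} (hθ : θ ≠ 0) : ∃ c : ℂ, c ≠ 0 ∧
    ∀ Φ : Herm n D → ℂ, IsSchwartz Φ → ∀ s : Herm m D, ft (-θ) hform (Desc h θ t Φ) s =
      c * ∫ η, ft θ mform (fun y : Matrix (Fin m) (Fin 1) D =>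
        ∫ x : Herm 1 D, Φ (hblk h s y x) * expi θ (hform x (hreal t)) ∂addHaar) η *
        expi θ (t⁻¹ * (2⁻¹ * mform (s.1 * η) η) - t⁻¹ * mform (corner m 1 D) η) ∂addHaar := by
  obtain ⟨c₁, hc1, h1⟩ := exists_ft_equiv (E := Herm m D)
    (F := Matrix (Fin m) (Fin 1) D × Herm 1 D) (H := Herm n D) (hblkE h)
  obtain ⟨c₂, hc2, h2⟩ := exists_ft_inversion (E := Herm m D) (F := Herm m D) hθ
    (b := hform) hform_nondegenerate
  obtain ⟨c₃, hc3, h3⟩ := exists_integral_mul_expi_prod (E := Matrix (Fin m) (Fin 1) D)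
    (F := Herm 1 D)
  refine ⟨c₁ * c₂ * c₃, mul_ne_zero (mul_ne_zero hc1 hc2) hc3, fun Φ hΦ s => ?_⟩
  have hs := isSchwartz_descArg (t := t) h (hΦ.ft_hform hθ) θ
  refine (ft_integral_shift (E := Herm m D) (F := Matrix (Fin m) (Fin 1) D) hform
    (fun σ η => ft θ hform Φ (hblk h σ η (hreal t))) (fun η => t⁻¹ • hact ηᴴ (hreal 1))
    (fun η => -(t⁻¹ * mform (corner m 1 D) η)) hs s).trans ?_
  rw [← integral_const_mul]
  congr 1
  funext η
  let q : (Matrix (Fin m) (Fin 1) D × Herm 1 D) →ₗ[ℝ] ℝ :=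
    (mform.flip η).coprod (hform.flip (hreal t))
  have hKS : IsSchwartz (fun s : Herm m D => ∫ z : Matrix (Fin m) (Fin 1) D × Herm 1 D,
      Φ (hblkE h (s, z)) * expi θ (q z) ∂addHaar) :=
    (hΦ.comp_linearEquiv (E := Herm m D × Matrix (Fin m) (Fin 1) D × Herm 1 D)
      (F := Herm n D) (hblkE h)).integral_mul_expi θ q
  have h4 : ∫ σ : Herm m D, ft θ hform Φ (hblk h σ η (hreal t)) * expi θ (-hform σ s) ∂addHaar =
      c₁ * (c₂ * ∫ z : Matrix (Fin m) (Fin 1) D × Herm 1 D,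
      Φ (hblkE h (s, z)) * expi θ (q z) ∂addHaar) := by
    rw [← h2 _ hKS s, ← integral_const_mul]
    congr 1
    funext σ
    rw [h1 θ Φ hΦ hform hform q _ σ, mul_assoc, hform_symm σ s]
    intro s z
    rw [hblkE_apply, hform_hblk, add_assoc]
    rfl
  have h5 : ∫ z : Matrix (Fin m) (Fin 1) D × Herm 1 D, Φ (hblkE h (s, z)) * expi θ (q z) ∂addHaar =
      c₃ * ft θ mform (fun y : Matrix (Fin m) (Fin 1) D =>
        ∫ x : Herm 1 D, Φ (hblk h s y x) * expi θ (hform x (hreal t)) ∂addHaar) η :=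
    h3 _ (isSchwartz_hblk h hΦ s) θ mform (hform.flip (hreal t)) η
  rw [h4, h5, map_smul, LinearMap.smul_apply, smul_eq_mul, hform_symm _ s, hform_hact_hreal,
    show -(t⁻¹ * mform (corner m 1 D) η) + t⁻¹ * (2⁻¹ * mform (s.1 * η) η) =
      t⁻¹ * (2⁻¹ * mform (s.1 * η) η) - t⁻¹ * mform (corner m 1 D) η by ring]
  ring

/-- The key identity: at each point of the orbit `exists_ft_desc` yields a Gaussian integral, which
`exists_gaussian_orbit` converts into the inner integral of `exists_ft_MS`. The function on the left
depends on Φ and `t` but not on `g`, so information at diagonal matrices can be transferred to other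
matrices of size m. -/
theorem exists_OI_ft_desc {θ t : ℝ} (hθ : θ ≠ 0) (ht : t ≠ 0) {g : Herm m D}
    {P : Submodule ℝ (Matrix (Fin m) (Fin m) D)} (hc : IsChart g P)
    {g' : Matrix (Fin m) (Fin m) D} (hg : g' * g.1 = 1) : ∃ c : ℂ, c ≠ 0 ∧
    ∀ Φ : Herm n D → ℂ, IsSchwartz Φ → OI θ g P (ft (-θ) hform (Desc h θ t Φ)) =
      c * ft θ hform (MS h g P θ Φ) (hreal t) := by
  obtain ⟨c₁, hc1, h1⟩ := exists_ft_desc (D := D) h (t := t) hθ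
  obtain ⟨γ, hγ, h2⟩ := exists_gaussian_orbit hθ ht g hg
  obtain ⟨κ, hκ, h3⟩ := exists_ft_MS (h := h) hc hg
  refine ⟨c₁ * γ * κ⁻¹, mul_ne_zero (mul_ne_zero hc1 hγ) (inv_ne_zero hκ), fun Φ hΦ => ?_⟩
  rw [h3 θ Φ hΦ, mul_assoc _ κ⁻¹, inv_mul_cancel_left₀ hκ, OI, ← integral_const_mul]
  congr 1
  funext p
  have hs : IsSchwartz fun y : Matrix (Fin m) (Fin 1) D => ∫ x : Herm 1 D,
      Φ (hblk h (hact (1 + p.1) g) y x) * expi θ (hform x (hreal t)) ∂addHaar := by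
    exact (isSchwartz_hblk h hΦ _).integral_mul_expi θ (hform.flip (hreal t))
  rw [h1 Φ hΦ, h2 _ hs p.1 (hc.sut _ p.2), mul_assoc, mul_assoc, mul_assoc]
  congr 4
  funext v
  rw [hform_hact, hact_hreal, map_smul, hform_hact_hreal, smul_eq_mul]

theorem OI_ft_desc_diagA {θ t : ℝ} (hθ : θ ≠ 0) (ht : t ≠ 0) {Φ : Herm n D → ℂ}
    (hΦ : IsSchwartz Φ) (hreg : ∀ a : Fin n → ℝˣ, OI θ (diagA a) (sutP n D) Φ = 0)
    (a : Fin m → ℝˣ) : OI θ (diagA a) (sutP m D) (ft (-θ) hform (Desc h θ t Φ)) = 0 := by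
  obtain ⟨c, -, h1⟩ := exists_OI_ft_desc h hθ ht (IsChart.diagA (D := D) a) (diagA_inv a)
  rw [h1 Φ hΦ, ft]
  simp only [MS_diagA_eq_zero h hΦ hreg a, zero_mul, integral_zero, mul_zero]

-- The key identity is used twice: for diagonal matrices it shows that the regular integrals of the
-- transformed descent vanish, and after an application of `hlim` it shows for `g` that the Fourier
-- transform of `MS` vanishes at t ≠ 0. Continuity and Fourier inversion finish the proof.
set_option maxHeartbeats 1000000 in
theorem MS_eq_zero {θ : ℝ} (hθ : θ ≠ 0) {g : Herm m D}
    {P : Submodule ℝ (Matrix (Fin m) (Fin m) D)} (hc : IsChart g P)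
    {g' : Matrix (Fin m) (Fin m) D} (hg : g' * g.1 = 1) (hlim : IsLimit θ g P)
    {Φ : Herm n D → ℂ} (hΦ : IsSchwartz Φ)
    (hreg : ∀ a : Fin n → ℝˣ, OI θ (diagA a) (sutP n D) Φ = 0) (s : Herm 1 D) :
    MS h g P θ Φ s = 0 := by
  have hM : IsSchwartz (MS h g P θ Φ) := IsSchwartz.MS hc hg θ hΦ
  refine eq_zero_of_ft_eq_zero hθ hform_nondegenerate hM (fun w => ?_) s
  refine (hM.ft_hform hθ).eq_zero_of_hreal (fun t ht => ?_) w
  obtain ⟨c, hc0, h1⟩ := exists_OI_ft_desc h hθ ht hc hg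
  have h2 := hlim _ ((hΦ.desc h (t := t) hθ).ft_hform (neg_ne_zero.2 hθ))
    (OI_ft_desc_diagA h hθ ht hΦ hreg)
  rw [h1 Φ hΦ] at h2
  exact (mul_eq_zero.1 h2).resolve_left hc0

end Reduction

section Reversal

variable {m n : ℕ} {D : Type*} [NormedCommRing D] [NormedAlgebra ℝ D] [StarRing D]
  [StarModule ℝ D] [FiniteDimensional ℝ D] [IsQuadratic D] [Nontrivial D]

/-! ### Reversal and the Fourier transform -/

theorem hrev_hreal (t : ℝ) : hrev (hreal (D := D) t) = hreal t := by
  apply Subtype.ext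
  ext i j
  rw [Subsingleton.elim i 0, Subsingleton.elim j 0]
  rfl

theorem hrev_hact_hreal (v : Matrix (Fin 1) (Fin m) D) :
    hrev (hact v (hreal 1)) = hact (mrev 1 m D v)ᴴ (hreal 1) := by
  apply Subtype.ext
  ext i j
  simp [hreal_coe, mrev_apply, Matrix.mul_apply]

theorem OI_const_mul (θ : ℝ) (g : Herm n D) (P : Submodule ℝ (Matrix (Fin n) (Fin n) D)) (c : ℂ)
    (Φ : Herm n D → ℂ) : OI θ g P (fun x => c * Φ x) = c * OI θ g P Φ := by
  rw [OI, OI, ← integral_const_mul]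
  simp only [mul_assoc]

/-- The descent is the reduction along a block of size one. -/
theorem exists_MS_hrev (h : m + 1 = n) (h' : 1 + m = n) {t : ℝ} (ht : t ≠ 0) :
    ∃ c : ℂ, c ≠ 0 ∧ ∀ (θ : ℝ) (Φ : Herm n D → ℂ) (σ : Herm m D),
      MS h' (hreal t) ⊥ (-θ) (fun x => ft θ hform Φ (hrev x)) σ = c * Desc h θ t Φ (hrev σ) := by
  -- The substitution is η = t vᴴ up to reversal; it turns t vᴴ v into t⁻¹ η ηᴴ, the shift in
  -- `descArg`.
  let e : ((⊥ : Submodule ℝ (Matrix (Fin 1) (Fin 1) D)) × Matrix (Fin 1) (Fin m) D) ≃ₗ[ℝ]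
      Matrix (Fin m) (Fin 1) D :=
    LinearEquiv.uniqueProd.trans ((mrev 1 m D).trans (LinearEquiv.smulOfNeZero ℝ _ t ht))
  have he : ∀ z, e z = t • mrev 1 m D z.2 := fun z => rfl
  obtain ⟨c, hc, hint⟩ := exists_integral_comp_linearEquiv
    (E := (⊥ : Submodule ℝ (Matrix (Fin 1) (Fin 1) D)) × Matrix (Fin 1) (Fin m) D)
    (F := Matrix (Fin m) (Fin 1) D) e
  refine ⟨c, hc, fun θ Φ σ => ?_⟩
  refine Eq.trans ?_ (hint fun η => ft θ hform Φ (descArg h t (hrev σ, η)) *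
    expi θ (-(t⁻¹ * mform (corner m 1 D) η)))
  rw [MS]
  congr 1
  funext z
  have hz : z.1.1 = 0 := by rw [Subsingleton.elim z.1 0]; rfl
  rw [he, blockPhase_apply, hz, map_zero, zero_add, expi_neg_left, map_smul, smul_eq_mul,
    inv_mul_cancel_left₀ ht, mform_corner_mrev]
  congr 2
  rw [blockMap, hrev_hblk h' h, descArg, hz, add_zero, hact_one, Matrix.conjTranspose_one,
    Matrix.one_mul, hrev_hreal, hreal_coe, Matrix.smul_mul, Matrix.one_mul, map_smul,
    map_add, hact_hreal, map_smul, hrev_hact_hreal, Matrix.conjTranspose_smul, star_trivial]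
  congr 2
  apply Subtype.ext
  rw [hact_hreal]
  simp only [Submodule.coe_smul, hact_coe, Matrix.conjTranspose_smul, star_trivial,
    Matrix.smul_mul, Matrix.mul_smul, smul_smul]
  congr 1
  field_simp

/-- The vanishing of the regular orbital integrals is preserved by the Fourier transform. -/
theorem OI_diagA_ft_hrev_eq_zero {θ : ℝ} (hθ : θ ≠ 0) {Φ : Herm n D → ℂ} (hΦ : IsSchwartz Φ)
    (hreg : ∀ a : Fin n → ℝˣ, OI θ (diagA a) (sutP n D) Φ = 0) (a : Fin n → ℝˣ) :
    OI (-θ) (diagA a) (sutP n D) (fun x => ft θ hform Φ (hrev x)) = 0 := by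
  induction n with
  | zero =>
    have hs : Subsingleton (Herm 0 D) := ⟨fun x y => Subtype.ext (by ext i; exact i.elim0)⟩
    have h1 := hreg a
    rw [sutP_eq_bot (by omega)] at h1 ⊢
    obtain ⟨c, hc, h2⟩ := exists_OI_bot θ (diagA (D := D) a)
    rw [h2] at h1
    have h3 : ∀ x, Φ x = 0 := fun x => by
      rw [Subsingleton.elim x (diagA a)]; exact (mul_eq_zero.1 h1).resolve_left hc
    obtain ⟨c', hc', h4⟩ := exists_OI_bot (-θ) (diagA (D := D) a)
    rw [h4]
    simp only [ft, h3, zero_mul, integral_zero, mul_zero]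
  | succ m ih =>
    have h' : 1 + m = m + 1 := add_comm _ _
    have hF := (hΦ.ft_hform hθ).comp_linearEquiv (E := Herm (m + 1) D) (F := Herm (m + 1) D) hrev
    rw [diagA_block h', diagA_one, ← pblk_sutP h', sutP_eq_bot (n := 1) le_rfl]
    set t : ℝ := (a (iL h' 0) : ℝ) with htdef
    have ht : t ≠ 0 := Units.ne_zero _
    have hg : ((hreal t⁻¹ : Herm 1 D)).1 * (hreal (D := D) t).1 = 1 := by
      rw [hreal_coe, hreal_coe, Matrix.smul_mul, Matrix.one_mul, smul_smul, inv_mul_cancel₀ ht,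
        one_smul]
    obtain ⟨c, hc, h1⟩ := exists_OI_block (h := h') (IsChart.trivial (hreal (D := D) t) le_rfl) hg
      (IsChart.diagA (D := D) fun i => a (iR h' i)) (-θ)
    rw [h1 _ hF]
    obtain ⟨c₂, hc2, h2⟩ := exists_MS_hrev (D := D) rfl h' ht
    obtain ⟨c₃, hc3, h3⟩ := exists_ft_inversion (E := Herm m D) (F := Herm m D)
      (neg_ne_zero.2 hθ) (b := hform) hform_nondegenerate
    have hdesc := hΦ.desc (rfl : m + 1 = m + 1) (t := t) hθ
    -- The induction hypothesis is applied to the Fourier transform of the descent, whose regular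
    -- integrals vanish by the key identity; transforming once more returns the descent up to a
    -- constant.
    have h4 := ih (hdesc.ft_hform (neg_ne_zero.2 hθ)) (OI_ft_desc_diagA rfl hθ ht hΦ hreg)
      fun i => a (iR h' i)
    have h5 : ∀ w : Herm m D, ft θ hform (ft (-θ) hform (Desc rfl θ t Φ)) w =
        c₃ * Desc rfl θ t Φ w := fun w => by
      rw [← h3 _ hdesc w, ft]
      congr 1
      funext v
      rw [expi_neg_left, neg_neg, hform_symm]
    simp only [h5, OI_const_mul] at h4
    simp only [funext (h2 θ Φ), OI_const_mul]
    rw [(mul_eq_zero.1 h4).resolve_left hc3, mul_zero, mul_zero]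

end Reversal

/-! ### Fourier duality between orthogonal affine subspaces -/

section Abstract

variable {E F G H : Type*} [NormedAddCommGroup E] [NormedSpace ℝ E] [FiniteDimensional ℝ E]
  [MeasurableSpace E] [BorelSpace E] [NormedAddCommGroup F] [NormedSpace ℝ F]
  [FiniteDimensional ℝ F] [MeasurableSpace F] [BorelSpace F] [NormedAddCommGroup H]
  [NormedSpace ℝ H] [FiniteDimensional ℝ H] [MeasurableSpace H] [BorelSpace H]
  [NormedAddCommGroup G] [NormedSpace ℝ G] [FiniteDimensional ℝ G] [MeasurableSpace G]
  [BorelSpace G]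

theorem exists_integral_prod_prod : ∃ c : ℂ, c ≠ 0 ∧ ∀ f : E × F × G → ℂ, IsSchwartz f →
    ∫ w, f w ∂addHaar = c * ∫ x, ∫ y, ∫ z, f (x, y, z) ∂addHaar ∂addHaar ∂addHaar := by
  obtain ⟨c₁, hc1, h1⟩ := exists_integral_prod (E := E) (F := F × G)
  obtain ⟨c₂, hc2, h2⟩ := exists_integral_prod (E := F) (F := G)
  refine ⟨c₁ * c₂, mul_ne_zero hc1 hc2, fun f hf => ?_⟩
  rw [h1 _ hf.integrable_addHaar, mul_assoc, ← integral_const_mul c₂]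
  congr 2
  funext x
  exact h2 _ (hf.slice x).integrable_addHaar

/-- The Fourier transform exchanges integrals over cosets of complementary orthogonal
subspaces. -/
theorem integral_coset_eq_zero {θ : ℝ} (hθ : θ ≠ 0) (e : (E × F) ≃ₗ[ℝ] H)
    {b : H →ₗ[ℝ] H →ₗ[ℝ] ℝ} (hb : b.Nondegenerate) (hsymm : ∀ x y, b x y = b y x)
    (horth : ∀ x y, b (e (x, 0)) (e (0, y)) = 0) {Φ : H → ℂ} (hΦ : IsSchwartz Φ) (v : E) (J : F)
    (h : ∫ x, ft θ b Φ (e (x, J)) * expi θ (-b (e (v, 0)) (e (x, 0))) ∂addHaar = 0) :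
    ∫ y, Φ (e (v, y)) * expi θ (b (e (0, y)) (e (0, J))) ∂addHaar = 0 := by
  have hadd : ∀ x y, e (x, y) = e (x, 0) + e (0, y) := fun x y => by
    rw [← map_add, Prod.mk_add_mk, add_zero, zero_add]
  let i₁ : E →ₗ[ℝ] H := e.toLinearMap ∘ₗ LinearMap.inl ℝ E F
  let i₂ : F →ₗ[ℝ] H := e.toLinearMap ∘ₗ LinearMap.inr ℝ E F
  let b₁ : E →ₗ[ℝ] E →ₗ[ℝ] ℝ := b.compl₁₂ i₁ i₁
  let q : F →ₗ[ℝ] ℝ := b.flip (e (0, J)) ∘ₗ i₂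
  have hb1 : ∀ x x', b₁ x x' = b (e (x, 0)) (e (x', 0)) := fun _ _ => rfl
  have hq : ∀ y, q y = b (e (0, y)) (e (0, J)) := fun _ => rfl
  -- Since the two summands are orthogonal, `b` stays non-degenerate on the first one.
  have hs : b₁.SeparatingLeft := by
    intro x hx
    have h1 : e (x, 0) = 0 := hb.1 _ fun z => by
      obtain ⟨⟨x', y'⟩, rfl⟩ := e.surjective z
      rw [hadd x' y', map_add, horth, ← hb1, hx, add_zero]
    exact congrArg Prod.fst (e.map_eq_zero_iff.1 h1)
  have hnd : b₁.Nondegenerate :=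
    ⟨hs, fun x hx => hs x fun x' => by rw [hb1, hsymm, ← hb1]; exact hx x'⟩
  obtain ⟨c, hc, h2⟩ := exists_ft_equiv e
  obtain ⟨c', hc', h3⟩ := exists_ft_inversion hθ hnd
  have hΨ : IsSchwartz fun x => ∫ y, Φ (e (x, y)) * expi θ (q y) ∂addHaar :=
    (hΦ.comp_linearEquiv e).integral_mul_expi θ q
  -- On the coset through `J` the transform of Φ is the transform on `E` of its partial integral
  -- over `F`; so the hypothesis says that the inverse transform vanishes at `v`.
  have h4 : ∀ x, ft θ b Φ (e (x, J)) =
      c * ft θ b₁ (fun x => ∫ y, Φ (e (x, y)) * expi θ (q y) ∂addHaar) x := fun x => by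
    refine h2 θ Φ hΦ b b₁ q _ x fun x' y' => ?_
    rw [hadd x' y', hadd x J, hb1, hq]
    simp only [map_add, LinearMap.add_apply]
    rw [horth, hsymm (e (0, y')), horth, zero_add, add_zero]
  simp only [h4, mul_assoc, integral_const_mul] at h
  have h5 := h3 _ hΨ v
  simp only [hb1] at h5
  rw [h5] at h
  exact (mul_eq_zero.1 ((mul_eq_zero.1 h).resolve_left hc)).resolve_left hc'

end Abstract

section Split

variable {m n : ℕ} {D : Type*} [NormedCommRing D] [NormedAlgebra ℝ D] [StarRing D]
  [StarModule ℝ D] [FiniteDimensional ℝ D] [IsQuadratic D] [Nontrivial D]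

/-! ### Matrices supported below the antidiagonal -/

theorem hblk_apply_eq_zero (h : m + 1 = n) {s : Herm m D} (hs : s ∈ LW m D)
    (y : Matrix (Fin m) (Fin 1) D) (c : Herm 1 D) (i j : Fin n) (hij : (i : ℕ) + j < m) :
    (hblk h s y c).1 i j = 0 := by
  have h1 : (hblk h s y c).1 (iL h ⟨i, by omega⟩) (iL h ⟨j, by omega⟩) = 0 := by
    rw [hblk_coe, mblk_LL]
    exact hs _ _ hij
  exact h1

theorem hrev_hblk_apply_eq_zero (h : m + 1 = n) {s : Herm m D} (hs : s ∈ LW m D)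
    (y : Matrix (Fin m) (Fin 1) D) (c : Herm 1 D) (i j : Fin n) (hij : n ≤ (i : ℕ) + j) :
    (hrev (hblk h s y c)).1 i j = 0 :=
  hblk_apply_eq_zero h hs y c _ _ (by rw [Fin.val_rev, Fin.val_rev]; omega)

variable (n D) in
/-- The projection onto the matrices supported below the antidiagonal. -/
noncomputable def lowerPart (x : Herm n D) : LW n D :=
  ⟨⟨Matrix.of fun i j => if (i : ℕ) + j < n then 0 else x.1 i j, by
    change Matrix.conjTranspose _ = _
    ext i j
    rw [Matrix.conjTranspose_apply, Matrix.of_apply, Matrix.of_apply, add_comm]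
    split_ifs
    · exact star_zero _
    · exact congrFun (congrFun (conjT x) i) j⟩, fun i j hij => if_pos hij⟩

theorem lowerPart_apply (x : Herm n D) (i j : Fin n) (hij : n ≤ (i : ℕ) + j) :
    (lowerPart n D x).1.1 i j = x.1 i j := if_neg (by omega)

/-- The sum decomposition of hermitian matrices along the antidiagonal. -/
noncomputable def splitMap (h : m + 1 = n) :
    ((LW m D × Matrix (Fin m) (Fin 1) D × Herm 1 D) × LW n D) →ₗ[ℝ] Herm n D :=
  (hrev.toLinearMap ∘ₗ (hblkE h).toLinearMap ∘ₗ
    LinearMap.prodMap (LW m D).subtype LinearMap.id).coprod (LW n D).subtype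

theorem splitMap_apply (h : m + 1 = n)
    (z : (LW m D × Matrix (Fin m) (Fin 1) D × Herm 1 D) × LW n D) :
    splitMap h z = hrev (hblk h z.1.1.1 z.1.2.1 z.1.2.2) + z.2.1 := rfl

/-- Reversing a matrix whose upper left block lies in `LW m` gives a matrix supported on and above
the antidiagonal. Such matrices form a complement of `LW n`, which by `hform_hrev_hblk` is
orthogonal to it. -/
theorem splitMap_bijective (h : m + 1 = n) : Function.Bijective (splitMap (D := D) h) := by
  constructor
  · rw [injective_iff_map_eq_zero]
    rintro ⟨⟨s, y, c⟩, A⟩ hz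
    rw [splitMap_apply] at hz
    have hA : A = 0 := by
      apply Subtype.ext
      apply Subtype.ext
      ext i j
      rcases lt_or_ge ((i : ℕ) + j) n with hij | hij
      · exact A.2 i j hij
      · have h1 := congrFun (congrFun (congrArg Subtype.val hz) i) j
        have h2 := hrev_hblk_apply_eq_zero h s.2 y c i j hij
        change (hrev (hblk h s.1 y c)).1 i j + A.1.1 i j = 0 at h1
        rwa [h2, zero_add] at h1
    subst hA
    have h3 : hblkE h (s.1, y, c) = 0 := by
      have h4 : hrev (hblkE h (s.1, y, c)) = 0 := by
        rw [hblkE_apply]; simpa using hz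
      exact hrev.map_eq_zero_iff.1 h4
    have h5 := (hblkE h).map_eq_zero_iff.1 h3
    simp only [Prod.mk_eq_zero, ZeroMemClass.coe_eq_zero] at h5
    obtain ⟨rfl, rfl, rfl⟩ := h5
    rfl
  · intro x
    obtain ⟨s, y, c, hs⟩ := exists_hblk h (hrev (x - (lowerPart n D x).1))
    have h1 : s ∈ LW m D := fun i j hij => by
      have h2 : (hblk h s y c).1 (iL h i) (iL h j) = 0 := by
        rw [← hs]
        change x.1 (Fin.rev (iL h i)) (Fin.rev (iL h j)) -
          (lowerPart n D x).1.1 (Fin.rev (iL h i)) (Fin.rev (iL h j)) = 0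
        rw [lowerPart_apply, sub_self]
        simp only [Fin.val_rev, iL]
        omega
      rwa [hblk_coe, mblk_LL] at h2
    refine ⟨((⟨s, h1⟩, y, c), lowerPart n D x), ?_⟩
    rw [splitMap_apply, ← hs, hrev_hrev, sub_add_cancel]

/-- The decomposition of hermitian matrices along the antidiagonal. -/
noncomputable def splitE (h : m + 1 = n) :
    ((LW m D × Matrix (Fin m) (Fin 1) D × Herm 1 D) × LW n D) ≃ₗ[ℝ] Herm n D :=
  LinearEquiv.ofBijective (splitMap h) (splitMap_bijective h)

theorem splitE_apply (h : m + 1 = n)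
    (z : (LW m D × Matrix (Fin m) (Fin 1) D × Herm 1 D) × LW n D) :
    splitE h z = hrev (hblk h z.1.1.1 z.1.2.1 z.1.2.2) + z.2.1 := rfl

theorem JW_mem_LW (b : ℝ) : JW n D b ∈ LW n D := fun i j hij => if_neg (by omega)

/-- The covector of the phase on the orbit of size n is, after reversal, the antidiagonal matrix of
size m. This is how the dual coset contains the orbit of a smaller antidiagonal block. -/
theorem hrev_hblk_wH (h : m + 1 = n) (b : ℝ) : hrev (hblk h (wH m D b) 0 0) = JW n D b := by
  have h1 : hblk h (wH m D b) 0 0 = hrev (JW n D b) := by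
    apply Subtype.ext
    apply matrix_ext_block h <;> intro i j <;> rw [hrev_coe, Matrix.submatrix_apply, JW_coe_apply]
    · rw [hblk_coe, mblk_LL, wH_coe, Matrix.smul_apply, wmat, Algebra.algebraMap_eq_smul_one]
      have : (((Fin.rev (iL h i)) : ℕ) + Fin.rev (iL h j) = n) ↔ Fin.rev i = j := by
        simp only [Fin.val_rev, iL, Fin.ext_iff]; omega
      simp only [this]
      split_ifs
      · rfl
      · rw [smul_zero]
    · rw [hblk_coe, mblk_LR, if_neg]
      · rfl
      · simp only [Fin.val_rev, iL, iR]; omega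
    · rw [hblk_coe, mblk_RL, if_neg]
      · simp
      · simp only [Fin.val_rev, iL, iR]; omega
    · rw [hblk_coe, mblk_RR, if_neg]
      · rfl
      · simp only [Fin.val_rev, iR]; omega
  rw [h1, hrev_hrev]

theorem hrev_wH (b : ℝ) : hrev (wH n D b) = wH n D b := by
  apply Subtype.ext
  ext i j
  change (wH n D b).1 (Fin.rev i) (Fin.rev j) = (wH n D b).1 i j
  rw [wH_coe, Matrix.smul_apply, Matrix.smul_apply, wmat, wmat, Fin.rev_rev]
  have : i = Fin.rev j ↔ Fin.rev i = j := by
    rw [Fin.rev_eq_iff]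
  simp only [this]

/-- The base point of the orbit of size n decomposes into the phases of the smaller orbit and of its
off-diagonal block. For m = 0 the only antidiagonal entry would sit in the last diagonal block,
which is why that case is excluded. -/
theorem hblk_JW (h : m + 1 = n) (hm : m ≠ 0) (b : ℝ) :
    hblk h (JW m D b) (b • (wmat m D * corner m 1 D)) 0 = wH n D b := by
  have h0 : ∀ (i : Fin m) (j : Fin 1), (b • (wmat m D * corner m 1 D)) i j =
      b • if (i : ℕ) = 0 then (1 : D) else 0 := fun i j => by
    rw [Matrix.smul_apply, wmat_mul_apply, corner]
    have : (((Fin.rev i : Fin m) : ℕ) + 1 = m ∧ (j : ℕ) = 0) ↔ (i : ℕ) = 0 := by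
      rw [Fin.val_rev]; omega
    simp only [this]
  apply Subtype.ext
  apply matrix_ext_block h <;> intro i j <;> rw [wH_coe, Matrix.smul_apply, wmat]
  · rw [hblk_coe, mblk_LL, JW_coe_apply, Algebra.algebraMap_eq_smul_one]
    have : Fin.rev (iL h i) = iL h j ↔ (i : ℕ) + j = m := by
      simp only [Fin.ext_iff, Fin.val_rev, iL]; omega
    simp only [this]
    split_ifs
    · rfl
    · rw [smul_zero]
  · rw [hblk_coe, mblk_LR, h0]
    have : Fin.rev (iL h i) = iR h j ↔ (i : ℕ) = 0 := by
      simp only [Fin.ext_iff, Fin.val_rev, iL, iR]; omega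
    simp only [this]
  · rw [hblk_coe, mblk_RL, Matrix.conjTranspose_apply, h0]
    have : Fin.rev (iR h i) = iL h j ↔ (j : ℕ) = 0 := by
      simp only [Fin.ext_iff, Fin.val_rev, iL, iR]; omega
    simp only [this, star_smul, star_trivial]
    split_ifs <;> simp
  · rw [hblk_coe, mblk_RR, if_neg, smul_zero]
    · rfl
    · simp only [Fin.ext_iff, Fin.val_rev, iR]; omega

theorem hform_hrev (x y : Herm n D) : hform (hrev x) (hrev y) = hform x y := by
  rw [hform_apply, hform_apply, hrev_coe, hrev_coe,
    ← Matrix.submatrix_mul x.1 y.1 Fin.rev Fin.rev Fin.rev Fin.rev_bijective]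
  congr 2
  rw [Matrix.trace, ← Equiv.sum_comp Fin.revPerm]
  simp [Matrix.trace]

theorem hform_hrev_hblk (h : m + 1 = n) {s : Herm m D} (hs : s ∈ LW m D)
    (y : Matrix (Fin m) (Fin 1) D) (c : Herm 1 D) {A : Herm n D} (hA : A ∈ LW n D) :
    hform (hrev (hblk h s y c)) A = 0 := by
  rw [hform_apply, Matrix.trace, Finset.sum_eq_zero, map_zero, mul_zero]
  intro i _
  rw [Matrix.diag_apply, Matrix.mul_apply]
  refine Finset.sum_eq_zero fun j _ => ?_
  rcases lt_or_ge ((i : ℕ) + j) n with hij | hij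
  · rw [hA j i (by omega), mul_zero]
  · rw [hrev_hblk_apply_eq_zero h hs y c i j hij, zero_mul]

end Split

section Antidiagonal

variable {m n : ℕ} {D : Type*} [NormedCommRing D] [NormedAlgebra ℝ D] [StarRing D]
  [StarModule ℝ D] [FiniteDimensional ℝ D] [IsQuadratic D] [Nontrivial D]

/-! ### The orbital integrals of antidiagonal matrices -/

/-- Integration along the orbit of vectors under an invertible hermitian matrix. -/
theorem exists_integral_orbit_wH {b : ℝ} (hb : b ≠ 0) : ∃ c : ℂ, c ≠ 0 ∧
    ∀ (θ : ℝ) (f : Matrix (Fin m) (Fin 1) D → ℂ) (p : Matrix (Fin m) (Fin m) D), IsSUT p →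
    ∫ v : Matrix (Fin m) (Fin 1) D, f ((1 + p)ᴴ * (wH m D b⁻¹).1 * v) *
      expi θ (mform (corner m 1 D) v) ∂addHaar =
    c * ∫ y : Matrix (Fin m) (Fin 1) D,
      f y * expi θ (mform (b • (wmat m D * corner m 1 D)) y) ∂addHaar := by
  let S : Matrix (Fin m) (Fin 1) D ≃ₗ[ℝ] Matrix (Fin m) (Fin 1) D :=
    LinearEquiv.ofLinearMap (mulL 1 (wH m D b⁻¹).1) (mulL 1 (wH m D b).1)
      (LinearMap.ext fun y => by
        rw [LinearMap.comp_apply, mulL_apply, mulL_apply, ← Matrix.mul_assoc,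
          wH_mul_wH (inv_mul_cancel₀ hb), Matrix.one_mul]
        rfl)
      (LinearMap.ext fun y => by
        rw [LinearMap.comp_apply, mulL_apply, mulL_apply, ← Matrix.mul_assoc,
          wH_mul_wH (mul_inv_cancel₀ hb), Matrix.one_mul]
        rfl)
  have hS : ∀ y, S y = (wH m D b⁻¹).1 * y := fun y => rfl
  obtain ⟨c, hc, hint⟩ := exists_integral_comp_linearEquiv (E := Matrix (Fin m) (Fin 1) D)
    (F := Matrix (Fin m) (Fin 1) D) S
  refine ⟨c, hc, fun θ f p hp => ?_⟩
  have hpn : IsNilpotent pᴴ := by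
    obtain ⟨a, ha⟩ := hp.isNilpotent
    exact ⟨a, by rw [← Matrix.conjTranspose_pow, ha, Matrix.conjTranspose_zero]⟩
  have hq : (1 + p)ᴴ = 1 + pᴴ := by
    rw [Matrix.conjTranspose_add, Matrix.conjTranspose_one]
  refine Eq.trans ?_ (congrArg (c * ·) (integral_mul_left_unipotent hpn fun y =>
    f y * expi θ (mform (b • (wmat m D * corner m 1 D)) y)))
  rw [← hq]
  refine Eq.trans ?_ (hint fun y => f ((1 + p)ᴴ * y) *
    expi θ (mform (b • (wmat m D * corner m 1 D)) ((1 + p)ᴴ * y)))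
  congr 1
  funext v
  rw [hS, ← Matrix.mul_assoc]
  congr 2
  rw [Matrix.mul_assoc, mform_mul_left, Matrix.conjTranspose_conjTranspose, mform_mul_left, conjT]
  congr 2
  -- The vector w · corner lives in row 0, and column 0 of `p` vanishes.
  have h1 : (1 + p) * (wmat m D * corner m 1 D) = wmat m D * corner m 1 D := by
    ext i j
    rw [Matrix.add_mul, Matrix.one_mul, Matrix.add_apply, add_eq_left, Matrix.mul_apply]
    refine Finset.sum_eq_zero fun r _ => ?_
    rw [wmat_mul_apply, corner]
    split_ifs with h
    · rw [hp i r, zero_mul]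
      rw [Fin.le_def]
      rw [Fin.val_rev] at h
      omega
    · rw [mul_zero]
  rw [Matrix.mul_smul, h1, wH_coe, Matrix.smul_mul, Matrix.mul_smul, smul_smul,
    inv_mul_cancel₀ hb, one_smul, ← Matrix.mul_assoc, wmat_mul_wmat, Matrix.one_mul]

-- The orbit is the affine space b w + `LW n` with a linear phase. By `integral_coset_eq_zero` it
-- suffices to integrate the Fourier transform over the dual coset. After reversal the upper left
-- block of that coset runs through the orbit of b⁻¹ w of size m and the other two blocks are free.
-- The resulting integral is a Fourier coefficient of `MS`, which vanishes by `MS_eq_zero` because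
-- the Fourier transform inherits the vanishing of the regular integrals.
set_option maxHeartbeats 1000000 in
theorem OI_wH_eq_zero (h : m + 1 = n) (hm : m ≠ 0) {θ : ℝ} (hθ : θ ≠ 0) {b : ℝ} (hb : b ≠ 0)
    (hlim : IsLimit (-θ) (wH m D b⁻¹) (PW m D)) {Φ : Herm n D → ℂ} (hΦ : IsSchwartz Φ)
    (hreg : ∀ a : Fin n → ℝˣ, OI θ (diagA a) (sutP n D) Φ = 0) :
    OI θ (wH n D b) (PW n D) Φ = 0 := by
  have hF := hΦ.ft_hform hθ
  have hF' : IsSchwartz fun x => ft θ hform Φ (hrev x) :=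
    hF.comp_linearEquiv (E := Herm n D) (F := Herm n D) hrev
  have hbi : b⁻¹ ≠ 0 := inv_ne_zero hb
  -- the reduction of the Fourier transform vanishes
  have h1 : ft (-θ) hform (MS h (wH m D b⁻¹) (PW m D) (-θ) fun x => ft θ hform Φ (hrev x)) 0 = 0 := by
    rw [ft]
    simp only [MS_eq_zero h (neg_ne_zero.2 hθ) (IsChart.wH hbi) (wH_mul_wH (mul_inv_cancel₀ hb)) hlim
      hF' (OI_diagA_ft_hrev_eq_zero hθ hΦ hreg), zero_mul, integral_zero]
  obtain ⟨κ, hκ, h2⟩ := exists_ft_MS (h := h) (IsChart.wH (k := m) (D := D) hbi)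
    (wH_mul_wH (mul_inv_cancel₀ hb))
  rw [h2 _ _ hF'] at h1
  replace h1 := (mul_eq_zero.1 h1).resolve_left hκ
  -- At t = 0 the quadratic phase disappears and the last diagonal entry is integrated without
  -- weight.
  simp only [map_zero, expi_zero, mul_one, sub_zero] at h1
  obtain ⟨c₁, hc1, h3⟩ := exists_integral_orbit_wH (m := m) (D := D) hb
  have h4 : OI (-θ) (wH m D b⁻¹) (PW m D) (fun s => ∫ y : Matrix (Fin m) (Fin 1) D,
      (∫ c : Herm 1 D, ft θ hform Φ (hrev (hblk h s y c)) ∂addHaar) *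
        expi (-θ) (mform (b • (wmat m D * corner m 1 D)) y) ∂addHaar) = 0 := by
    refine (mul_eq_zero.1 (?_ : c₁ * _ = 0)).resolve_left hc1
    rw [← h1, OI, ← integral_const_mul]
    congr 1
    funext p
    rw [h3 (-θ) (fun y => ∫ c : Herm 1 D,
      ft θ hform Φ (hrev (hblk h (hact (1 + p.1) (wH m D b⁻¹)) y c)) ∂addHaar) p.1 p.2.1, mul_assoc]
  obtain ⟨c₂, hc2, h5⟩ := exists_OI_wH (k := m) (D := D) (-θ) hbi
  rw [h5, inv_inv] at h4
  replace h4 := (mul_eq_zero.1 h4).resolve_left hc2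
  -- the integral over a coset of the space of matrices supported above the antidiagonal
  let v : LW m D × Matrix (Fin m) (Fin 1) D × Herm 1 D :=
    (⟨JW m D b, JW_mem_LW b⟩, b • (wmat m D * corner m 1 D), 0)
  let J : LW n D := ⟨JW n D b⁻¹, JW_mem_LW b⁻¹⟩
  have hv : splitE h (v, 0) = wH n D b := by
    rw [splitE_apply, hblk_JW h hm, hrev_wH]
    exact add_zero _
  have hz : ∀ z : LW m D × Matrix (Fin m) (Fin 1) D × Herm 1 D,
      splitE h (z, 0) = hrev (hblk h z.1.1 z.2.1 z.2.2) := fun z => add_zero _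
  have hJ : ∀ z : LW m D × Matrix (Fin m) (Fin 1) D × Herm 1 D, splitE h (z, J) =
      hrev (hblk h (wH m D b⁻¹ + z.1.1) z.2.1 z.2.2) := fun z => by
    rw [splitE_apply, show J.1 = hrev (hblk h (wH m D b⁻¹) 0 0) from (hrev_hblk_wH h b⁻¹).symm,
      ← map_add]
    congr 1
    have := (hblkE (D := D) h).map_add (z.1.1, z.2.1, z.2.2) (wH m D b⁻¹, 0, 0)
    rw [hblkE_apply, hblkE_apply, hblkE_apply] at this
    rw [← this]
    simp [add_comm]
  have hphase : ∀ z : LW m D × Matrix (Fin m) (Fin 1) D × Herm 1 D,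
      hform (splitE h (v, 0)) (splitE h (z, 0)) =
        hform z.1.1 (JW m D b) + mform (b • (wmat m D * corner m 1 D)) z.2.1 := fun z => by
    rw [hz, hz, hform_hrev, hform_hblk, hform_symm z.1.1]
    simp [v]
  have hs : IsSchwartz fun z : LW m D × Matrix (Fin m) (Fin 1) D × Herm 1 D =>
      ft θ hform Φ (splitE h (z, J)) * expi θ (-hform (splitE h (v, 0)) (splitE h (z, 0))) := by
    have h6 := (hF.comp_linearEquiv (E := (LW m D × Matrix (Fin m) (Fin 1) D × Herm 1 D) × LW n D)
      (F := Herm n D) (splitE h)).comp_linearMap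
      (E := LW m D × Matrix (Fin m) (Fin 1) D × Herm 1 D)
      (F := (LW m D × Matrix (Fin m) (Fin 1) D × Herm 1 D) × LW n D)
      (LinearMap.inl ℝ _ _) LinearMap.inl_injective (0, J)
    have h7 := h6.mul_expi (E := LW m D × Matrix (Fin m) (Fin 1) D × Herm 1 D) θ
      (-(hform (splitE h (v, 0)) ∘ₗ (splitE h).toLinearMap ∘ₗ LinearMap.inl ℝ _ (LW n D)))
    simpa using h7
  obtain ⟨c₃, hc3, h8⟩ := exists_integral_prod_prod (E := LW m D) (F := Matrix (Fin m) (Fin 1) D)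
    (G := Herm 1 D)
  have h9 := integral_coset_eq_zero (E := LW m D × Matrix (Fin m) (Fin 1) D × Herm 1 D)
    (F := LW n D) (H := Herm n D) hθ (splitE h) (b := hform) hform_nondegenerate hform_symm
    (fun x y => by
      rw [hz, splitE_apply]
      have : hblk h (0 : Herm m D) 0 0 = 0 := (hblkE (D := D) h).map_zero
      change hform _ (hrev (hblk h (0 : Herm m D) 0 0) + y.1) = 0
      rw [this, map_zero, zero_add]
      exact hform_hrev_hblk h x.1.2 _ _ y.2) hΦ v J (by
      rw [h8 _ hs, ← mul_zero c₃, ← h4]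
      congr 2
      funext A
      rw [← integral_mul_const]
      congr 1
      funext y
      rw [← integral_mul_const, ← integral_mul_const]
      congr 1
      funext c
      rw [hJ, hphase, mul_assoc, ← expi_add, expi_neg_left, add_comm (hform A.1 _)])
  obtain ⟨c₄, hc4, h10⟩ := exists_OI_wH (k := n) (D := D) θ hb
  rw [h10, ← mul_zero c₄, ← h9]
  congr 2
  funext A
  have h11 : splitE h (v, A) = wH n D b + A.1 := by
    rw [← hv, splitE_apply, splitE_apply]
    simp
  have h12 : ∀ B : LW n D, splitE h (0, B) = B.1 := fun B => by
    rw [splitE_apply]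
    have : hblk h (0 : Herm m D) 0 0 = 0 := (hblkE (D := D) h).map_zero
    change hrev (hblk h (0 : Herm m D) 0 0) + B.1 = B.1
    rw [this, map_zero, zero_add]
  rw [h11, h12, h12]

end Antidiagonal

section Standard

variable {k l m n q r : ℕ} {D : Type*} [NormedCommRing D] [NormedAlgebra ℝ D] [StarRing D]
  [StarModule ℝ D]

/-! ### Associativity of block decompositions -/

theorem iR_iL (h₁ : k + l = n) (h₂ : m + q = l) (h₃ : k + m = r) (h₄ : r + q = n) (i : Fin m) :
    iR h₁ (iL h₂ i) = iL h₄ (iR h₃ i) := rfl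

theorem iR_iR (h₁ : k + l = n) (h₂ : m + q = l) (h₃ : k + m = r) (h₄ : r + q = n) (i : Fin q) :
    iR h₁ (iR h₂ i) = iR h₄ i := by
  apply Fin.ext
  simp only [iR]
  omega

theorem iL_iL (h₁ : k + l = n) (h₃ : k + m = r) (h₄ : r + q = n) (i : Fin k) :
    iL h₁ i = iL h₄ (iL h₃ i) := rfl

theorem hblk_assoc (h₁ : k + l = n) (h₂ : m + q = l) (h₃ : k + m = r) (h₄ : r + q = n)
    (A : Herm k D) (B : Herm m D) (C : Herm q D) :
    hblk h₁ A 0 (hblk h₂ B 0 C) = hblk h₄ (hblk h₃ A 0 B) 0 C := by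
  have e₁ := iL_iL h₁ h₃ h₄
  have e₂ := iR_iL h₁ h₂ h₃ h₄
  have e₃ := iR_iR h₁ h₂ h₃ h₄
  have key : ∀ i j, (hblk h₁ A 0 (hblk h₂ B 0 C)).1 i j = (hblk h₄ (hblk h₃ A 0 B) 0 C).1 i j := by
    rw [forall_fin_block h₁]
    refine ⟨fun i => ?_, (forall_fin_block h₂).2 ⟨fun i => ?_, fun i => ?_⟩⟩ <;>
    · rw [forall_fin_block h₁]
      refine ⟨fun j => ?_, (forall_fin_block h₂).2 ⟨fun j => ?_, fun j => ?_⟩⟩ <;>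
      · conv_rhs => simp only [e₁, e₂, e₃]
        simp
  exact Subtype.ext (Matrix.ext key)

theorem pblk_assoc (h₁ : k + l = n) (h₂ : m + q = l) (h₃ : k + m = r) (h₄ : r + q = n)
    (P : Submodule ℝ (Matrix (Fin k) (Fin k) D)) (Q : Submodule ℝ (Matrix (Fin m) (Fin m) D))
    (R : Submodule ℝ (Matrix (Fin q) (Fin q) D)) :
    pblk h₁ P (pblk h₂ Q R) = pblk h₄ (pblk h₃ P Q) R := by
  have e₃ : iR h₁ ∘ iR h₂ = iR h₄ := funext (iR_iR h₁ h₂ h₃ h₄)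
  ext p
  constructor
  · rintro ⟨ha, ⟨hb, hc, hd⟩, he⟩
    rw [Matrix.submatrix_submatrix, e₃] at hc
    refine ⟨⟨ha, hb, ?_⟩, hc, ?_⟩
    · ext i j
      exact congrFun (congrFun he (iL h₂ i)) j
    · refine Matrix.ext fun i => (forall_fin_block h₃).2 ⟨fun j => ?_, fun j => ?_⟩
      · have := congrFun (congrFun he (iR h₂ i)) j
        rwa [Matrix.submatrix_apply, iR_iR h₁ h₂ h₃ h₄] at this
      · have := congrFun (congrFun hd i) j
        rwa [Matrix.submatrix_apply, Matrix.submatrix_apply, iR_iR h₁ h₂ h₃ h₄] at this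
  · rintro ⟨⟨ha, hb, hd⟩, hc, he⟩
    refine ⟨ha, ⟨hb, ?_, ?_⟩, ?_⟩
    · rwa [Matrix.submatrix_submatrix, e₃]
    · ext i j
      rw [Matrix.submatrix_apply, Matrix.submatrix_apply, iR_iR h₁ h₂ h₃ h₄]
      exact congrFun (congrFun he i) (iR h₃ j)
    · refine Matrix.ext ((forall_fin_block h₂).2 ⟨fun i j => ?_, fun i j => ?_⟩)
      · exact congrFun (congrFun hd i) j
      · rw [Matrix.submatrix_apply, iR_iR h₁ h₂ h₃ h₄]
        exact congrFun (congrFun he i) (iL h₃ j)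

/-! ### Standard representatives -/

/-- The standard representatives of the relevant orbits. -/
inductive Std : (n : ℕ) → Herm n D → Submodule ℝ (Matrix (Fin n) (Fin n) D) → Prop
  | empty (g : Herm 0 D) : Std 0 g ⊥
  | zero : Std 1 0 ⊥
  | block {k l n : ℕ} (h : k + l = n) (hk : 0 < k) {b : ℝ} (hb : b ≠ 0) {g : Herm l D}
      {P : Submodule ℝ (Matrix (Fin l) (Fin l) D)} (hg : Std l g P) :
      Std n (hblk h (wH k D b) 0 g) (pblk h (PW k D) P)

theorem hblk_right_empty (h : k + 0 = n) (h' : k = n) (A : Herm k D) (y) (g : Herm 0 D) :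
    hblk h A y g = h' ▸ A := by
  subst h'
  apply Subtype.ext
  ext i j
  exact mblk_LL (h := h) A.1 y yᴴ g.1 i j

theorem pblk_right_empty (h : k + 0 = k) (P : Submodule ℝ (Matrix (Fin k) (Fin k) D))
    (Q : Submodule ℝ (Matrix (Fin 0) (Fin 0) D)) : pblk h P Q = P := by
  ext p
  refine ⟨fun hp => hp.1, fun hp => ⟨hp, ?_, ?_⟩⟩
  · rw [Subsingleton.elim (p.submatrix _ _) 0]
    exact Q.zero_mem
  · ext i
    exact i.elim0

theorem Std.wH (hk : 0 < k) {b : ℝ} (hb : b ≠ 0) : Std k (wH k D b) (PW k D) := by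
  have h1 := Std.block (D := D) (add_zero k) hk hb (Std.empty 0)
  rwa [hblk_right_empty _ rfl, pblk_right_empty] at h1

theorem PW_one : PW 1 D = ⊥ :=
  (Submodule.eq_bot_iff _).2 fun p hp => by
    ext i j
    exact hp.1 i j (by rw [Fin.le_def]; omega)

variable [FiniteDimensional ℝ D] [IsQuadratic D] [Nontrivial D]

theorem wH_one (b : ℝ) : wH 1 D b = hreal b := by
  apply Subtype.ext
  ext i j
  rw [Subsingleton.elim i 0, Subsingleton.elim j 0, hreal_coe, wH_coe]
  rfl

theorem Std.diagA (a : Fin n → ℝˣ) : Std n (diagA (D := D) a) (sutP n D) := by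
  induction n with
  | zero =>
    rw [sutP_eq_bot (by omega)]
    exact Std.empty _
  | succ n ih =>
    have h : 1 + n = n + 1 := add_comm _ _
    have h1 := Std.block h one_pos (a (iL h 0)).ne_zero (ih fun i => a (iR h i))
    rwa [wH_one, PW_one, ← sutP_eq_bot le_rfl, pblk_sutP h,
      ← diagA_one (fun i => a (iL h i)), ← diagA_block] at h1

theorem Std.isChart {g : Herm n D} {P : Submodule ℝ (Matrix (Fin n) (Fin n) D)}
    (h : Std n g P) : IsChart g P := by
  induction h with
  | empty g => exact IsChart.trivial _ (by omega)
  | zero => exact IsChart.trivial _ le_rfl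
  | block h hk hb hg ih => exact IsChart.block h (IsChart.wH hb) ih (wH_mul_wH (inv_mul_cancel₀ hb))

theorem hblk_wH_diagA_inv (h : k + l = n) {b : ℝ} (hb : b ≠ 0) (a : Fin l → ℝˣ) :
    (hblk h (Kloosterman.wH k D b⁻¹) 0 (Kloosterman.diagA a⁻¹)).1 *
      (hblk h (Kloosterman.wH k D b) 0 (Kloosterman.diagA a)).1 = 1 := by
  rw [hblk_coe, hblk_coe, mblk_mul, wH_mul_wH (inv_mul_cancel₀ hb), diagA_inv]
  simp [mblk_one]

/-- Strong induction on the size, with θ free because a single block passes to -θ. For several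
blocks the first one is integrated out, and the induction hypothesis for the remaining ones reduces
the claim to first block plus diagonal matrix. -/
theorem Std.isLimit {θ : ℝ} (hθ : θ ≠ 0) {g : Herm n D}
    {P : Submodule ℝ (Matrix (Fin n) (Fin n) D)} (hg : Std n g P) : IsLimit θ g P := by
  induction n using Nat.strong_induction_on generalizing θ with
  | _ n ih =>
  intro Φ hΦ hreg
  cases hg with
  | empty g =>
    have h1 := hreg fun i => i.elim0
    rw [sutP_eq_bot (by omega)] at h1
    rw [← h1]
    congr 1
    apply Subtype.ext
    ext i
    exact i.elim0
  | zero =>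
    obtain ⟨c, hc, h1⟩ := exists_OI_bot θ (0 : Herm 1 D)
    rw [h1, hΦ.eq_zero_of_hreal (fun t ht => ?_), mul_zero]
    have h2 := hreg fun _ => Units.mk0 t ht
    obtain ⟨c', hc', h3⟩ := exists_OI_bot θ (hreal (D := D) t)
    rw [sutP_eq_bot le_rfl, diagA_one, Units.val_mk0, h3] at h2
    exact (mul_eq_zero.1 h2).resolve_left hc'
  | @block k l _ h hk b hb g P hg =>
    rcases l with _ | l
    · obtain rfl : k = n := h
      rw [hblk_right_empty _ rfl, pblk_right_empty]
      change OI θ (Kloosterman.wH k D b) (PW k D) Φ = 0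
      obtain ⟨m, rfl⟩ : ∃ m, k = m + 1 := ⟨k - 1, by omega⟩
      rcases Nat.eq_zero_or_pos m with rfl | hm
      · have h2 := hreg fun _ => Units.mk0 b hb
        rw [sutP_eq_bot le_rfl, diagA_one, Units.val_mk0] at h2
        rwa [PW_one, wH_one]
      · exact OI_wH_eq_zero rfl hm.ne' hθ hb
          (ih m (by omega) (neg_ne_zero.2 hθ) (Std.wH hm (inv_ne_zero hb))) hΦ hreg
    · have hwi := wH_mul_wH (k := k) (D := D) (inv_mul_cancel₀ hb)
      obtain ⟨c, hc, h1⟩ := exists_OI_block (h := h) (IsChart.wH hb) hwi hg.isChart θ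
      rw [h1 Φ hΦ, ih (l + 1) (by omega) hθ hg _ (IsSchwartz.MS (IsChart.wH hb) hwi θ hΦ), mul_zero]
      intro a
      obtain ⟨c', hc', h2⟩ := exists_OI_block (h := h) (IsChart.wH hb) hwi (IsChart.diagA a) θ
      refine (mul_eq_zero.1 ((h2 Φ hΦ).symm.trans ?_)).resolve_left hc'
      -- Regrouped so that only the last diagonal entry is split off, the matrix has an invertible
      -- standard part of size n - 1; induction and `MS_eq_zero` apply to it.
      have h4 : k + l + 1 = n := by omega
      have hs := Std.block (D := D) rfl hk hb (Std.diagA fun i => a (iL rfl i))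
      have hi := hblk_wH_diagA_inv (k := k) (D := D) rfl hb fun i : Fin l => a (iL rfl i)
      rw [diagA_block (rfl : l + 1 = l + 1), ← pblk_sutP (rfl : l + 1 = l + 1),
        hblk_assoc h rfl rfl h4, pblk_assoc h rfl rfl h4]
      obtain ⟨c'', -, h5⟩ := exists_OI_block (h := h4) hs.isChart hi
        (IsChart.diagA (D := D) fun i => a (iR rfl i)) θ
      rw [h5 Φ hΦ, OI]
      simp only [MS_eq_zero h4 hθ hs.isChart hi (ih (k + l) (by omega) hθ hs) hΦ hreg, zero_mul,
        integral_zero, mul_zero]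

end Standard

section Classification

variable {k l m n : ℕ} {D : Type*} [NormedCommRing D] [NormedAlgebra ℝ D]

/-! ### Classification of the relevant orbits -/

theorem IsUni.exists_inv {u : Matrix (Fin n) (Fin n) D} (hu : IsUni u) :
    ∃ v, IsUni v ∧ u * v = 1 ∧ v * u = 1 := by
  let U : unip n D := unipOf hu.isSUT
  have hU : U.1.val = u := add_sub_cancel _ _
  refine ⟨U.1⁻¹.val, isUni_coe U⁻¹, ?_, ?_⟩
  · rw [← hU, Units.mul_inv]
  · rw [← hU, Units.inv_mul]

theorem supdiag_add_supdiag_eq_zero {u v : Matrix (Fin n) (Fin n) D} (hu : IsUni u) (hv : IsUni v)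
    (h : u * v = 1) : supdiag u + supdiag v = 0 := by
  rw [← supdiag_mul hu hv, h, supdiag_one]

theorem eq_zero_of_expi_eq_one {θ s : ℝ} (hθ : θ ≠ 0) (h : ∀ t : ℝ, expi θ (t * s) = 1) :
    s = 0 := by
  by_contra hs
  -- At this parameter the exponential equals exp(iπ) = -1.
  have h1 := h (Real.pi * (θ * s)⁻¹)
  have h2 : ((θ : ℂ) * ((Real.pi * (θ * s)⁻¹ * s : ℝ) : ℂ) * Complex.I) = Real.pi * Complex.I := by
    congr 1
    rw [← Complex.ofReal_mul]
    congr 1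
    field_simp
  rw [expi, h2, Complex.exp_pi_mul_I] at h1
  norm_num at h1

theorem supdiag_single_mul (G : Matrix (Fin n) (Fin n) D) {a a' : Fin n} (b : Fin n)
    (ha : (a : ℕ) + 1 = a') (d : D) :
    supdiag (Matrix.single a b d * G) = Algebra.trace ℝ D (d * G b a') := by
  rw [supdiag_apply, Finset.sum_eq_single a, Finset.sum_eq_single a', if_pos ha]
  · rw [Matrix.single_mul_apply_same]
  · intro j _ hj
    rw [if_neg]
    rintro h
    exact hj (Fin.ext (by omega))
  · simp
  · intro i _ hi
    refine Finset.sum_eq_zero fun j _ => ?_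
    rw [Matrix.single_mul_apply_of_ne _ _ _ _ _ hi]
    simp
  · simp

variable [StarRing D] [StarModule ℝ D]

/-- The relevant matrices. -/
def IsRel (θ : ℝ) (g : Herm n D) : Prop :=
  ∀ u, IsUni u → hact u g = g → expi θ (supdiag u) = 1

theorem IsRel.orbit {θ : ℝ} {g : Herm n D} (hg : IsRel θ g) {u : Matrix (Fin n) (Fin n) D}
    (hu : IsUni u) : IsRel θ (hact u g) := by
  intro w hw hwg
  obtain ⟨v, hv, huv, -⟩ := hu.exists_inv
  have h1 := hg (u * w * v) ((hu.mul hw).mul hv) (by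
    rw [hact_mul, hact_mul, hwg, ← hact_mul, huv, hact_one])
  have h2 := supdiag_add_supdiag_eq_zero hu hv huv
  rw [supdiag_mul (hu.mul hw) hv, supdiag_mul hu hw] at h1
  rwa [show supdiag w = supdiag u + supdiag w + supdiag v by linarith]

/-- The Cayley transform gives elements of the stabilizer. -/
theorem IsRel.supdiag_mul_eq_zero {θ : ℝ} (hθ : θ ≠ 0) {g : Herm n D} (hg : IsRel θ g)
    {K : Matrix (Fin n) (Fin n) D} (hK : Kᴴ = -K) (hs : IsSUT (K * g.1)) :
    supdiag (K * g.1) = 0 := by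
  have key : ∀ t : ℝ, expi θ (t * (2 * supdiag (K * g.1))) = 1 := by
    intro t
    set X := t • (K * g.1) with hX
    have hXs : IsSUT X := fun i j hij => by rw [hX, Matrix.smul_apply, hs i j hij, smul_zero]
    have hXn : IsSUT (-X) := fun i j hij => by rw [Matrix.neg_apply, hXs i j hij, neg_zero]
    have h1 := isUni_one_add_iff.2 hXs
    have h2 := isUni_one_add_iff.2 hXn
    obtain ⟨V, hV, hV1, -⟩ := h2.exists_inv
    -- `X` lies in the Lie algebra of the stabilizer of `g`, so (1 + X)(1 - X)⁻¹ stabilizes `g`; its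
    -- superdiagonal sum is twice that of `X`.
    have hGX : Xᴴ * g.1 = -(g.1 * X) := by
      rw [hX, Matrix.conjTranspose_smul, Matrix.conjTranspose_mul, conjT, hK, star_trivial,
        Matrix.smul_mul, Matrix.mul_smul, Matrix.mul_neg, Matrix.neg_mul, Matrix.mul_assoc, smul_neg]
    have e1 : g.1 * (1 + X) = (1 + -X)ᴴ * g.1 := by
      rw [Matrix.conjTranspose_add, Matrix.conjTranspose_one, Matrix.conjTranspose_neg,
        Matrix.add_mul, Matrix.neg_mul, hGX, neg_neg, Matrix.mul_add, Matrix.mul_one,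
        Matrix.one_mul]
    have e2 : (1 + X)ᴴ * g.1 = g.1 * (1 + -X) := by
      rw [Matrix.conjTranspose_add, Matrix.conjTranspose_one, Matrix.add_mul, hGX, Matrix.mul_add,
        Matrix.mul_neg, Matrix.mul_one, Matrix.one_mul]
    have e3 : (1 + -X) * (1 + X) = (1 + X) * (1 + -X) := by noncomm_ring
    have h3 := hg ((1 + X) * V) (h1.mul hV) (Subtype.ext (by
      rw [hact_coe, Matrix.conjTranspose_mul]
      calc Vᴴ * (1 + X)ᴴ * g.1 * ((1 + X) * V)
          = Vᴴ * ((1 + X)ᴴ * g.1) * ((1 + X) * V) := by simp only [Matrix.mul_assoc]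
        _ = Vᴴ * g.1 * ((1 + -X) * (1 + X)) * V := by rw [e2]; simp only [Matrix.mul_assoc]
        _ = Vᴴ * (g.1 * (1 + X)) * ((1 + -X) * V) := by rw [e3]; simp only [Matrix.mul_assoc]
        _ = ((1 + -X) * V)ᴴ * g.1 := by
          rw [hV1, e1, Matrix.mul_one, ← Matrix.mul_assoc, ← Matrix.conjTranspose_mul, hV1]
        _ = g.1 := by rw [hV1, Matrix.conjTranspose_one, Matrix.one_mul]))
    have h4 := supdiag_add_supdiag_eq_zero h2 hV hV1
    rw [supdiag_mul h1 hV] at h3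
    have h5 : supdiag X = t * supdiag (K * g.1) := by rw [hX, map_smul, smul_eq_mul]
    rw [← h3]
    congr 1
    rw [map_add, supdiag_one, zero_add, map_neg, h5] at h4
    rw [map_add, supdiag_one, zero_add, h5]
    linarith
  have := eq_zero_of_expi_eq_one hθ key
  linarith

variable [FiniteDimensional ℝ D] [IsQuadratic D] [Nontrivial D]

theorem star_herm_apply (g : Herm n D) (i j : Fin n) : star (g.1 i j) = g.1 j i :=
  congrFun (congrFun (conjT g) j) i

/-- The skew-hermitian matrix with entries d and -star d at (a, b) and (b, a) is a test element: the
vanishing of `g` above the line i + j = s makes its product with `g` strictly upper triangular, and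
the superdiagonal pairs d with the difference of two neighbouring entries on that line.
Non-degeneracy of the trace form concludes. -/
theorem IsRel.apply_eq {θ : ℝ} (hθ : θ ≠ 0) {g : Herm n D} (hg : IsRel θ g) {s : ℕ}
    (hz : ∀ i j : Fin n, (i : ℕ) + j < s → g.1 i j = 0) {a b a' b' : Fin n}
    (ha : (a : ℕ) + 1 = a') (hb : (b : ℕ) + 1 = b') (hab : (a : ℕ) + b + 1 = s) :
    g.1 b a' = g.1 b' a := by
  rw [← sub_eq_zero]
  refine IsQuadratic.eq_zero_of_trace _ fun d => ?_
  have h1 := hg.supdiag_mul_eq_zero hθ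
    (K := Matrix.single a b d - Matrix.single b a (star d)) (by
      rw [Matrix.conjTranspose_sub, Matrix.conjTranspose_single, Matrix.conjTranspose_single,
        star_star, neg_sub]) (by
      have h2 : ∀ (a b : Fin n) (d : D), (a : ℕ) + b + 1 = s →
          IsSUT (Matrix.single a b d * g.1) := by
        intro a b d hab i j hij
        by_cases hi : i = a
        · rw [hi, Matrix.single_mul_apply_same, hz b j, mul_zero]
          rw [hi, Fin.le_def] at hij
          omega
        · exact Matrix.single_mul_apply_of_ne _ _ _ _ _ hi _
      intro i j hij
      rw [Matrix.sub_mul, Matrix.sub_apply, h2 a b d hab i j hij, h2 b a _ (by omega) i j hij,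
        sub_zero])
  rw [Matrix.sub_mul, map_sub, supdiag_single_mul _ _ ha, supdiag_single_mul _ _ hb,
    ← trace_star (star d * _), star_mul, star_star, star_herm_apply, mul_comm d, ← map_sub,
    ← sub_mul] at h1
  exact h1

theorem IsRel.apply_eq_first {θ : ℝ} (hθ : θ ≠ 0) {g : Herm n D} (hg : IsRel θ g) {s : ℕ}
    (hs : s < n) (hz : ∀ i j : Fin n, (i : ℕ) + j < s → g.1 i j = 0) (i j : Fin n)
    (hij : (i : ℕ) + j = s) : g.1 i j = g.1 ⟨0, by omega⟩ ⟨s, hs⟩ := by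
  obtain ⟨i, hi⟩ := i
  induction i generalizing j with
  | zero =>
    exact congrArg (g.1 ⟨0, hi⟩) (Fin.ext (by simpa using hij))
  | succ i ih =>
    simp only at hij
    rw [← ih ⟨j + 1, by omega⟩ (by omega) (by simp only; omega)]
    exact (hg.apply_eq hθ hz (a := j) (b := ⟨i, by omega⟩) rfl rfl
      (by simp only; omega)).symm

/-- All entries on the first antidiagonal line not yet known to vanish are equal, so a zero in the
first row kills the whole line; this is repeated line by line. -/
theorem IsRel.apply_eq_zero {θ : ℝ} (hθ : θ ≠ 0) {g : Herm n D} (hg : IsRel θ g) {m : ℕ}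
    (hm : m < n) (hz : ∀ j : Fin n, (j : ℕ) < m → g.1 ⟨0, by omega⟩ j = 0) (i j : Fin n)
    (hij : (i : ℕ) + j < m) : g.1 i j = 0 := by
  have key : ∀ s ≤ m, ∀ i j : Fin n, (i : ℕ) + j < s → g.1 i j = 0 := by
    intro s
    induction s with
    | zero => intro _ i j hij; omega
    | succ s ih =>
      intro hs i j hij
      rcases Nat.lt_succ_iff_lt_or_eq.1 hij with h | h
      · exact ih (by omega) i j h
      · rw [hg.apply_eq_first hθ (by omega) (ih (by omega)) i j h]
        exact hz _ (by simp only; omega)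
  exact key m le_rfl i j hij

/-- If the first row and column vanish, every 1 + t E with E the matrix unit at (0, 1) stabilizes
`g`, while the character takes the value exp(2iθt) there. -/
theorem IsRel.exists_ne_zero {θ : ℝ} (hθ : θ ≠ 0) {g : Herm n D} (hg : IsRel θ g) (hn : 2 ≤ n) :
    ∃ j, g.1 ⟨0, by omega⟩ j ≠ 0 := by
  by_contra! h
  have hr : ∀ j, g.1 j ⟨0, by omega⟩ = 0 := fun j => by
    rw [← star_herm_apply, h, star_zero]
  have key : ∀ t : ℝ, expi θ (t * 2) = 1 := by
    intro t
    let X : Matrix (Fin n) (Fin n) D :=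
      Matrix.single ⟨0, by omega⟩ ⟨1, by omega⟩ (algebraMap ℝ D t)
    have hX : IsSUT X := fun i j hij => by
      refine Matrix.single_apply_of_ne _ _ _ _ _ ?_
      rintro ⟨rfl, rfl⟩
      rw [Fin.le_def] at hij
      simp at hij
    have h1 : g.1 * X = 0 := by
      ext i j
      rw [Matrix.mul_apply]
      refine Finset.sum_eq_zero fun r _ => ?_
      by_cases hr0 : (⟨0, by omega⟩ : Fin n) = r
      · rw [← hr0, hr, zero_mul]
      · exact mul_eq_zero_of_right _ (Matrix.single_apply_of_row_ne hr0 _ _ _)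
    have h2 : Xᴴ * g.1 = 0 := by
      rw [← conjT g, ← Matrix.conjTranspose_mul, h1, Matrix.conjTranspose_zero]
    have h3 := hg (1 + X) (isUni_one_add_iff.2 hX) (Subtype.ext (by
      rw [hact_coe, Matrix.mul_assoc, Matrix.mul_add, h1, add_zero, Matrix.mul_one,
        Matrix.conjTranspose_add, Matrix.add_mul, h2, Matrix.conjTranspose_one, Matrix.one_mul,
        add_zero]))
    rw [map_add, supdiag_one, zero_add, ← Matrix.mul_one X,
      supdiag_single_mul (a' := ⟨1, by omega⟩) _ _ rfl, Matrix.one_apply_eq, mul_one,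
      trace_algebraMap, mul_comm] at h3
    exact h3
  have := eq_zero_of_expi_eq_one hθ key
  norm_num at this

/-- A relevant matrix whose first non-zero entry is in column `k - 1` splits. -/
theorem IsRel.exists_block {θ : ℝ} (hθ : θ ≠ 0) {g : Herm n D} (hg : IsRel θ g) {m : ℕ}
    (hm : m < n) (hz : ∀ j : Fin n, (j : ℕ) < m → g.1 ⟨0, by omega⟩ j = 0)
    (hne : g.1 ⟨0, by omega⟩ ⟨m, hm⟩ ≠ 0) (h : m + 1 + l = n) :
    ∃ b : ℝ, b ≠ 0 ∧ ∃ (c : Herm l D) (u : Matrix (Fin n) (Fin n) D), IsUni u ∧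
      g = hact u (hblk h (wH (m + 1) D b) 0 c) := by
  have hz' := hg.apply_eq_zero hθ hm hz
  -- The entries at (0, m) and (m, 0) are conjugate to each other and lie on the same line i + j =
  -- m, hence are equal; so their common value is real.
  have hst : star (g.1 ⟨0, by omega⟩ ⟨m, hm⟩) = g.1 ⟨0, by omega⟩ ⟨m, hm⟩ := by
    rw [star_herm_apply, hg.apply_eq_first hθ hm hz' ⟨m, hm⟩ ⟨0, by omega⟩ rfl]
  set b := 2⁻¹ * Algebra.trace ℝ D (g.1 ⟨0, by omega⟩ ⟨m, hm⟩) with hbdef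
  have hb' : algebraMap ℝ D b = g.1 ⟨0, by omega⟩ ⟨m, hm⟩ := algebraMap_of_star_eq hst
  have hb : b ≠ 0 := fun h0 => hne (by rw [← hb', h0, map_zero])
  obtain ⟨s, y, c, rfl⟩ := exists_hblk h g
  have hs : ∀ i j, s.1 i j = (hblk h s y c).1 (iL h i) (iL h j) := fun i j => by
    rw [hblk_coe, mblk_LL]
  obtain ⟨hp, hps⟩ := exists_mem_PW (A := b⁻¹ • s.1 - wmat (m + 1) D) (fun i j hij => by
    rw [Matrix.sub_apply, Matrix.smul_apply, hs, wmat]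
    rcases Nat.lt_succ_iff_lt_or_eq.1 hij with h1 | h1
    · rw [hz' _ _ h1, if_neg, smul_zero, sub_zero]
      rw [Fin.ext_iff, Fin.val_rev]
      omega
    · rw [hg.apply_eq_first hθ hm hz' _ _ h1, if_pos, ← hb', Algebra.algebraMap_eq_smul_one,
        smul_smul, inv_mul_cancel₀ hb, one_smul, sub_self]
      rw [Fin.ext_iff, Fin.val_rev]
      omega) (by
    rw [Matrix.conjTranspose_sub, Matrix.conjTranspose_smul, conjT, wmat_conjTranspose,
      star_trivial]) b
  set p := wmat (m + 1) D * wsol (b⁻¹ • s.1 - wmat (m + 1) D) (m + 1)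
  have hu : IsUni (1 + p) := isUni_one_add_iff.2 hp.1
  obtain ⟨V, hV, hV1, hV2⟩ := hu.exists_inv
  -- Block elimination: `v` solves (1 + p)ᴴ (b w) v = y.
  let v := (wH (m + 1) D b⁻¹).1 * (Vᴴ * y)
  refine ⟨b, hb, c - hact v (wH (m + 1) D b), mblk h (1 + p) v 0 1, hu.mblk IsUni.one _, ?_⟩
  rw [hact_mblk, hact_one, add_sub_cancel]
  congr 1
  · apply Subtype.ext
    rw [hps, add_sub_cancel, smul_smul, mul_inv_cancel₀ hb, one_smul]
  · change y = (1 + p)ᴴ * (wH (m + 1) D b).1 * ((wH (m + 1) D b⁻¹).1 * (Vᴴ * y))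
    rw [Matrix.mul_assoc, ← Matrix.mul_assoc (wH (m + 1) D b).1, wH_mul_wH (mul_inv_cancel₀ hb),
      Matrix.one_mul, ← Matrix.mul_assoc, ← Matrix.conjTranspose_mul, hV2,
      Matrix.conjTranspose_one, Matrix.one_mul]

/-- The position of the first non-zero entry of the first row determines the size of the leading
block, which is split off. A zero first row is possible only in size one, which gives the zero
block. -/
theorem IsRel.exists_std {θ : ℝ} (hθ : θ ≠ 0) {g : Herm n D} (hg : IsRel θ g) :
    ∃ u, IsUni u ∧ ∃ P, Std n (Kloosterman.hact u g) P := by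
  induction n using Nat.strong_induction_on with
  | _ n ih =>
  rcases Nat.eq_zero_or_pos n with rfl | hn
  · exact ⟨1, IsUni.one, ⊥, Std.empty _⟩
  by_cases h0 : ∃ m : ℕ, ∃ hm : m < n, g.1 ⟨0, hn⟩ ⟨m, hm⟩ ≠ 0
  · classical
    obtain ⟨m, ⟨hm, hne⟩, hmin⟩ : ∃ m, (∃ hm : m < n, g.1 ⟨0, hn⟩ ⟨m, hm⟩ ≠ 0) ∧
        ∀ j < m, ¬∃ hm : j < n, g.1 ⟨0, hn⟩ ⟨j, hm⟩ ≠ 0 :=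
      ⟨Nat.find h0, Nat.find_spec h0, fun j => Nat.find_min h0⟩
    have hz : ∀ j : Fin n, (j : ℕ) < m → g.1 ⟨0, hn⟩ j = 0 := fun j hj => by
      by_contra hj0
      exact hmin j hj ⟨j.2, hj0⟩
    have h : m + 1 + (n - (m + 1)) = n := by omega
    obtain ⟨b, hb, c, u, hu, hgu⟩ := hg.exists_block hθ hm hz hne h
    obtain ⟨v, hv, huv, -⟩ := hu.exists_inv
    have hg' := hg.orbit hv
    rw [hgu, ← hact_mul, huv, hact_one] at hg'
    -- The complementary block is again relevant: if `w` stabilizes it, 1 ⊕ w stabilizes the sum and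
    -- has the same superdiagonal sum.
    obtain ⟨w, hw, P, hP⟩ := ih (n - (m + 1)) (by omega) (g := c) (fun w hw hwc => by
      have h1 := hg' (mblk h 1 0 0 w) (IsUni.one.mblk hw 0) (by
        rw [hact_mblk, hact_one, hact_zero, Matrix.mul_zero, hwc, zero_add])
      rwa [supdiag_mblk, supdiag_one, map_zero, zero_add, zero_add] at h1)
    refine ⟨v * mblk h 1 0 0 w, hv.mul (IsUni.one.mblk hw 0), pblk h (PW (m + 1) D) P, ?_⟩
    rw [hgu, hact_mul, ← hact_mul u, huv, hact_one, hact_mblk, hact_one, hact_zero, Matrix.mul_zero,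
      zero_add]
    exact Std.block h (Nat.succ_pos m) hb hP
  · push Not at h0
    obtain rfl : n = 1 := by
      by_contra hn1
      obtain ⟨j, hj⟩ := hg.exists_ne_zero hθ (by omega)
      exact hj (h0 j j.2)
    refine ⟨1, IsUni.one, ⊥, ?_⟩
    rw [hact_one]
    have : g = 0 := Subtype.ext (by
      ext i j
      rw [Subsingleton.elim i 0]
      exact h0 j j.2)
    rw [this]
    exact Std.zero

end Classification

/-! ### Characters of the real line -/

/-- A continuous unitary character of the real line is of the form `t ↦ exp (iθt)`. -/
theorem exists_eq_expi {ψ : AddChar ℝ Circle} (hψ : Continuous ψ) :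
    ∃ θ : ℝ, ∀ t, (ψ t : ℂ) = expi θ t := by
  let f : ℝ → ℂ := fun t => ψ t
  have hf : Continuous f := continuous_subtype_val.comp hψ
  have hadd : ∀ x y, f (x + y) = f x * f y := fun x y => by
    simp only [f, AddChar.map_add_eq_mul, Circle.coe_mul]
  have h0 : f 0 = 1 := by simp only [f, AddChar.map_zero_eq_one, Circle.coe_one]
  -- Integrating f(x + t) = f(x) f(t) over t from 0 to a expresses the merely continuous `f` through
  -- its primitive `F`; hence `f` is differentiable and solves f' = z f.
  let F : ℝ → ℂ := fun x => ∫ t in (0 : ℝ)..x, f t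
  have hF : ∀ x, HasDerivAt F (f x) x := fun x =>
    intervalIntegral.integral_hasDerivAt_right (hf.intervalIntegrable _ _)
      (hf.stronglyMeasurableAtFilter _ _) hf.continuousAt
  obtain ⟨a, ha⟩ : ∃ a, F a ≠ 0 := by
    by_contra! h
    have h1 := hF 0
    rw [show F = fun _ => 0 from funext h, h0] at h1
    exact zero_ne_one ((hasDerivAt_const (0 : ℝ) (0 : ℂ)).unique h1)
  have hfF : ∀ x, f x = (F (x + a) - F x) * (F a)⁻¹ := by
    intro x
    rw [eq_mul_inv_iff_mul_eq₀ ha, intervalIntegral.integral_interval_sub_left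
      (hf.intervalIntegrable _ _) (hf.intervalIntegrable _ _), ← intervalIntegral.integral_const_mul]
    simp only [← hadd]
    rw [intervalIntegral.integral_comp_add_left, add_zero]
  set z : ℂ := (f a - 1) * (F a)⁻¹
  have hd : ∀ x, HasDerivAt f (f x * z) x := by
    intro x
    have h1 := (((hF (x + a)).comp_add_const x a).sub (hF x)).mul_const (F a)⁻¹
    rw [hadd] at h1
    have h2 : f x * z = (f x * f a - f x) * (F a)⁻¹ := by ring
    rw [h2]
    exact h1.congr_of_eventuallyEq (.of_forall hfF)
  have hg : ∀ x : ℝ, HasDerivAt (fun x : ℝ => f x * Complex.exp (-(x * z))) 0 x := by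
    intro x
    have h1 : HasDerivAt (fun x : ℝ => Complex.exp (-((x : ℂ) * z)))
        (Complex.exp (-(x * z)) * -(1 * z)) x :=
      (((Complex.ofRealCLM.hasDerivAt (x := x)).mul_const z).neg).cexp
    have h2 := (hd x).mul h1
    have h3 : f x * z * Complex.exp (-(x * z)) + f x * (Complex.exp (-(x * z)) * -(1 * z)) = 0 := by
      ring
    rwa [h3] at h2
  have hc : ∀ x : ℝ, f x = Complex.exp (x * z) := by
    intro x
    have h1 := is_const_of_deriv_eq_zero (fun x => (hg x).differentiableAt) (fun x => (hg x).deriv) x 0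
    simp only [h0, Complex.ofReal_zero, zero_mul, neg_zero, Complex.exp_zero, mul_one] at h1
    rw [← mul_one (f x), ← Complex.exp_zero, ← neg_add_cancel ((x : ℂ) * z), Complex.exp_add,
      ← mul_assoc, h1, one_mul]
  have hre : z.re = 0 := by
    have h1 := hc 1
    have h2 : ‖f 1‖ = 1 := Circle.norm_coe _
    rw [h1, Complex.norm_exp, Complex.ofReal_one, one_mul, Real.exp_eq_one_iff] at h2
    exact h2
  refine ⟨z.im, fun t => (hc t).trans ?_⟩
  rw [expi]
  congr 1
  rw [show z = z.im * Complex.I from Complex.ext (by simp [hre]) (by simp)]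
  simp only [Complex.mul_im, Complex.ofReal_re, Complex.I_im, mul_one, Complex.ofReal_im,
    Complex.I_re, mul_zero, add_zero]
  ring

/-! ### Spans of functionals -/

/-- A linear functional that vanishes on the common kernel of a family of functionals is in the
closure of the span of the family for the topology of pointwise convergence. -/
theorem mem_closure_span_of_forall {E ι : Type*} [AddCommGroup E] [Module ℂ E] (L : ι → E →ₗ[ℂ] ℂ)
    (T : E →ₗ[ℂ] ℂ) (h : ∀ x, (∀ i, L i x = 0) → T x = 0) :
    (fun x => T x) ∈
      closure (Submodule.span ℂ (Set.range fun i x => L i x) : Set (E → ℂ)) := by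
  classical
  rw [mem_closure_iff]
  intro o ho hT
  obtain ⟨I, u, hu, huo⟩ := isOpen_pi_iff.1 ho _ hT
  let R : (E → ℂ) →ₗ[ℂ] (I → ℂ) := LinearMap.funLeft ℂ ℂ Subtype.val
  -- Otherwise a linear form φ on the finitely many coordinates kills the span but not `T`. It acts
  -- on linear functionals as evaluation at a single vector, at which all `L i` vanish and `T` does
  -- not.
  have key : R (fun x => T x) ∈ (Submodule.span ℂ (Set.range fun i x => L i x)).map R := by
    by_contra hn
    obtain ⟨φ, hφ, hle⟩ := Submodule.exists_le_ker_of_notMem hn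
    have hsum : ∀ S : E →ₗ[ℂ] ℂ, φ (R fun x => S x) =
        S (∑ i : I, φ (Pi.single i 1) • i.1) := by
      intro S
      rw [LinearMap.pi_apply_eq_sum_univ φ, _root_.map_sum]
      refine Finset.sum_congr rfl fun i _ => ?_
      rw [map_smul, smul_eq_mul, smul_eq_mul, mul_comm]
      congr 2
      funext j
      simp [Pi.single_apply, eq_comm]
    refine hφ ?_
    rw [hsum]
    refine h _ fun i => ?_
    rw [← hsum]
    exact hle (Submodule.mem_map_of_mem (Submodule.subset_span ⟨i, rfl⟩))
  obtain ⟨f, hf, hfT⟩ := key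
  refine ⟨f, huo fun x hx => ?_, hf⟩
  have h1 : f x = T x := congrFun hfT ⟨x, hx⟩
  rw [h1]
  exact (hu x hx).2

/-! ### Functions that are Schwartz along the fibres of a map -/

section Along

variable {E F : Type*} [NormedAddCommGroup E] [NormedSpace ℝ E] [NormedAddCommGroup F]
  [NormedSpace ℝ F]

theorem IsSchwartzOn.add {U : Set E} {f g : E → ℂ} (hf : IsSchwartzOn U f)
    (hg : IsSchwartzOn U g) : IsSchwartzOn U fun x => f x + g x := by
  obtain ⟨φ, h1, h2⟩ := hf
  obtain ⟨χ, h3, h4⟩ := hg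
  refine ⟨φ + χ, fun x hx => by rw [_root_.add_apply, h1 x hx, h3 x hx], fun x hx k => ?_⟩
  rw [show ((φ + χ : SchwartzMap E ℂ) : E → ℂ) = ⇑φ + ⇑χ from rfl,
    iteratedFDeriv_add_apply (φ.smooth k).contDiffAt (χ.smooth k).contDiffAt, h2 x hx, h4 x hx,
    add_zero]

theorem IsSchwartzOn.const_smul {U : Set E} {f : E → ℂ} (hf : IsSchwartzOn U f) (c : ℂ) :
    IsSchwartzOn U fun x => c * f x := by
  obtain ⟨φ, h1, h2⟩ := hf
  refine ⟨c • φ, fun x hx => by rw [_root_.smul_apply, h1 x hx, smul_eq_mul],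
    fun x hx k => ?_⟩
  rw [show ((c • φ : SchwartzMap E ℂ) : E → ℂ) = c • ⇑φ from rfl,
    iteratedFDeriv_const_smul_apply (φ.smooth k).contDiffAt, h2 x hx, smul_zero]

/-- The space of functions that are Schwartz along the fibres of `p`. -/
def schwartzAlong (p : E → F) (V : Set F) : Submodule ℂ (E → ℂ) where
  carrier := {f | SchwartzAlong p V f}
  add_mem' hf hg := ⟨hf.smooth.add hg.smooth, fun h hh => by
    simpa only [Pi.add_apply, mul_add] using (hf.schwartz h hh).add (hg.schwartz h hh)⟩
  zero_mem' := ⟨contDiffOn_const, fun h hh => ⟨0, fun x _ => by simp, fun x _ k => by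
    rw [show ((0 : SchwartzMap E ℂ) : E → ℂ) = fun _ => 0 from rfl]
    simp⟩⟩
  smul_mem' c f hf := ⟨contDiffOn_const.smul hf.smooth, fun h hh => by
    simpa only [Pi.smul_apply, smul_eq_mul, mul_left_comm] using
      (hf.schwartz h hh).const_smul c⟩

theorem exists_isSchwartzOn [FiniteDimensional ℝ F] {V : Set F} (hV : IsOpen V) {r : F}
    (hr : r ∈ V) : ∃ h : F → ℂ, IsSchwartzOn V h ∧ h r = 1 := by
  obtain ⟨f, h1, h2, h3, -, h4⟩ := exists_contDiff_tsupport_subset (n := ⊤) (hV.mem_nhds hr)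
  have hs : Function.support (fun x => (f x : ℂ)) ⊆ Function.support f := fun x hx hx' =>
    hx (by simp only [hx', Complex.ofReal_zero])
  have hc : HasCompactSupport fun x => (f x : ℂ) := h2.comp_left Complex.ofReal_zero
  have hd : ContDiff ℝ ∞ fun x => (f x : ℂ) := Complex.ofRealCLM.contDiff.comp h3
  refine ⟨fun x => f x, ⟨hc.toSchwartzMap hd, fun x _ => rfl, fun x hx k => ?_⟩, by simp [h4]⟩
  by_contra hne
  exact hx (h1 (closure_mono hs (support_iteratedFDeriv_subset k hne)))

/-- Functions that are Schwartz along the fibres are Schwartz functions locally on the base. -/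
theorem exists_isSchwartz_of_mem_schwartzAlong [FiniteDimensional ℝ F] {p : E → F} {V : Set F}
    (hV : IsOpen V) {r : F} (hr : r ∈ V) : ∃ h : F → ℂ, h r = 1 ∧ ∀ f ∈ schwartzAlong p V,
      ∃ φ : E → ℂ, IsSchwartz φ ∧ ∀ x, p x ∈ V → φ x = h (p x) * f x := by
  obtain ⟨h, hh, h1⟩ := exists_isSchwartzOn hV hr
  refine ⟨h, h1, fun f hf => ?_⟩
  obtain ⟨φ, h2, -⟩ := hf.schwartz h hh
  exact ⟨φ, ⟨φ, rfl⟩, h2⟩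

end Along

section Final

variable {n : ℕ} {D : Type*} [NormedCommRing D] [NormedAlgebra ℝ D] [StarRing D]
  [StarModule ℝ D]

/-! ### Density of the regular orbital integrals -/

/-- An element d of the radical of the trace form has star d = -d, and the trace of d² is zero; the
trace identity for d² then reads 2 d² = 0, so d = 0 in a reduced algebra. -/
theorem isQuadratic_of_finrank_eq_two [IsReduced D] (hD : Module.finrank ℝ D = 2)
    (hstar : ∃ d : D, star d ≠ d) : IsQuadratic D where
  algebraMap_trace := algebraMap_trace hD hstar
  eq_zero_of_trace d hd := by
    have : Nontrivial D := Module.nontrivial_of_finrank_pos (R := ℝ) (by omega)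
    have h1 : star d = -d := by
      have h2 := algebraMap_trace hD hstar d
      rw [← mul_one d, hd, mul_one, map_zero] at h2
      exact (neg_eq_of_add_eq_zero_right h2.symm).symm
    have h2 : d * d = 0 := by
      have h3 := algebraMap_trace hD hstar (d * d)
      rw [hd, map_zero, star_mul, h1, neg_mul_neg, ← two_mul] at h3
      have h4 : d * d = (2⁻¹ : ℝ) • (2 * (d * d)) := by
        rw [two_mul, ← two_smul ℝ, smul_smul, inv_mul_cancel₀ two_ne_zero, one_smul]
      rw [h4, ← h3, smul_zero]
    exact IsReduced.eq_zero d ⟨2, by rw [pow_two, h2]⟩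

theorem detR_act (u : unip n D) (x : Herm n D) : detR (act u x) = detR x := by
  have hu := (isUni_coe u).det_eq_one
  rw [detR, detR, act_eq_hact, hact_coe, Matrix.det_mul, Matrix.det_mul, Matrix.det_conjTranspose,
    hu, star_one, one_mul, mul_one]

variable [FiniteDimensional ℝ D] [IsQuadratic D] [Nontrivial D]

theorem detR_diagA_ne_zero (a : Fin n → ℝˣ) : detR (diagA (D := D) a) ≠ 0 := by
  have : (diagA (D := D) a).1.det = algebraMap ℝ D (∏ i, (a i : ℝ)) := by
    rw [_root_.map_prod]
    exact Matrix.det_diagonal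
  rw [detR, this, trace_algebraMap, mul_div_cancel_left₀ _ two_ne_zero]
  exact Finset.prod_ne_zero_iff.2 fun i _ => (a i).ne_zero

variable {ψ : AddChar ℝ Circle} {θ : ℝ}

theorem isRel_of_isRelevant (hψ : ∀ t, (ψ t : ℂ) = expi θ t) {g : Herm n D}
    (hg : IsRelevant ψ g) : IsRel θ g := by
  intro u hu hug
  have h1 := hg (unipOf hu.isSUT) (by
    change act (unipOf hu.isSUT) g = g
    rw [act_eq_hact, unipOf_coe, add_sub_cancel, hug])
  have h2 := chi_unipOf hψ hu.isSUT
  rw [h1, map_sub, supdiag_one, sub_zero, Circle.coe_one] at h2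
  exact h2.symm

/-- Integrals over an orbit in terms of Schwartz functions. -/
theorem OI_congr {g : Herm n D} {P : Submodule ℝ (Matrix (Fin n) (Fin n) D)} (hc : IsChart g P)
    {V : Set ℝ} (hgV : detR g ∈ V) {Φ φ : Herm n D → ℂ} {h : ℝ → ℂ}
    (hφ : ∀ x, detR x ∈ V → φ x = h (detR x) * Φ x) (p : P) :
    φ (hact (1 + p.1) g) = h (detR g) * Φ (hact (1 + p.1) g) := by
  have h1 : detR (hact (1 + p.1) g) = detR g := detR_act (unipOf (hc.sut p.1 p.2)) g
  rw [hφ _ (by rwa [h1]), h1]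

variable {V : Set ℝ}

theorem integrable_OI_diagA (hV : IsOpen V) (hV0 : {0}ᶜ ⊆ V) {Φ : Herm n D → ℂ} (hΦ : Φ ∈ schwartzAlong (E := Herm n D) detR V)
    (a : Fin n → ℝˣ) : Integrable (fun p : sutP n D =>
      Φ (hact (1 + p.1) (diagA a)) * expi θ (supdiag p.1)) addHaar := by
  have ha : detR (diagA (D := D) a) ∈ V := hV0 (detR_diagA_ne_zero a)
  obtain ⟨h, h1, h2⟩ := exists_isSchwartz_of_mem_schwartzAlong (E := Herm n D) (p := detR) hV ha
  obtain ⟨φ, hφ, h3⟩ := h2 Φ hΦ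
  have h4 := ((IsChart.diagA (D := D) a).isSchwartz θ hφ).integrable_addHaar
  simpa only [OI_congr (IsChart.diagA a) ha h3, h1, one_mul] using h4

/-- The regular integral as a functional. -/
noncomputable def regularFunctional (hV : IsOpen V) (hV0 : {0}ᶜ ⊆ V)
    (hψ : ∀ t, (ψ t : ℂ) = expi θ t) (ν : Measure (unip n D)) [ν.IsHaarMeasure]
    (a : Fin n → ℝˣ) : schwartzAlong (E := Herm n D) detR V →ₗ[ℂ] ℂ where
  toFun Φ := regularIntegral ψ ν Φ.1 a
  map_add' Φ Ψ := by
    obtain ⟨c, -, h⟩ := exists_regularIntegral_eq' hψ ν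
    rw [h, h, h, ← mul_add, OI, OI, OI,
      ← integral_add (integrable_OI_diagA hV hV0 Φ.2 a) (integrable_OI_diagA hV hV0 Ψ.2 a)]
    simp only [Submodule.coe_add, Pi.add_apply, add_mul]
  map_smul' c Φ := by
    obtain ⟨c', -, h⟩ := exists_regularIntegral_eq' hψ ν
    rw [h, h, RingHom.id_apply, smul_eq_mul, mul_left_comm, ← OI_const_mul θ _ _ c]
    rfl

/-- The orbital integral of a function that is Schwartz along the determinant is the orbital
integral of a Schwartz function. -/
theorem orbitFun_congr {g : Herm n D} (hg : IsRelevant ψ g) (hgV : detR g ∈ V)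
    {Φ φ : Herm n D → ℂ} {h : ℝ → ℂ} (h1 : h (detR g) = 1)
    (hφ : ∀ x, detR x ∈ V → φ x = h (detR x) * Φ x) :
    orbitFun ψ Φ g hg = orbitFun ψ φ g hg := by
  funext q
  induction q using Quotient.inductionOn with
  | _ v =>
  change Φ (act v⁻¹ g) * (chi ψ v⁻¹ : ℂ) = φ (act v⁻¹ g) * (chi ψ v⁻¹ : ℂ)
  rw [hφ _ (by rwa [detR_act]), detR_act, h1, one_mul]

theorem integrable_orbitFun (hV : IsOpen V) (hθ : θ ≠ 0) (hψ : ∀ t, (ψ t : ℂ) = expi θ t)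
    {g : Herm n D} (hg : IsRelevant ψ g) (hgV : detR g ∈ V) (μ : Measure (unip n D ⧸ stab g))
    [IsLocallyFiniteMeasure μ] [SMulInvariantMeasure (unip n D) (unip n D ⧸ stab g) μ]
    {Φ : Herm n D → ℂ} (hΦ : Φ ∈ schwartzAlong (E := Herm n D) detR V) :
    Integrable (orbitFun ψ Φ g hg) μ := by
  obtain ⟨u, hu, P, hP⟩ := (isRel_of_isRelevant hψ hg).exists_std hθ
  have hc : IsChart (act (unipOf hu.isSUT) g) P := by
    rw [act_eq_hact, unipOf_coe, add_sub_cancel]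
    exact hP.isChart
  obtain ⟨κ, h2⟩ := exists_orbitIntegral_eq' hψ hg _ hc μ
  obtain ⟨h, h1, h3⟩ := exists_isSchwartz_of_mem_schwartzAlong (E := Herm n D) (p := detR) hV hgV
  obtain ⟨φ, hφ, h4⟩ := h3 Φ hΦ
  rw [orbitFun_congr hg hgV h1 h4]
  exact (h2 φ hφ).1

theorem orbitIntegral_eq_zero (hV : IsOpen V) (hV0 : {0}ᶜ ⊆ V) (hθ : θ ≠ 0)
    (hψ : ∀ t, (ψ t : ℂ) = expi θ t) (ν : Measure (unip n D)) [ν.IsHaarMeasure]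
    {g : Herm n D} (hg : IsRelevant ψ g) (hgV : detR g ∈ V) (μ : Measure (unip n D ⧸ stab g))
    [IsLocallyFiniteMeasure μ] [SMulInvariantMeasure (unip n D) (unip n D ⧸ stab g) μ]
    {Φ : Herm n D → ℂ} (hΦ : Φ ∈ schwartzAlong (E := Herm n D) detR V)
    (hreg : ∀ a : Fin n → ℝˣ, regularIntegral ψ ν Φ a = 0) :
    orbitIntegral ψ Φ g hg μ = 0 := by
  obtain ⟨u, hu, P, hP⟩ := (isRel_of_isRelevant hψ hg).exists_std hθ
  have hP' : Std n (act (unipOf hu.isSUT) g) P := by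
    rwa [act_eq_hact, unipOf_coe, add_sub_cancel]
  obtain ⟨κ, h2⟩ := exists_orbitIntegral_eq' hψ hg _ hP'.isChart μ
  obtain ⟨h, h1, h3⟩ := exists_isSchwartz_of_mem_schwartzAlong (E := Herm n D) (p := detR) hV hgV
  obtain ⟨φ, hφ, h4⟩ := h3 Φ hΦ
  obtain ⟨c, hc, h5⟩ := exists_regularIntegral_eq' hψ ν
  rw [orbitIntegral, orbitFun_congr hg hgV h1 h4, ← orbitIntegral, (h2 φ hφ).2,
    hP'.isLimit hθ φ hφ, mul_zero]
  intro a
  have h6 := hreg a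
  rw [h5] at h6
  rw [← mul_zero (h (detR (diagA (D := D) a))), ← (mul_eq_zero.1 h6).resolve_left hc,
    ← OI_const_mul, OI, OI]
  simp only [OI_congr (IsChart.diagA a) (hV0 (detR_diagA_ne_zero a)) h4]

/-- The orbital integral as a functional. -/
noncomputable def orbitFunctional (hV : IsOpen V) (hθ : θ ≠ 0) (hψ : ∀ t, (ψ t : ℂ) = expi θ t)
    {g : Herm n D} (hg : IsRelevant ψ g) (hgV : detR g ∈ V) (μ : Measure (unip n D ⧸ stab g))
    [IsLocallyFiniteMeasure μ] [SMulInvariantMeasure (unip n D) (unip n D ⧸ stab g) μ] :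
    schwartzAlong (E := Herm n D) detR V →ₗ[ℂ] ℂ where
  toFun Φ := orbitIntegral ψ Φ.1 g hg μ
  map_add' Φ Ψ := by
    rw [orbitIntegral, orbitIntegral, orbitIntegral, ← integral_add
      (integrable_orbitFun hV hθ hψ hg hgV μ Φ.2) (integrable_orbitFun hV hθ hψ hg hgV μ Ψ.2)]
    congr 1
    funext q
    induction q using Quotient.inductionOn with
    | _ v => exact add_mul _ _ _
  map_smul' c Φ := by
    rw [orbitIntegral, orbitIntegral, RingHom.id_apply, smul_eq_mul, ← integral_const_mul]
    congr 1
    funext q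
    induction q using Quotient.inductionOn with
    | _ v => exact mul_assoc _ _ _

/-- The regular orbital integrals are dense among all orbital integrals. -/
theorem regularIntegral_dense (hV : IsOpen V) (hV0 : {0}ᶜ ⊆ V) (hθ : θ ≠ 0)
    (hψ : ∀ t, (ψ t : ℂ) = expi θ t) (ν : Measure (unip n D)) (hν : ν.IsHaarMeasure)
    {g : Herm n D} (hg : IsRelevant ψ g) (hgV : detR g ∈ V) (μ : Measure (unip n D ⧸ stab g))
    (hμ : IsLocallyFiniteMeasure μ)
    (hμ' : SMulInvariantMeasure (unip n D) (unip n D ⧸ stab g) μ) :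
    (∀ Φ ∈ schwartzAlongDet n D V, Integrable (orbitFun ψ Φ g hg) μ) ∧
    (∀ Φ ∈ schwartzAlongDet n D V, (∀ a : Fin n → ℝˣ, regularIntegral ψ ν Φ a = 0) →
      orbitIntegral ψ Φ g hg μ = 0) ∧
    (fun Φ : schwartzAlongDet n D V => orbitIntegral ψ Φ.1 g hg μ) ∈
      closure (Submodule.span ℂ (Set.range fun (a : Fin n → ℝˣ)
        (Φ : schwartzAlongDet n D V) => regularIntegral ψ ν Φ.1 a) :
        Set (schwartzAlongDet n D V → ℂ)) :=
  ⟨fun _ hΦ => integrable_orbitFun hV hθ hψ hg hgV μ hΦ,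
    fun _ hΦ hreg => orbitIntegral_eq_zero hV hV0 hθ hψ ν hg hgV μ hΦ hreg,
    mem_closure_span_of_forall (regularFunctional hV hV0 hψ ν)
      (orbitFunctional hV hθ hψ hg hgV μ) fun Φ hreg =>
        orbitIntegral_eq_zero hV hV0 hθ hψ ν hg hgV μ Φ.2 hreg⟩

end Final

end Kloosterman

theorem mainTheorem5
    (D : Type*) [NormedCommRing D] [NormedAlgebra ℝ D] [IsSemisimpleRing D]
    (hD : Module.finrank ℝ D = 2)
    [StarRing D] [StarModule ℝ D] (hstar : ∃ d : D, star d ≠ d)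
    (n : ℕ) (ψ : AddChar ℝ Circle) (hψ : Continuous ψ) (hψ1 : ψ ≠ 1)
    (ν : MeasureTheory.Measure (Kloosterman.unip n D)) [ν.IsHaarMeasure]
    (V : Set ℝ) (hV : V = Set.univ ∨ V = {0}ᶜ)
    (g : Kloosterman.Herm n D) (hg : Kloosterman.IsRelevant ψ g) (hgV : Kloosterman.detR g ∈ V)
    (μ : MeasureTheory.Measure (Kloosterman.unip n D ⧸ Kloosterman.stab g))
    [MeasureTheory.IsLocallyFiniteMeasure μ]
    [MeasureTheory.SMulInvariantMeasure (Kloosterman.unip n D)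
      (Kloosterman.unip n D ⧸ Kloosterman.stab g) μ] :
    (∀ Φ ∈ Kloosterman.schwartzAlongDet n D V,
      MeasureTheory.Integrable (Kloosterman.orbitFun ψ Φ g hg) μ) ∧
    (∀ Φ ∈ Kloosterman.schwartzAlongDet n D V,
      (∀ a : Fin n → ℝˣ, Kloosterman.regularIntegral ψ ν Φ a = 0) →
      Kloosterman.orbitIntegral ψ Φ g hg μ = 0) ∧
    (fun Φ : Kloosterman.schwartzAlongDet n D V => Kloosterman.orbitIntegral ψ Φ.1 g hg μ) ∈
      closure (Submodule.span ℂ (Set.range fun (a : Fin n → ℝˣ)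
        (Φ : Kloosterman.schwartzAlongDet n D V) => Kloosterman.regularIntegral ψ ν Φ.1 a) :
        Set (Kloosterman.schwartzAlongDet n D V → ℂ)) := by
  have : Nontrivial D := Module.nontrivial_of_finrank_pos (R := ℝ) (by omega)
  have : FiniteDimensional ℝ D := Module.finite_of_finrank_pos (by omega)
  -- A commutative semisimple ring is reduced.
  have : Kloosterman.IsQuadratic D := Kloosterman.isQuadratic_of_finrank_eq_two hD hstar
  obtain ⟨θ, hθψ⟩ := Kloosterman.exists_eq_expi hψ
  have hθ : θ ≠ 0 := by
    rintro rfl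
    refine hψ1 (DFunLike.ext _ _ fun t => Circle.ext ?_)
    rw [hθψ, Kloosterman.expi, Complex.ofReal_zero, zero_mul, zero_mul, Complex.exp_zero]
    rfl
  have hVo : IsOpen V := by
    rcases hV with rfl | rfl
    · exact isOpen_univ
    · exact isOpen_compl_singleton
  have hV0 : {0}ᶜ ⊆ V := by
    rcases hV with rfl | rfl
    · exact Set.subset_univ _
    · exact subset_rfl
  have hν : ν.IsHaarMeasure := inferInstance
  have hμ : MeasureTheory.IsLocallyFiniteMeasure μ := inferInstance
  exact Kloosterman.regularIntegral_dense hVo hV0 hθ hθψ ν hν hg hgV μ hμ inferInstance
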